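/- **Setting.** An access structure on $[n]$ is a family $\mathbb S\subseteq\mathcal P([n])$ closed under supersets; its members are called authorized. All registers are finite-dimensional, secrets and classical shares are bit strings, and two secrets that are compared have the same length. *Classical scheme for $\mathbb S$.* Algorithms $\mathsf{CSplit}_{\mathbb S}(s)\to(\mathsf{sh}_1,\dots,\mathsf{sh}_n)$ and $\mathsf{CReconstruct}_{\mathbb S}$, for secrets of every length (the share lengths depend only on the party and on the length of the secret), such that every authorized set of shares reconstructs $s$ with probability $1$ (correctness) and the joint distribution of any unauthorized set of shares does not depend on $s$ (perfect privacy). *2-out-of-2 scheme with certified deletion.* $\mathsf{Split}_{2\text-2}(1^\kappa,s)$ outputs a quantum share $|\mathsf{qsh}\rangle$, a classical share $\mathsf{csh}$ and a verification key $\mathsf{vk}$; $\mathsf{Reconstruct}_{2\text-2}(|\mathsf{qsh}\rangle,\mathsf{csh})=s$ with probability $1$; $\mathsf{Verify}_{2\text-2}(\mathsf{vk},\mathsf{Delete}_{2\text-2}(|\mathsf{qsh}\rangle))=\top$ with probability $1$. It is *private* if neither share alone depends on $s$. It is *deletion secure* if, for all secrets of any fixed length and every unbounded adversary that maps $|\mathsf{qsh}\rangle$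 to a certificate and a register $\mathcal R$, the outputs of the following game for any two secrets have trace distance $2^{-\Omega(\kappa)}$: output $(\mathcal R,\mathsf{csh})$ if the certificate is accepted, and $\bot$ otherwise. For $L:\mathbb N\to\mathbb N$ it is *deletion secure up to length $L$* if there are $a>0$ and $\kappa_0$ such that for all $\kappa\ge\kappa_0$ this trace distance is at most $2^{-a\kappa}$ for all secrets of length at most $L(\kappa)$ and all adversaries. *Secret sharing with certified deletion.* $\mathsf{Split}(1^\lambda,s)$ outputs share registers $\mathcal S_1,\dots,\mathcal S_n$ and a key $\mathsf{vk}$; *correctness* means that every authorized set of registers reconstructs $s$ with probability $1$ and that $\mathsf{Verify}(\mathsf{vk},i,\mathsf{Delete}(\mathcal S_i))=\top$ with probability $1$ for every $i$. *No-signaling certified deletion game:* let $P=(P_1,\dots,P_\ell)$ be a partition of $[n]$ that is admissible, i.e. each $P_t$ is unauthorized, and let $|\psi\rangle$ be a state on registers $\mathcal R_1,\dots,\mathcal R_\ell$. Each of $\ell$ unbounded, non-communicating adversaries $\mathsf{Adv}_t$ receives $\{\mathcal S_i\}_{i\in P_t}$ and $\mathcal R_t$ and outputs certificates $\{\mathsf{cert}_i\}_{i\in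 P_t}$ (possibly $\bot$, which is rejected) and a register $\mathcal R_t'$. If every authorized set contains some $i$ with $\mathsf{Verify}(\mathsf{vk},i,\mathsf{cert}_i)=\top$, the output is $(\mathcal R_1',\dots,\mathcal R_\ell')$, otherwise $\bot$. The *advantage* is the trace distance between the outputs for two secrets $s_0,s_1$. The scheme is *no-signaling certified deletion secure* if the supremum of the advantage over all admissible partitions, all states $|\psi\rangle$, all such adversaries and all pairs of secrets is negligible in $\lambda$ (equivalently, the advantage is negligible for every sequence of these data indexed by $\lambda$). *Compiled scheme.* Given a classical scheme for $\mathbb S$ and a 2-out-of-2 scheme, $\mathsf{Split}_{\mathbb S}(1^\lambda,s)$ samples $(\mathsf{sh}_i)_i\leftarrow\mathsf{CSplit}_{\mathbb S}(s)$, sets $\kappa=\max(\lambda,n)^2$, samples $(|\mathsf{qsh}_i\rangle,\mathsf{csh}_i,\mathsf{vk}_i)\leftarrow\mathsf{Split}_{2\text-2}(1^\kappa,\mathsf{sh}_i)$ and $(\mathsf{csh}_{i,1},\dots,\mathsf{csh}_{i,n})\leftarrow\mathsf{CSplit}_{\mathbb S}(\mathsf{csh}_i)$ for each $i$; the register $\mathcal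 S_i$ holds $|\mathsf{qsh}_i\rangle$ and $\{\mathsf{csh}_{j,i}\}_{j\in[n]}$, and $\mathsf{vk}=(\mathsf{vk}_1,\dots,\mathsf{vk}_n)$. To reconstruct from $P$, compute each $\mathsf{csh}_i$, $i\in P$, from $\{\mathsf{csh}_{i,j}\}_{j\in P}$ (output $\bot$ if this fails), then $\mathsf{sh}_i\leftarrow\mathsf{Reconstruct}_{2\text-2}(|\mathsf{qsh}_i\rangle,\mathsf{csh}_i)$, and output $\mathsf{CReconstruct}_{\mathbb S}(\{\mathsf{sh}_i\}_{i\in P})$. Deletion and verification of share $i$ are those of the $i$-th 2-out-of-2 instance. **Theorem.** 1. For every $n$, every access structure $\mathbb S$ on $[n]$, every correct and perfectly private classical scheme for $\mathbb S$, and every 2-out-of-2 scheme with certified deletion that satisfies reconstruction and deletion correctness, the compiled scheme is correct; if the 2-out-of-2 scheme is also deletion secure, then the compiled scheme is no-signaling certified deletion secure, for secrets of every length. 2. The exponential loss in $n$ is absorbed uniformly: if a 2-out-of-2 scheme is deletion secure up to length $L$, then there is one negligible function $\varepsilon$, depending only on that scheme and on $L$, such that for all $n$, all access structures $\mathbb S$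 on $[n]$, all perfectly private classical schemes for $\mathbb S$, all secret lengths and all $\lambda$ for which the first-level shares $\mathsf{sh}_i$ have length at most $L(\max(\lambda,n)^2)$, the advantage against the compiled scheme at $\lambda$ is at most $\varepsilon(\lambda)$ for every admissible partition, every state $|\psi\rangle$, every such adversary and every pair of secrets. 3. Consequently, for every $n$ and every access structure $\mathbb S$ on $[n]$ with $\emptyset\notin\mathbb S$, a secret sharing scheme with no-signaling certified deletion security exists unconditionally: there is a 2-out-of-2 scheme that is correct, private, deletion correct and deletion secure, and for each such $\mathbb S$ a correct and perfectly private classical scheme, such that for secrets of every length the compiled scheme is correct and no-signaling certified deletion secure. -/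

import Mathlib

namespace CertDel

open Matrix
open scoped ComplexOrder Kronecker

noncomputable section

/-! ## Finite-dimensional quantum information

A register is a finite type `X` of basis labels.  A (sub-normalized) state of the register is a
positive semidefinite matrix in `Matrix X X ℂ`, and a joint register of `X i`, `i : ι`, has basis
labels `∀ i, X i`. -/

/-- Bit strings of length `m`. -/
abbrev Bits (m : ℕ) : Type := Fin m → Bool

/-- The trace norm: the sum of the singular values. -/
def traceNorm {X : Type} [Fintype X] [DecidableEq X] (A : Matrix X X ℂ) : ℝ :=
  ∑ i, Real.sqrt ((isHermitian_conjTranspose_mul_self A).eigenvalues i)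

/-- The trace distance. -/
def traceDist {X : Type} [Fintype X] [DecidableEq X] (ρ σ : Matrix X X ℂ) : ℝ :=
  traceNorm (ρ - σ) / 2

/-- A measurement with outcomes in `O`, given by its effects. -/
structure IsPOVM {O X : Type} [Fintype O] [Fintype X] [DecidableEq X]
    (M : O → Matrix X X ℂ) : Prop where
  pos : ∀ o, (M o).PosSemidef
  sum_eq_one : ∑ o, M o = 1

/-- A joint state of a classical value in `O` and of a quantum register `X`: the entry `ρ o` is the
state of the register, weighted by the probability of the value `o`. -/
structure IsEnsemble {O X : Type} [Fintype O] [Fintype X] [DecidableEq X]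
    (ρ : O → Matrix X X ℂ) : Prop where
  pos : ∀ o, (ρ o).PosSemidef
  trace_eq_one : ∑ o, (ρ o).trace = 1

/-- A quantum operation from `X` to a classical value in `O` and a register `Y`, in Kraus form.
On the state `ρ`, the value `o` is output with the (unnormalized) residual state
`∑ k, E o k * ρ * (E o k)ᴴ`. -/
def IsInstrument {O K X Y : Type} [Fintype O] [Fintype K] [Fintype X] [DecidableEq X] [Fintype Y]
    (E : O → K → Matrix Y X ℂ) : Prop :=
  ∑ o, ∑ k, (E o k)ᴴ * E o k = 1

/-- The tensor product of operators on the registers `X i`. -/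
def piTensor {ι : Type} [Fintype ι] {X Y : ι → Type} (A : ∀ i, Matrix (Y i) (X i) ℂ) :
    Matrix (∀ i, Y i) (∀ i, X i) ℂ :=
  Matrix.of fun y x => ∏ i, A i (y i) (x i)

/-- The basis projection `|d⟩⟨d|`, that is, a register that holds the classical value `d`. -/
def ketbra {X : Type} [DecidableEq X] (d : X) : Matrix X X ℂ := Matrix.single d d 1

/-- The operator `M` on the registers in `P`, tensored with the identity on all others. -/
def onSubset {ι : Type} [Fintype ι] [DecidableEq ι] {X : ι → Type} [∀ i, DecidableEq (X i)]
    (P : Finset ι) (M : Matrix (∀ i : P, X i) (∀ i : P, X i) ℂ) :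
    Matrix (∀ i, X i) (∀ i, X i) ℂ :=
  Matrix.of fun x y => if ∀ i, i ∉ P → x i = y i then M (fun i => x i) (fun i => y i) else 0

/-- The operator `M` on the single register `i`, tensored with the identity on all others. -/
def onSingle {ι : Type} [Fintype ι] [DecidableEq ι] {X : ι → Type} [∀ i, DecidableEq (X i)]
    (i : ι) (M : Matrix (X i) (X i) ℂ) : Matrix (∀ i, X i) (∀ i, X i) ℂ :=
  Matrix.of fun x y => if ∀ j, j ≠ i → x j = y j then M (x i) (y i) else 0

/-- The state `σ`, regarded as a state of a register that may also hold the symbol `⊥`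
(which is `none`) but does not. -/
def accepting {X : Type} (σ : Matrix X X ℂ) : Matrix (Option X) (Option X) ℂ :=
  Matrix.of fun x y =>
    match x, y with
    | some x, some y => σ x y
    | _, _ => 0

/-- The state in which `σ` has been discarded and replaced by the symbol `⊥`. -/
def rejecting {X : Type} [Fintype X] [DecidableEq X] (σ : Matrix X X ℂ) :
    Matrix (Option X) (Option X) ℂ :=
  σ.trace • ketbra none

lemma piTensor_mul {ι : Type} [Fintype ι] [DecidableEq ι] {X Y Z : ι → Type}
    [∀ i, Fintype (Y i)] (A : ∀ i, Matrix (Z i) (Y i) ℂ) (B : ∀ i, Matrix (Y i) (X i) ℂ) :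
    piTensor A * piTensor B = piTensor fun i => A i * B i := by
  ext z x
  simp [piTensor, Matrix.mul_apply, Finset.prod_univ_sum, Fintype.piFinset_univ,
    Finset.prod_mul_distrib]

lemma piTensor_conjTranspose {ι : Type} [Fintype ι] {X Y : ι → Type}
    (A : ∀ i, Matrix (Y i) (X i) ℂ) : (piTensor A)ᴴ = piTensor fun i => (A i)ᴴ := by
  ext x y
  simp [piTensor, Matrix.conjTranspose_apply, star_prod]

lemma piTensor_one {ι : Type} [Fintype ι] {X : ι → Type} [∀ i, DecidableEq (X i)]
    [DecidableEq (∀ i, X i)] :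
    piTensor (fun i => (1 : Matrix (X i) (X i) ℂ)) = 1 := by
  ext x y
  simp only [piTensor, Matrix.of_apply, Matrix.one_apply, funext_iff]
  rw [Finset.prod_ite_zero]
  simp

lemma piTensor_sum {ι : Type} [Fintype ι] [DecidableEq ι] {X Y O : ι → Type} [∀ i, Fintype (O i)]
    (A : ∀ i, O i → Matrix (Y i) (X i) ℂ) :
    ∑ f : ∀ i, O i, piTensor (fun i => A i (f i)) = piTensor fun i => ∑ o, A i o := by
  ext y x
  simp [piTensor, Matrix.sum_apply, Finset.prod_univ_sum, Fintype.piFinset_univ]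

lemma piTensor_trace {ι : Type} [Fintype ι] [DecidableEq ι] {X : ι → Type} [∀ i, Fintype (X i)]
    (A : ∀ i, Matrix (X i) (X i) ℂ) : (piTensor A).trace = ∏ i, (A i).trace := by
  simp [piTensor, Matrix.trace, Finset.prod_univ_sum, Fintype.piFinset_univ]

lemma piTensor_posSemidef {ι : Type} [Fintype ι] [DecidableEq ι] {X : ι → Type}
    [∀ i, Fintype (X i)] [∀ i, DecidableEq (X i)] {A : ∀ i, Matrix (X i) (X i) ℂ}
    (hA : ∀ i, (A i).PosSemidef) : (piTensor A).PosSemidef := by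
  have h : ∀ i, ∃ B : Matrix (X i) (X i) ℂ, A i = Bᴴ * B := fun i => by
    open scoped MatrixOrder in
    obtain ⟨B, hB⟩ := CStarAlgebra.nonneg_iff_eq_star_mul_self.mp
      (Matrix.nonneg_iff_posSemidef.mpr (hA i))
    exact ⟨B, hB⟩
  choose B hB using h
  have : piTensor A = (piTensor B)ᴴ * piTensor B := by
    rw [piTensor_conjTranspose, piTensor_mul]
    simp_rw [← hB]
  rw [this]
  exact posSemidef_conjTranspose_mul_self _

lemma ketbra_posSemidef {X : Type} [Fintype X] [DecidableEq X] (d : X) :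
    (ketbra d).PosSemidef := by
  have : ketbra d = (ketbra d)ᴴ * ketbra d := by
    simp [ketbra, Matrix.conjTranspose_single]
  rw [this]
  exact posSemidef_conjTranspose_mul_self _

lemma ketbra_trace {X : Type} [Fintype X] [DecidableEq X] (d : X) : (ketbra d).trace = 1 := by
  simp [ketbra]

lemma ketbra_sum {X : Type} [Fintype X] [DecidableEq X] : ∑ d : X, ketbra d = 1 := by
  ext x y
  simp [ketbra, Matrix.sum_apply, Matrix.single_apply, Matrix.one_apply, ite_and]

lemma sum_kron {O X Y : Type} [Fintype O] (A : O → Matrix X X ℂ) (B : Matrix Y Y ℂ) :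
    (∑ o, A o) ⊗ₖ B = ∑ o, A o ⊗ₖ B := by
  ext x y
  simp [Matrix.sum_apply, Finset.sum_mul]

lemma kron_sum {O X Y : Type} [Fintype O] (A : Matrix X X ℂ) (B : O → Matrix Y Y ℂ) :
    A ⊗ₖ (∑ o, B o) = ∑ o, A ⊗ₖ B o := by
  ext x y
  simp [Matrix.sum_apply, Finset.mul_sum]

lemma sum_toReal {X : Type} [Fintype X] (p : PMF X) : ∑ x, (p x).toReal = 1 := by
  rw [← ENNReal.toReal_sum (fun x _ => p.apply_ne_top x)]
  have := p.tsum_coe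
  rw [tsum_fintype] at this
  simp [this]

/-! ## Classical secret sharing -/

/-- The two algorithms of a classical secret sharing scheme for `n` parties.  Secrets and shares are
bit strings; the scheme shares secrets of every length `m`, and `shareLen m i` is the length of
the share of party `i`. -/
structure ClassicalScheme (n : ℕ) where
  shareLen : ℕ → Fin n → ℕ
  split : ∀ m, Bits m → PMF (∀ i, Bits (shareLen m i))
  reconstruct : ∀ (m) (P : Finset (Fin n)), (∀ i : P, Bits (shareLen m i)) → Option (Bits m)

namespace ClassicalScheme

variable {n : ℕ}

/-- Authorized sets reconstruct the secret with probability one. -/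
def Correct (C : ClassicalScheme n) (S : UpperSet (Finset (Fin n))) : Prop :=
  ∀ m (s : Bits m), ∀ P ∈ S,
    (C.split m s).map (fun sh => C.reconstruct m P fun i => sh i) = PMF.pure (some s)

/-- Perfect privacy: the shares of an unauthorized set can be sampled without the secret. -/
def Private (C : ClassicalScheme n) (S : UpperSet (Finset (Fin n))) : Prop :=
  ∃ Sim : ∀ (m) (P : Finset (Fin n)), PMF (∀ i : P, Bits (C.shareLen m i)),
    ∀ m, ∀ P ∉ S, ∀ s : Bits m,
      (C.split m s).map (fun sh => fun i : P => sh i) = Sim m P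

end ClassicalScheme

/-! ## 2-out-of-2 secret sharing with certified deletion -/

/-- The algorithms of a 2-out-of-2 secret sharing scheme with certified deletion, for every
security parameter `κ` and all secrets of every bit length `m`.  The first share is a quantum
register with basis `Q κ m`, the second one a bit string.  `split κ m s (c, vk)` is the state of the
quantum share weighted by the probability of the classical share `c` and verification key `vk`. -/
structure TwoOfTwo where
  Q : ℕ → ℕ → Type
  [fintypeQ : ∀ κ m, Fintype (Q κ m)]
  [decEqQ : ∀ κ m, DecidableEq (Q κ m)]
  cshLen : ℕ → ℕ → ℕ
  VK : ℕ → ℕ → Type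
  [fintypeVK : ∀ κ m, Fintype (VK κ m)]
  Cert : ℕ → ℕ → Type
  [fintypeCert : ∀ κ m, Fintype (Cert κ m)]
  split : ∀ κ m, Bits m → Bits (cshLen κ m) × VK κ m → Matrix (Q κ m) (Q κ m) ℂ
  split_isEnsemble : ∀ κ m s, IsEnsemble (split κ m s)
  reconstruct : ∀ κ m, Bits (cshLen κ m) → Bits m → Matrix (Q κ m) (Q κ m) ℂ
  reconstruct_isPOVM : ∀ κ m c, IsPOVM (reconstruct κ m c)
  delete : ∀ κ m, Cert κ m → Matrix (Q κ m) (Q κ m) ℂ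
  delete_isPOVM : ∀ κ m, IsPOVM (delete κ m)
  verify : ∀ κ m, VK κ m → Cert κ m → Bool

attribute [instance] TwoOfTwo.fintypeQ TwoOfTwo.decEqQ TwoOfTwo.fintypeVK TwoOfTwo.fintypeCert

namespace TwoOfTwo

/-- The two shares together determine the secret. -/
def Correct (T : TwoOfTwo) : Prop :=
  ∀ κ m (s : Bits m), ∑ c, ∑ vk, (T.reconstruct κ m c s * T.split κ m s (c, vk)).trace = 1

/-- Perfect privacy: neither of the two shares alone depends on the secret. -/
def Private (T : TwoOfTwo) : Prop :=
  ∀ κ m,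
    (∃ ρ : Matrix (T.Q κ m) (T.Q κ m) ℂ, ∀ s, ∑ c, ∑ vk, T.split κ m s (c, vk) = ρ) ∧
    (∃ p : Bits (T.cshLen κ m) → ℂ, ∀ s c, ∑ vk, (T.split κ m s (c, vk)).trace = p c)

/-- Honestly produced deletion certificates are accepted with probability one. -/
def DeletionCorrect (T : TwoOfTwo) : Prop :=
  ∀ κ m (s : Bits m), ∑ c, ∑ vk, ∑ cert,
    (if T.verify κ m vk cert = true then (T.delete κ m cert * T.split κ m s (c, vk)).trace else 0)
      = 1

/-- An unbounded adversary for the certified deletion game: a quantum operation that takes the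
quantum share to a certificate and a residual register `R`.  The certificate `none` stands for `⊥`
(no certificate is produced). -/
structure Adversary (T : TwoOfTwo) (κ m : ℕ) where
  R : Type
  [fintypeR : Fintype R]
  [decEqR : DecidableEq R]
  K : Type
  [fintypeK : Fintype K]
  E : Option (T.Cert κ m) → K → Matrix R (T.Q κ m) ℂ
  isInstrument : IsInstrument E

attribute [instance] Adversary.fintypeR Adversary.decEqR Adversary.fintypeK

/-- The verification algorithm, extended so as to reject the certificate `⊥`. -/
def accepts (T : TwoOfTwo) (κ m : ℕ) (vk : T.VK κ m) : Option (T.Cert κ m) → Bool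
  | none => false
  | some cert => T.verify κ m vk cert

/-- The output state of the certified deletion game: the residual register of the adversary
together with the classical share if the certificate is accepted, and `⊥` otherwise. -/
def experiment (T : TwoOfTwo) (κ m : ℕ) (A : T.Adversary κ m) (s : Bits m) :
    Matrix (Option (A.R × Bits (T.cshLen κ m))) (Option (A.R × Bits (T.cshLen κ m))) ℂ :=
  ∑ c, ∑ vk, ∑ cert,
    let σ := (∑ k, A.E cert k * T.split κ m s (c, vk) * (A.E cert k)ᴴ) ⊗ₖ ketbra c
    if T.accepts κ m vk cert = true then accepting σ else rejecting σ

/-- Certified deletion security with trace distance `2^(-Ω(κ))`, uniformly over all secrets of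
at most `L κ` bits. -/
def DeletionSecureUpTo (T : TwoOfTwo) (L : ℕ → ℕ) : Prop :=
  ∃ a : ℝ, 0 < a ∧ ∃ κ₀ : ℕ, ∀ κ, κ₀ ≤ κ → ∀ m, m ≤ L κ →
    ∀ (A : T.Adversary κ m) (s₀ s₁ : Bits m),
      traceDist (T.experiment κ m A s₀) (T.experiment κ m A s₁) ≤ (2 : ℝ) ^ (-(a * κ))

/-- Certified deletion security with trace distance `2^(-Ω(κ))`, for secrets of any fixed length.
As the adversaries are arbitrary at each `κ`, a bound for each sequence of adversaries
is the same as this uniform bound. -/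
def DeletionSecure (T : TwoOfTwo) : Prop :=
  ∀ m : ℕ, T.DeletionSecureUpTo fun _ => m

end TwoOfTwo

/-! ## Secret sharing with certified deletion for `n` parties -/

/-- The algorithms of a secret sharing scheme with certified deletion for `n` parties and secrets
in `M`.  The first argument is the security parameter.  The share of party `i` is a quantum
register with basis `Reg sec i`.  `split sec s vk` is the joint state of the `n` share registers
weighted by the probability of the verification key `vk`.  The outcome `none` of `reconstruct` stands
for `⊥`. -/
structure Scheme (n : ℕ) (M : Type) [Fintype M] where
  Reg : ℕ → Fin n → Type
  [fintypeReg : ∀ sec i, Fintype (Reg sec i)]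
  [decEqReg : ∀ sec i, DecidableEq (Reg sec i)]
  VK : ℕ → Type
  [fintypeVK : ∀ sec, Fintype (VK sec)]
  Cert : ℕ → Fin n → Type
  [fintypeCert : ∀ sec i, Fintype (Cert sec i)]
  split : ∀ sec, M → VK sec → Matrix (∀ i, Reg sec i) (∀ i, Reg sec i) ℂ
  split_isEnsemble : ∀ sec s, IsEnsemble (split sec s)
  reconstruct : ∀ (sec) (P : Finset (Fin n)),
    Option M → Matrix (∀ i : P, Reg sec i) (∀ i : P, Reg sec i) ℂ
  reconstruct_isPOVM : ∀ sec P, IsPOVM (reconstruct sec P)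
  delete : ∀ sec i, Cert sec i → Matrix (Reg sec i) (Reg sec i) ℂ
  delete_isPOVM : ∀ sec i, IsPOVM (delete sec i)
  verify : ∀ sec, VK sec → ∀ i, Cert sec i → Bool

attribute [instance] Scheme.fintypeReg Scheme.decEqReg Scheme.fintypeVK Scheme.fintypeCert

namespace Scheme

variable {n : ℕ} {M : Type} [Fintype M]

/-- Authorized sets reconstruct the secret with probability one. -/
def ReconstructionCorrect (D : Scheme n M) (S : UpperSet (Finset (Fin n))) : Prop :=
  ∀ sec (s : M), ∀ P ∈ S,
    ∑ vk, (onSubset P (D.reconstruct sec P (some s)) * D.split sec s vk).trace = 1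

/-- Honestly produced deletion certificates are accepted with probability one. -/
def DeletionCorrect (D : Scheme n M) : Prop :=
  ∀ sec (s : M) (i : Fin n), ∑ vk, ∑ cert,
    (if D.verify sec vk i cert = true then
      (onSingle i (D.delete sec i cert) * D.split sec s vk).trace else 0) = 1

/-- An unbounded `ℓ`-part adversary.  The part `t` holds the shares of the parties `i` with
`part i = t` and one register of the `ℓ`-part state `ψ`.  It applies a quantum operation to these
that outputs a certificate for each of its shares (`none` stands for `⊥`: no
certificate for this share) and a residual register `Out t`. -/
structure Adversary (D : Scheme n M) (sec ℓ : ℕ) where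
  part : Fin n → Fin ℓ
  In : Fin ℓ → Type
  [fintypeIn : ∀ t, Fintype (In t)]
  [decEqIn : ∀ t, DecidableEq (In t)]
  ψ : (∀ t, In t) → ℂ
  ψ_norm : ∑ r, ‖ψ r‖ ^ 2 = 1
  Out : Fin ℓ → Type
  [fintypeOut : ∀ t, Fintype (Out t)]
  [decEqOut : ∀ t, DecidableEq (Out t)]
  K : Fin ℓ → Type
  [fintypeK : ∀ t, Fintype (K t)]
  E : ∀ t, (∀ i : {i // part i = t}, Option (D.Cert sec i)) → K t →
    Matrix (Out t) ((∀ i : {i // part i = t}, D.Reg sec i) × In t) ℂ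
  isInstrument : ∀ t, IsInstrument (E t)

attribute [instance] Adversary.fintypeIn Adversary.decEqIn Adversary.fintypeOut
  Adversary.decEqOut Adversary.fintypeK

namespace Adversary

variable {D : Scheme n M} {sec ℓ : ℕ}

/-- Each part of the partition is unauthorized. -/
def Admissible (A : D.Adversary sec ℓ) (S : UpperSet (Finset (Fin n))) : Prop :=
  ∀ t, (Finset.univ.filter fun i => A.part i = t) ∉ S

/-- The tensor product over `t` of the Kraus operators with index `k t` for which part `t`
outputs the certificates `cert i` of its shares. -/
def joint (A : D.Adversary sec ℓ) (cert : ∀ i, Option (D.Cert sec i)) (k : ∀ t, A.K t) :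
    Matrix (∀ t, A.Out t) ((∀ i, D.Reg sec i) × (∀ t, A.In t)) ℂ :=
  Matrix.of fun y x => ∏ t, A.E t (fun i => cert i) (k t) (y t) (fun i => x.1 i, x.2 t)

end Adversary

/-- The verification algorithm, extended so as to reject the certificate `⊥`. -/
def accepts (D : Scheme n M) (sec : ℕ) (vk : D.VK sec) (i : Fin n) :
    Option (D.Cert sec i) → Bool
  | none => false
  | some cert => D.verify sec vk i cert

open Classical in
/-- The output state of the no-signaling certified deletion game: the residual registers of all
parts of the adversary if each authorized set contains a party whose certificate is accepted,
and `⊥` otherwise. -/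
def experiment (D : Scheme n M) (S : UpperSet (Finset (Fin n))) (sec ℓ : ℕ)
    (A : D.Adversary sec ℓ) (s : M) :
    Matrix (Option (∀ t, A.Out t)) (Option (∀ t, A.Out t)) ℂ :=
  ∑ vk, ∑ cert : ∀ i, Option (D.Cert sec i),
    let σ := ∑ k, A.joint cert k *
      (D.split sec s vk ⊗ₖ Matrix.vecMulVec A.ψ (star A.ψ)) * (A.joint cert k)ᴴ
    if ∀ P ∈ S, ∃ i ∈ P, D.accepts sec vk i (cert i) = true then accepting σ else rejecting σ

/-- At the security parameter `sec`, the real `ε` bounds the trace distance between the outputs of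
the no-signaling certified deletion game for any two secrets, for every adversary with an
admissible partition, any number `ℓ` of parts and any shared state. -/
def NSCDAdvantageLE (D : Scheme n M) (S : UpperSet (Finset (Fin n))) (sec : ℕ) (ε : ℝ) : Prop :=
  ∀ (ℓ : ℕ) (A : D.Adversary sec ℓ), A.Admissible S → ∀ s₀ s₁ : M,
    traceDist (D.experiment S sec ℓ A s₀) (D.experiment S sec ℓ A s₁) ≤ ε

end Scheme

/-- Negligible functions: smaller than every inverse polynomial. -/
def Negligible (ε : ℕ → ℝ) : Prop :=
  Asymptotics.SuperpolynomialDecay Filter.atTop (fun k : ℕ => (k : ℝ)) ε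

/-- No-signaling certified deletion security.  As the adversaries (partition, shared state,
operations) are arbitrary at each security parameter, negligible trace distance for each
sequence of adversaries and pairs of secrets is the same as this uniform bound. -/
def Scheme.NSCDSecure {n : ℕ} {M : Type} [Fintype M] (D : Scheme n M)
    (S : UpperSet (Finset (Fin n))) : Prop :=
  ∃ ε : ℕ → ℝ, Negligible ε ∧ ∀ sec, D.NSCDAdvantageLE S sec (ε sec)

/-! ## The construction -/

section Construction

variable {n : ℕ} (C : ClassicalScheme n) (T : TwoOfTwo) (m : ℕ)

/-- The security parameter `κ = max(λ, n)²` of the 2-out-of-2 scheme. -/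
def kappa (n sec : ℕ) : ℕ := max sec n ^ 2

/-- The length of the classical 2-out-of-2 share `csh_i` of the classical share `sh_i`. -/
abbrev clen (sec : ℕ) (i : Fin n) : ℕ := T.cshLen (kappa n sec) (C.shareLen m i)

/-- The classical part `{csh_{j,i}}_j` of the share of party `i`. -/
abbrev ClassicalPart (sec : ℕ) (i : Fin n) : Type :=
  ∀ j : Fin n, Bits (C.shareLen (clen C T m sec j) i)

/-- The share register of party `i`. -/
abbrev ShareReg (sec : ℕ) (i : Fin n) : Type :=
  T.Q (kappa n sec) (C.shareLen m i) × ClassicalPart C T m sec i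

/-- The splitting algorithm: the sum runs over the first-level shares `sh`, the classical
2-out-of-2 shares `csh`, and the second-level shares `cc j i`, which is `csh_{j,i}`. -/
def compileSplit (sec : ℕ) (s : Bits m) (vk : ∀ i, T.VK (kappa n sec) (C.shareLen m i)) :
    Matrix (∀ i, ShareReg C T m sec i) (∀ i, ShareReg C T m sec i) ℂ :=
  ∑ sh : ∀ i, Bits (C.shareLen m i), ∑ csh : ∀ i, Bits (clen C T m sec i),
    ∑ cc : ∀ j i, Bits (C.shareLen (clen C T m sec j) i),
      (((C.split m s sh).toReal * ∏ j, (C.split _ (csh j) (cc j)).toReal : ℝ) : ℂ) •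
        piTensor fun i =>
          T.split (kappa n sec) (C.shareLen m i) (sh i) (csh i, vk i) ⊗ₖ ketbra fun j => cc j i

/-- The classical first step of reconstruction: recover `csh_i` for all `i ∈ P` from the classical
parts `d` of the shares, or fail. -/
def decode (sec : ℕ) (P : Finset (Fin n)) (d : ∀ i : P, ClassicalPart C T m sec i) :
    Option (∀ i : P, Bits (clen C T m sec i)) :=
  if h : ∀ i : P, (C.reconstruct (clen C T m sec i) P fun j => d j i).isSome = true then
    some fun i => (C.reconstruct (clen C T m sec i) P fun j => d j i).get (h i)
  else none

/-- The reconstruction algorithm: read the classical parts `d`, recover the `csh_i` from them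
(output `⊥` if this fails), measure the `sh_i` with them, and reconstruct from the `sh_i`. -/
def compileReconstruct (sec : ℕ) (P : Finset (Fin n)) (o : Option (Bits m)) :
    Matrix (∀ i : P, ShareReg C T m sec i) (∀ i : P, ShareReg C T m sec i) ℂ :=
  ∑ d : ∀ i : P, ClassicalPart C T m sec i,
    match decode C T m sec P d with
    | none => if o = none then piTensor fun i => 1 ⊗ₖ ketbra (d i) else 0
    | some csh => ∑ sh : ∀ i : P, Bits (C.shareLen m i),
        if C.reconstruct m P sh = o then
          piTensor fun i =>
            T.reconstruct (kappa n sec) (C.shareLen m i) (csh i) (sh i) ⊗ₖ ketbra (d i)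
        else 0

lemma compileSplit_isEnsemble (sec : ℕ) (s : Bits m) : IsEnsemble (compileSplit C T m sec s) where
  pos vk := by
    refine posSemidef_sum _ fun sh _ => posSemidef_sum _ fun csh _ => posSemidef_sum _ fun cc _ => ?_
    refine PosSemidef.smul (piTensor_posSemidef fun i =>
      ((T.split_isEnsemble _ _ _).pos _).kronecker (ketbra_posSemidef _)) ?_
    exact_mod_cast mul_nonneg ENNReal.toReal_nonneg
      (Finset.prod_nonneg fun _ _ => ENNReal.toReal_nonneg)
  trace_eq_one := by
    have hT : ∀ sh : ∀ i, Bits (C.shareLen m i),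
        ∑ vk : ∀ i, T.VK (kappa n sec) (C.shareLen m i), ∑ csh : ∀ i, Bits (clen C T m sec i),
          ∏ i, (T.split (kappa n sec) (C.shareLen m i) (sh i) (csh i, vk i)).trace = 1 := by
      intro sh
      rw [Finset.sum_comm]
      have h : ∀ csh : ∀ i, Bits (clen C T m sec i),
          ∑ vk : ∀ i, T.VK (kappa n sec) (C.shareLen m i),
            ∏ i, (T.split (kappa n sec) (C.shareLen m i) (sh i) (csh i, vk i)).trace =
          ∏ i, ∑ v, (T.split (kappa n sec) (C.shareLen m i) (sh i) (csh i, v)).trace :=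
        fun csh => (Fintype.prod_sum (fun i v =>
          (T.split (kappa n sec) (C.shareLen m i) (sh i) (csh i, v)).trace)).symm
      simp_rw [h]
      rw [← Fintype.prod_sum (fun i c => ∑ v, (T.split (kappa n sec) (C.shareLen m i) (sh i)
        (c, v)).trace)]
      refine Finset.prod_eq_one fun i _ => ?_
      rw [← Fintype.sum_prod_type']
      exact (T.split_isEnsemble _ _ _).trace_eq_one
    have hC : ∀ csh : ∀ i, Bits (clen C T m sec i),
        ∑ cc : ∀ j i, Bits (C.shareLen (clen C T m sec j) i),
          ∏ j, (((C.split _ (csh j) (cc j)).toReal : ℝ) : ℂ) = 1 := by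
      intro csh
      rw [← Fintype.prod_sum (fun j x => (((C.split _ (csh j) x).toReal : ℝ) : ℂ))]
      refine Finset.prod_eq_one fun j _ => ?_
      exact_mod_cast sum_toReal _
    have hS : ∑ sh, (((C.split m s sh).toReal : ℝ) : ℂ) = 1 := by
      exact_mod_cast sum_toReal _
    have key : ∀ vk, (compileSplit C T m sec s vk).trace =
        ∑ sh, (((C.split m s sh).toReal : ℝ) : ℂ) * ∑ csh : ∀ i, Bits (clen C T m sec i),
          ∏ i, (T.split (kappa n sec) (C.shareLen m i) (sh i) (csh i, vk i)).trace := by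
      intro vk
      simp only [compileSplit, trace_sum, trace_smul, piTensor_trace, trace_kronecker,
        ketbra_trace, mul_one, smul_eq_mul]
      refine Finset.sum_congr rfl fun sh _ => ?_
      rw [Finset.mul_sum]
      refine Finset.sum_congr rfl fun csh _ => ?_
      rw [← Finset.sum_mul]
      congr 1
      push_cast
      rw [← Finset.mul_sum, hC, mul_one]
    simp_rw [key]
    rw [Finset.sum_comm]
    simp_rw [← Finset.mul_sum, hT, mul_one, hS]

lemma compileReconstruct_isPOVM (sec : ℕ) (P : Finset (Fin n)) :
    IsPOVM (compileReconstruct C T m sec P) where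
  pos o := by
    refine posSemidef_sum _ fun d _ => ?_
    split
    · split_ifs
      · exact piTensor_posSemidef fun i => PosSemidef.one.kronecker (ketbra_posSemidef _)
      · exact PosSemidef.zero
    · refine posSemidef_sum _ fun sh _ => ?_
      split_ifs
      · exact piTensor_posSemidef fun i =>
          ((T.reconstruct_isPOVM _ _ _).pos _).kronecker (ketbra_posSemidef _)
      · exact PosSemidef.zero
  sum_eq_one := by
    simp only [compileReconstruct]
    rw [Finset.sum_comm]
    have key : ∀ d : ∀ i : P, ClassicalPart C T m sec i,
        (∑ o : Option (Bits m), match decode C T m sec P d with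
          | none => if o = none then piTensor fun i : P =>
              (1 : Matrix (T.Q (kappa n sec) (C.shareLen m i)) _ ℂ) ⊗ₖ ketbra (d i) else 0
          | some csh => ∑ sh : ∀ i : P, Bits (C.shareLen m i),
              if C.reconstruct m P sh = o then
                piTensor fun i : P =>
                  T.reconstruct (kappa n sec) (C.shareLen m i) (csh i) (sh i) ⊗ₖ ketbra (d i)
              else 0) =
        piTensor fun i : P =>
          (1 : Matrix (T.Q (kappa n sec) (C.shareLen m i)) _ ℂ) ⊗ₖ ketbra (d i) := by
      intro d
      cases decode C T m sec P d with
      | none => simp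
      | some csh =>
        simp only
        rw [Finset.sum_comm]
        simp only [Finset.sum_ite_eq, Finset.mem_univ, if_true]
        rw [piTensor_sum (fun (i : P) x =>
          T.reconstruct (kappa n sec) (C.shareLen m i) (csh i) x ⊗ₖ ketbra (d i))]
        congr 1
        funext i
        rw [← (T.reconstruct_isPOVM _ _ (csh i)).sum_eq_one, sum_kron]
    rw [Finset.sum_congr rfl fun d _ => key d]
    rw [piTensor_sum (fun (i : P) x =>
      (1 : Matrix (T.Q (kappa n sec) (C.shareLen m i)) _ ℂ) ⊗ₖ ketbra x)]
    rw [← piTensor_one]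
    congr 1
    funext i
    rw [← kron_sum, ketbra_sum, one_kronecker_one]

lemma compileDelete_isPOVM (sec : ℕ) (i : Fin n) :
    IsPOVM fun cert => T.delete (kappa n sec) (C.shareLen m i) cert ⊗ₖ
      (1 : Matrix (ClassicalPart C T m sec i) (ClassicalPart C T m sec i) ℂ) where
  pos cert := ((T.delete_isPOVM _ _).pos _).kronecker PosSemidef.one
  sum_eq_one := by
    rw [← sum_kron, (T.delete_isPOVM _ _).sum_eq_one, one_kronecker_one]

/-- The secret sharing scheme with certified deletion for secrets of `m` bits that is obtained from
the classical scheme `C` and the 2-out-of-2 scheme `T`. -/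
def compile : Scheme n (Bits m) where
  Reg sec i := ShareReg C T m sec i
  VK sec := ∀ i, T.VK (kappa n sec) (C.shareLen m i)
  Cert sec i := T.Cert (kappa n sec) (C.shareLen m i)
  split sec s vk := compileSplit C T m sec s vk
  split_isEnsemble := compileSplit_isEnsemble C T m
  reconstruct sec P o := compileReconstruct C T m sec P o
  reconstruct_isPOVM := compileReconstruct_isPOVM C T m
  delete sec i cert := T.delete (kappa n sec) (C.shareLen m i) cert ⊗ₖ 1
  delete_isPOVM := compileDelete_isPOVM C T m
  verify sec vk i cert := T.verify (kappa n sec) (C.shareLen m i) (vk i) cert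

end Construction

end

end CertDel

/-! Both games output an unnormalized accepted state plus a multiple of `⊥`, with total trace one.
If the accepted states of two secrets differ by `P - N` with `P`, `N` positive and `tr P + tr N ≤
t`, the weights of `⊥` differ by at most `t` as well, so the trace distance is at most `t`
(`traceDist_gameOut_le`). The proof therefore manipulates such decompositions (`TNle`). They add up,
and pushing `P` and `N` through a trace-non-increasing completely positive map preserves the bound.

Security of the compiled scheme. The accepted state is split according to the exact set `V` of
parties whose certificates are accepted (`condState`). Acceptance means that the complement of `V`
is unauthorized, and there are at most `2 ^ n` such `V`. For `i ∈ V` the first-level share `sh_i`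
may be replaced by any other string at the cost `2δ`, where `δ` bounds the 2-out-of-2 deletion game
(`TNle_condState_of_eq_off`). The reduction prepares all other quantum shares and `ψ` around `qsh_i`
and runs the part that holds `i` before the others. That part sees second-level shares of `csh_i`
only for an unauthorized set, so by perfect privacy they can be sampled without `csh_i`. Once the
certificate for `i` is submitted and `csh_i` is revealed, the remaining second-level shares are
sampled conditionally on those already used and the other parts are run. Operations on different
tensor factors can be performed in any order, so this reproduces the game (`TNle_twoStage`). When
all `sh_i` with `i ∈ V` are constant, the state depends only on the shares outside `V`, whose law is
independent of the secret, again by privacy. Altogether the advantage is at most `2 ^ n * (4 * n *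
δ)`. With `δ = 2 ^ (-a * N ^ 2)` and `N = max(λ, n)` this is at most `4 * 2 ^ (-N)` as soon as `a *
N ≥ 3`, uniformly in `n`.

Correctness. An event of probability one has full probability on every branch of positive weight, so
perfect correctness can be applied branch by branch.

Unconditional existence. The 2-out-of-2 scheme is conjugate coding: `κ + 1` blocks of `m` bits, each
a data block in the Hadamard basis or a check block in the computational basis, with the sum of the
data blocks as one-time pad and one block that always holds data. Deletion is a computational-basis
measurement. In the Fourier expansion over characters `χ` of the pad, the mode `χ = 0` does not see
the secret. For `χ ≠ 0` a data block contributes the translation by `χ`, which is dominated by a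
diagonal operator that can be chosen small at the certified string; a check block forces agreement
with that string. The average over the unknown basis gains a factor `5/6` per block. The classical
scheme shares the secret additively within each authorized set. -/

namespace CertDel

open Matrix
open scoped ComplexOrder Kronecker

noncomputable section

/-! ## Trace norm bounds by positive decompositions -/

section TraceNorm

variable {X Y : Type} [Fintype X] [Fintype Y]

/-- `A` is a difference of positive semidefinite matrices with total trace at most `t`. -/
def TNle (A : Matrix X X ℂ) (t : ℝ) : Prop :=
  ∃ P N : Matrix X X ℂ, P.PosSemidef ∧ N.PosSemidef ∧ A = P - N ∧ (P.trace + N.trace).re ≤ t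

lemma trace_cfc [DecidableEq X] {A : Matrix X X ℂ} (hA : A.IsHermitian) (f : ℝ → ℝ) :
    (cfc f A).trace = ∑ i, (f (hA.eigenvalues i) : ℂ) := by
  rw [hA.cfc_eq, IsHermitian.cfc, Unitary.conjStarAlgAut_apply, trace_mul_comm, ← mul_assoc]
  simp [trace, diagonal]

/-- For Hermitian `A` one has `√(Aᴴ * A) = |A|` in the functional calculus; the traces of the two
sides are the two sums. -/
lemma traceNorm_eq_sum_abs [DecidableEq X] {A : Matrix X X ℂ} (hA : A.IsHermitian) :
    traceNorm A = ∑ i, |hA.eigenvalues i| := by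
  have h1 := trace_cfc (isHermitian_conjTranspose_mul_self A) Real.sqrt
  have h2 := trace_cfc hA (fun x => |x|)
  have h3 : cfc Real.sqrt (Aᴴ * A) = cfc (fun x : ℝ => |x|) A := by
    have hs : IsSelfAdjoint A := hA
    have : Aᴴ * A = cfc (fun x : ℝ => x ^ 2) A := by
      rw [cfc_pow_id (R := ℝ) A 2, hA.eq, sq]
    rw [this, ← cfc_comp' Real.sqrt (fun x : ℝ => x ^ 2) A]
    simp_rw [Real.sqrt_sq_eq_abs]
  rw [h3, h2] at h1
  unfold traceNorm
  exact_mod_cast h1.symm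

lemma conj_unitary_eq [DecidableEq X] {A : Matrix X X ℂ} (hA : A.IsHermitian) :
    (hA.eigenvectorUnitary : Matrix X X ℂ)ᴴ * A * hA.eigenvectorUnitary =
      diagonal (fun i => (hA.eigenvalues i : ℂ)) := by
  have := hA.conjStarAlgAut_star_eigenvectorUnitary
  rw [Unitary.conjStarAlgAut_apply] at this
  simpa [star_eq_conjTranspose, Function.comp_def] using this

lemma unitaryGroup_mul_conjTranspose [DecidableEq X] (U : unitaryGroup X ℂ) :
    (U : Matrix X X ℂ) * (U : Matrix X X ℂ)ᴴ = 1 := by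
  rw [← star_eq_conjTranspose]
  exact mem_unitaryGroup_iff.mp U.2

lemma trace_conj_unitary [DecidableEq X] (U : unitaryGroup X ℂ) (A : Matrix X X ℂ) :
    ((U : Matrix X X ℂ)ᴴ * A * U).trace = A.trace := by
  rw [trace_mul_comm, ← mul_assoc, unitaryGroup_mul_conjTranspose, one_mul]

/-- In an eigenbasis of `P - N` each eigenvalue is the difference of two nonnegative diagonal
entries, hence bounded in absolute value by their sum. -/
lemma TNle.traceNorm_le [DecidableEq X] {A : Matrix X X ℂ} {t : ℝ} (h : TNle A t) :
    traceNorm A ≤ t := by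
  obtain ⟨P, N, hP, hN, rfl, ht⟩ := h
  have hA : (P - N).IsHermitian := hP.1.sub hN.1
  rw [traceNorm_eq_sum_abs hA]
  refine le_trans ?_ ht
  set U := hA.eigenvectorUnitary
  rw [← trace_conj_unitary U P, ← trace_conj_unitary U N]
  have hP' := hP.conjTranspose_mul_mul_same (U : Matrix X X ℂ)
  have hN' := hN.conjTranspose_mul_mul_same (U : Matrix X X ℂ)
  simp only [trace, diag_apply, Complex.add_re, Complex.re_sum, ← Finset.sum_add_distrib]
  refine Finset.sum_le_sum fun i _ => ?_
  have h1 := congrFun (congrFun (conj_unitary_eq hA) i) i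
  rw [mul_sub, sub_mul, Matrix.sub_apply, diagonal_apply_eq] at h1
  have h2 := congrArg Complex.re h1
  simp only [Complex.sub_re, Complex.ofReal_re] at h2
  rw [← h2]
  have a := (Complex.le_def.mp (hP'.diag_nonneg (i := i))).1
  have b := (Complex.le_def.mp (hN'.diag_nonneg (i := i))).1
  simp only [Complex.zero_re] at a b
  rw [abs_le]
  constructor <;> linarith

/-- The Jordan decomposition into positive and negative part attains the trace norm, so for
Hermitian matrices `TNle` characterizes it. -/
lemma TNle_traceNorm [DecidableEq X] {A : Matrix X X ℂ} (hA : A.IsHermitian) :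
    TNle A (traceNorm A) := by
  set U := hA.eigenvectorUnitary
  have key : ∀ f : ℝ → ℝ, ((U : Matrix X X ℂ) * diagonal (fun i => (f (hA.eigenvalues i) : ℂ)) *
      (U : Matrix X X ℂ)ᴴ).trace = ∑ i, (f (hA.eigenvalues i) : ℂ) := by
    intro f
    rw [trace_mul_comm, ← mul_assoc, ← star_eq_conjTranspose, Unitary.coe_star_mul_self, one_mul,
      trace_diagonal]
  have pos : ∀ f : ℝ → ℝ, (∀ x, 0 ≤ f x) →
      ((U : Matrix X X ℂ) * diagonal (fun i => (f (hA.eigenvalues i) : ℂ)) *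
      (U : Matrix X X ℂ)ᴴ).PosSemidef := by
    intro f hf
    refine PosSemidef.mul_mul_conjTranspose_same (PosSemidef.diagonal fun i => ?_) _
    simpa using hf _
  refine ⟨_, _, pos (fun x => x⁺) (fun x => posPart_nonneg x), pos (fun x => x⁻)
    (fun x => negPart_nonneg x), ?_, ?_⟩
  · rw [← sub_mul, ← mul_sub, diagonal_sub]
    have : (fun i => (((hA.eigenvalues i)⁺ : ℝ) : ℂ) - (((hA.eigenvalues i)⁻ : ℝ) : ℂ)) =
        fun i => (hA.eigenvalues i : ℂ) := by
      funext i
      rw [← Complex.ofReal_sub, posPart_sub_negPart]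
    rw [this, ← conj_unitary_eq hA]
    simp only [← mul_assoc]
    rw [unitaryGroup_mul_conjTranspose, one_mul, mul_assoc, unitaryGroup_mul_conjTranspose,
      mul_one]
  · rw [key, key, ← Finset.sum_add_distrib, traceNorm_eq_sum_abs hA]
    simp only [← Complex.ofReal_add, posPart_add_negPart, ← Complex.ofReal_sum, Complex.ofReal_re]
    exact le_rfl

lemma TNle.mono {A : Matrix X X ℂ} {s t : ℝ} (h : TNle A s) (hst : s ≤ t) : TNle A t := by
  obtain ⟨P, N, hP, hN, e, ht⟩ := h
  exact ⟨P, N, hP, hN, e, ht.trans hst⟩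

lemma TNle_zero : TNle (0 : Matrix X X ℂ) 0 :=
  ⟨0, 0, .zero, .zero, by simp, by simp⟩

lemma TNle.add {A B : Matrix X X ℂ} {s t : ℝ} (hA : TNle A s) (hB : TNle B t) :
    TNle (A + B) (s + t) := by
  obtain ⟨P, N, hP, hN, rfl, hs⟩ := hA
  obtain ⟨P', N', hP', hN', rfl, ht⟩ := hB
  refine ⟨P + P', N + N', hP.add hP', hN.add hN', by abel, ?_⟩
  simp only [trace_add, Complex.add_re] at *
  linarith

lemma TNle.sum {ι : Type*} (s : Finset ι) {A : ι → Matrix X X ℂ} {t : ι → ℝ}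
    (h : ∀ i ∈ s, TNle (A i) (t i)) : TNle (∑ i ∈ s, A i) (∑ i ∈ s, t i) := by
  classical
  induction s using Finset.induction_on with
  | empty => simpa using TNle_zero
  | insert a s ha ih =>
    rw [Finset.sum_insert ha, Finset.sum_insert ha]
    exact (h a (by simp)).add (ih fun i hi => h i (by simp [hi]))

lemma TNle.neg {A : Matrix X X ℂ} {t : ℝ} (h : TNle A t) : TNle (-A) t := by
  obtain ⟨P, N, hP, hN, rfl, ht⟩ := h
  exact ⟨N, P, hN, hP, by abel, by rwa [add_comm]⟩

lemma TNle.smul_nonneg {A : Matrix X X ℂ} {t r : ℝ} (h : TNle A t) (hr : 0 ≤ r) :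
    TNle ((r : ℂ) • A) (r * t) := by
  obtain ⟨P, N, hP, hN, rfl, ht⟩ := h
  have hr' : (0 : ℂ) ≤ (r : ℂ) := by exact_mod_cast hr
  refine ⟨_, _, hP.smul hr', hN.smul hr', smul_sub _ _ _, ?_⟩
  rw [trace_smul, trace_smul, ← smul_add, smul_eq_mul, Complex.re_ofReal_mul]
  exact mul_le_mul_of_nonneg_left ht hr

lemma TNle.smul {A : Matrix X X ℂ} {t : ℝ} (h : TNle A t) (r : ℝ) :
    TNle ((r : ℂ) • A) (|r| * t) := by
  rcases le_total 0 r with hr | hr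
  · rw [abs_of_nonneg hr]
    exact h.smul_nonneg hr
  · rw [abs_of_nonpos hr]
    have := (h.smul_nonneg (neg_nonneg.mpr hr)).neg
    simpa using this

lemma TNle_sub_of_posSemidef {P N : Matrix X X ℂ} (hP : P.PosSemidef) (hN : N.PosSemidef) :
    TNle (P - N) (P.trace + N.trace).re := ⟨P, N, hP, hN, rfl, le_rfl⟩

lemma TNle.abs_re_trace_le {A : Matrix X X ℂ} {t : ℝ} (h : TNle A t) : |A.trace.re| ≤ t := by
  obtain ⟨P, N, hP, hN, rfl, ht⟩ := h
  have a := (Complex.le_def.mp hP.trace_nonneg).1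
  have b := (Complex.le_def.mp hN.trace_nonneg).1
  simp only [Complex.zero_re, trace_sub, Complex.sub_re, Complex.add_re] at *
  rw [abs_le]
  constructor <;> linarith

lemma posSemidef_re_trace_nonneg {P : Matrix X X ℂ} (hP : P.PosSemidef) : 0 ≤ P.trace.re := by
  simpa using (Complex.le_def.mp hP.trace_nonneg).1

lemma posSemidef_ofReal_re_trace {P : Matrix X X ℂ} (hP : P.PosSemidef) :
    ((P.trace.re : ℝ) : ℂ) = P.trace := by
  have := (Complex.le_def.mp hP.trace_nonneg).2
  apply Complex.ext <;> simp_all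

lemma posSemidef_sum_kraus {K : Type*} [Fintype K] (G : K → Matrix Y X ℂ)
    {P : Matrix X X ℂ} (hP : P.PosSemidef) : (∑ k, G k * P * (G k)ᴴ).PosSemidef :=
  posSemidef_sum _ fun _ _ => hP.mul_mul_conjTranspose_same _

lemma trace_sum_kraus {K : Type*} [Fintype K] [DecidableEq X] (G : K → Matrix Y X ℂ)
    {p : ℂ} (hG : ∑ k, (G k)ᴴ * G k = p • 1) (P : Matrix X X ℂ) :
    (∑ k, G k * P * (G k)ᴴ).trace = p * P.trace := by
  have h1 : (∑ k, G k * P * (G k)ᴴ).trace = ((∑ k, (G k)ᴴ * G k) * P).trace := by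
    rw [Finset.sum_mul, trace_sum, trace_sum]
    refine Finset.sum_congr rfl fun k _ => ?_
    rw [trace_mul_comm, Matrix.mul_assoc]
  rw [h1, hG]
  simp

end TraceNorm

end

end CertDel

namespace CertDel

open Matrix
open scoped ComplexOrder Kronecker

noncomputable section

/-! ## Games with rejection -/

section Game

variable {X : Type}

lemma accepting_add (A B : Matrix X X ℂ) : accepting (A + B) = accepting A + accepting B := by
  ext x y
  cases x <;> cases y <;> simp [accepting]

lemma accepting_zero : accepting (0 : Matrix X X ℂ) = 0 := by
  ext x y
  cases x <;> cases y <;> simp [accepting]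

lemma accepting_sub (A B : Matrix X X ℂ) : accepting (A - B) = accepting A - accepting B := by
  ext x y
  cases x <;> cases y <;> simp [accepting]

lemma accepting_sum {Ω : Type*} (s : Finset Ω) (A : Ω → Matrix X X ℂ) :
    accepting (∑ o ∈ s, A o) = ∑ o ∈ s, accepting (A o) :=
  map_sum (AddMonoidHom.mk' accepting accepting_add) A s

variable [Fintype X]

lemma accepting_trace (A : Matrix X X ℂ) : (accepting A).trace = A.trace := by
  simp [trace, accepting, Fintype.sum_option]

lemma accepting_posSemidef {A : Matrix X X ℂ} (hA : A.PosSemidef) :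
    (accepting A).PosSemidef := by
  classical
  open scoped MatrixOrder in
  obtain ⟨B, rfl⟩ := CStarAlgebra.nonneg_iff_eq_star_mul_self.mp
    (Matrix.nonneg_iff_posSemidef.mpr hA)
  have : accepting (star B * B) = (accepting B)ᴴ * accepting B := by
    ext x y
    cases x <;> cases y <;>
      simp [accepting, Matrix.mul_apply, Fintype.sum_option, star_eq_conjTranspose]
  rw [this]
  exact posSemidef_conjTranspose_mul_self _

lemma TNle.accepting {A : Matrix X X ℂ} {t : ℝ} (h : TNle A t) : TNle (accepting A) t := by
  obtain ⟨P, N, hP, hN, rfl, ht⟩ := h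
  exact ⟨_, _, accepting_posSemidef hP, accepting_posSemidef hN, accepting_sub P N,
    by rwa [accepting_trace, accepting_trace]⟩

lemma posSemidef_submatrix_trace_le {Y : Type} [Fintype Y] {A : Matrix Y Y ℂ}
    (hA : A.PosSemidef) (f : X → Y) (hf : Function.Injective f) :
    (A.submatrix f f).trace.re ≤ A.trace.re := by
  classical
  simp only [trace, diag_apply, submatrix_apply, Complex.re_sum]
  rw [← Finset.sum_image (f := fun y => (A y y).re) (g := f) fun a _ b _ h => hf h]
  refine Finset.sum_le_sum_of_subset_of_nonneg (Finset.subset_univ _) fun i _ _ => ?_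
  simpa using (Complex.le_def.mp (hA.diag_nonneg (i := i))).1

lemma TNle.submatrix {Y : Type} [Fintype Y] {A : Matrix Y Y ℂ} {t : ℝ} (h : TNle A t)
    (f : X → Y) (hf : Function.Injective f) : TNle (A.submatrix f f) t := by
  obtain ⟨P, N, hP, hN, rfl, ht⟩ := h
  refine ⟨_, _, hP.submatrix f, hN.submatrix f, rfl, le_trans ?_ ht⟩
  rw [Complex.add_re, Complex.add_re]
  exact add_le_add (posSemidef_submatrix_trace_le hP f hf) (posSemidef_submatrix_trace_le hN f hf)

variable [DecidableEq X] {Ω : Type} [Fintype Ω] (acc : Ω → Prop) [DecidablePred acc]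

/-- The output of a game with outcomes `o` and residual states `σ o`. -/
def gameOut (σ : Ω → Matrix X X ℂ) : Matrix (Option X) (Option X) ℂ :=
  ∑ o, if acc o then accepting (σ o) else rejecting (σ o)

/-- The accepted part of the output of a game. -/
def gameAcc (σ : Ω → Matrix X X ℂ) : Matrix X X ℂ := ∑ o, if acc o then σ o else 0

/-- A rejected outcome leaves only its probability, which is the total trace minus the accepted
trace. Hence the accepted part and the total trace determine the output. -/
lemma gameOut_eq (σ : Ω → Matrix X X ℂ) : gameOut acc σ =
    accepting (gameAcc acc σ) + (∑ o, (σ o).trace - (gameAcc acc σ).trace) • ketbra none := by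
  rw [gameAcc, accepting_sum, trace_sum, ← Finset.sum_sub_distrib, Finset.sum_smul,
    ← Finset.sum_add_distrib, gameOut]
  refine Finset.sum_congr rfl fun o _ => ?_
  split_ifs
  · simp
  · simp [accepting_zero, rejecting]

lemma gameOut_posSemidef {σ : Ω → Matrix X X ℂ} (h : ∀ o, (σ o).PosSemidef) :
    (gameOut acc σ).PosSemidef := by
  refine posSemidef_sum _ fun o _ => ?_
  split_ifs
  exacts [accepting_posSemidef (h o), (ketbra_posSemidef _).smul (h o).trace_nonneg]

lemma gameOut_trace (σ : Ω → Matrix X X ℂ) : (gameOut acc σ).trace = ∑ o, (σ o).trace := by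
  rw [gameOut_eq, trace_add, accepting_trace, trace_smul, ketbra_trace]
  simp

lemma gameAcc_eq_submatrix (σ : Ω → Matrix X X ℂ) :
    gameAcc acc σ = (gameOut acc σ).submatrix some some := by
  rw [gameOut_eq]
  ext x y
  simp [accepting, ketbra]

/-- As the total traces agree, the weights of `⊥` differ by minus the trace of the accepted
difference, which is at most `t` in absolute value. The trace norm is thus at most `2 * t`, and the
`1 / 2` in the trace distance cancels the factor. -/
lemma traceDist_gameOut_le {σ τ : Ω → Matrix X X ℂ} {t : ℝ}
    (h1 : ∑ o, (σ o).trace = ∑ o, (τ o).trace) (h : TNle (gameAcc acc σ - gameAcc acc τ) t) :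
    traceDist (gameOut acc σ) (gameOut acc τ) ≤ t := by
  have key : gameOut acc σ - gameOut acc τ = accepting (gameAcc acc σ - gameAcc acc τ) +
      ((-(gameAcc acc σ - gameAcc acc τ).trace.re : ℝ) : ℂ) • ketbra none := by
    have him : (((gameAcc acc σ - gameAcc acc τ).trace.re : ℝ) : ℂ) =
        (gameAcc acc σ - gameAcc acc τ).trace := by
      obtain ⟨P, N, hP, hN, e, -⟩ := h
      rw [e, trace_sub, Complex.sub_re, Complex.ofReal_sub, posSemidef_ofReal_re_trace hP,
        posSemidef_ofReal_re_trace hN]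
    rw [Complex.ofReal_neg, him, gameOut_eq, gameOut_eq, accepting_sub, h1, trace_sub]
    module
  have hk : TNle (ketbra (none : Option X)) 1 :=
    ⟨ketbra none, 0, ketbra_posSemidef _, .zero, (sub_zero _).symm, by simp [ketbra_trace]⟩
  have := (key ▸ h.accepting.add (hk.smul _)).traceNorm_le
  have h2 := h.abs_re_trace_le
  rw [abs_neg, mul_one] at this
  rw [traceDist]
  linarith

lemma TNle_gameAcc_of_traceDist {σ τ : Ω → Matrix X X ℂ} {t : ℝ}
    (hσ : ∀ o, (σ o).PosSemidef) (hτ : ∀ o, (τ o).PosSemidef)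
    (h : traceDist (gameOut acc σ) (gameOut acc τ) ≤ t) :
    TNle (gameAcc acc σ - gameAcc acc τ) (2 * t) := by
  have h1 : TNle (gameOut acc σ - gameOut acc τ) (2 * t) := by
    refine (TNle_traceNorm ((gameOut_posSemidef acc hσ).1.sub (gameOut_posSemidef acc hτ).1)).mono ?_
    rw [traceDist] at h
    linarith
  have := h1.submatrix some (Option.some_injective _)
  rwa [submatrix_sub, Pi.sub_apply, Pi.sub_apply, ← gameAcc_eq_submatrix,
    ← gameAcc_eq_submatrix] at this

lemma traceDist_gameOut_le_one {σ τ : Ω → Matrix X X ℂ}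
    (hσ : ∀ o, (σ o).PosSemidef) (hτ : ∀ o, (τ o).PosSemidef)
    (h1 : ∑ o, (σ o).trace = 1) (h2 : ∑ o, (τ o).trace = 1) :
    traceDist (gameOut acc σ) (gameOut acc τ) ≤ 1 := by
  have := (TNle_sub_of_posSemidef (gameOut_posSemidef acc hσ)
    (gameOut_posSemidef acc hτ)).traceNorm_le
  rw [gameOut_trace, gameOut_trace, h1, h2] at this
  norm_num at this
  rw [traceDist]
  linarith

end Game

namespace TwoOfTwo

variable (T : TwoOfTwo) {κ m : ℕ}

/-- The residual state of the certified deletion game, by classical share, key and certificate. -/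
def gameState (A : T.Adversary κ m) (s : Bits m)
    (o : Bits (T.cshLen κ m) × T.VK κ m × Option (T.Cert κ m)) :
    Matrix (A.R × Bits (T.cshLen κ m)) (A.R × Bits (T.cshLen κ m)) ℂ :=
  (∑ k, A.E o.2.2 k * T.split κ m s (o.1, o.2.1) * (A.E o.2.2 k)ᴴ) ⊗ₖ ketbra o.1

lemma experiment_eq_gameOut (A : T.Adversary κ m) (s : Bits m) :
    T.experiment κ m A s =
      gameOut (fun o => T.accepts κ m o.2.1 o.2.2 = true) (T.gameState A s) := by
  simp only [experiment, gameOut, Fintype.sum_prod_type, gameState]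

lemma gameState_posSemidef (A : T.Adversary κ m) (s : Bits m) (o) :
    (T.gameState A s o).PosSemidef :=
  (posSemidef_sum_kraus _ ((T.split_isEnsemble κ m s).pos _)).kronecker (ketbra_posSemidef _)

lemma sum_gameState_trace (A : T.Adversary κ m) (s : Bits m) :
    ∑ o, (T.gameState A s o).trace = 1 := by
  rw [← (T.split_isEnsemble κ m s).trace_eq_one]
  simp only [gameState, Fintype.sum_prod_type, trace_kronecker, ketbra_trace, mul_one]
  refine Finset.sum_congr rfl fun c _ => Finset.sum_congr rfl fun vk _ => ?_
  have h : ∑ o : Option (T.Cert κ m) × A.K, (A.E o.1 o.2)ᴴ * A.E o.1 o.2 = (1 : ℂ) • 1 := by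
    rw [Fintype.sum_prod_type, one_smul]
    exact A.isInstrument
  have := trace_sum_kraus _ h (T.split κ m s (c, vk))
  rw [one_mul, Fintype.sum_prod_type, trace_sum] at this
  exact this

/-- The accepted part of the certified deletion game with classical share `c`, for operations that
preserve the trace up to the factor `p`, is close for two secrets. -/
lemma exists_decomposition {δ : ℝ} {a b : Bits m}
    (hδ : ∀ A : T.Adversary κ m,
      traceDist (T.experiment κ m A a) (T.experiment κ m A b) ≤ δ)
    {R K : Type} [Fintype R] [DecidableEq R] [Fintype K]
    (F : Option (T.Cert κ m) → K → Matrix R (T.Q κ m) ℂ) {p : ℝ} (hp : 0 ≤ p)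
    (hF : ∑ o, ∑ k, (F o k)ᴴ * F o k = (p : ℂ) • 1) :
    ∃ P N : Bits (T.cshLen κ m) → Matrix R R ℂ, (∀ c, (P c).PosSemidef) ∧
      (∀ c, (N c).PosSemidef) ∧
      (∀ c, (∑ vk, ∑ cert, if T.accepts κ m vk cert = true then
        ∑ k, F cert k * (T.split κ m a (c, vk) - T.split κ m b (c, vk)) * (F cert k)ᴴ else 0) =
          P c - N c) ∧
      ∑ c, ((P c).trace + (N c).trace).re ≤ p * (2 * δ) := by
  -- For `p = 0` no normalization is possible, but then all Kraus operators vanish.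
  rcases hp.eq_or_lt with rfl | hp
  · have h0 : ∀ o k, F o k = 0 := by
      intro o k
      have h1 : ∑ o, ∑ k, ((F o k)ᴴ * F o k).trace = 0 := by
        simp_rw [← trace_sum]
        rw [hF]
        simp
      have hnn : ∀ o k, 0 ≤ ((F o k)ᴴ * F o k).trace := fun o k =>
        (posSemidef_conjTranspose_mul_self _).trace_nonneg
      have h2 := (Finset.sum_eq_zero_iff_of_nonneg fun o _ =>
        Finset.sum_nonneg fun k _ => hnn o k).mp h1 o (Finset.mem_univ _)
      have h3 := (Finset.sum_eq_zero_iff_of_nonneg fun k _ => hnn o k).mp h2 k (Finset.mem_univ _)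
      exact trace_conjTranspose_mul_self_eq_zero_iff.mp h3
    refine ⟨0, 0, fun _ => .zero, fun _ => .zero, fun c => ?_, by simp⟩
    simp [h0]
  · set r : ℝ := (Real.sqrt p)⁻¹ with hr
    have hr2 : r * r = p⁻¹ := by
      rw [hr, ← mul_inv, Real.mul_self_sqrt hp.le]
    have hrc : (r : ℂ) * r = (p : ℂ)⁻¹ := by exact_mod_cast hr2
    -- Scaling by `1 / √p` yields a genuine adversary; the factor `p` is restored afterwards.
    let A : T.Adversary κ m :=
      { R := R, K := K, E := fun o k => (r : ℂ) • F o k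
        isInstrument := by
          have : ∀ o k, ((r : ℂ) • F o k)ᴴ * ((r : ℂ) • F o k) =
              (p : ℂ)⁻¹ • ((F o k)ᴴ * F o k) := by
            intro o k
            simp only [conjTranspose_smul, Matrix.smul_mul, Matrix.mul_smul, smul_smul, ← hrc,
              Complex.star_def, Complex.conj_ofReal]
          simp only [IsInstrument, this, ← Finset.smul_sum, hF]
          rw [smul_smul, inv_mul_cancel₀ (by exact_mod_cast hp.ne'), one_smul] }
    have h := hδ A
    rw [experiment_eq_gameOut, experiment_eq_gameOut] at h
    obtain ⟨P, N, hP, hN, e, ht⟩ := TNle_gameAcc_of_traceDist _ (T.gameState_posSemidef A a)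
      (T.gameState_posSemidef A b) h
    have hpc : (0 : ℂ) ≤ p := by exact_mod_cast hp.le
    have htr : ∀ M : Matrix (R × Bits (T.cshLen κ m)) (R × Bits (T.cshLen κ m)) ℂ,
        ∑ c, (((p : ℂ) • M.submatrix (fun x => (x, c)) fun x => (x, c)).trace).re =
          p * M.trace.re := by
      intro M
      simp only [trace_smul, smul_eq_mul, Complex.re_ofReal_mul, ← Finset.mul_sum]
      congr 1
      rw [trace, Fintype.sum_prod_type_right, Complex.re_sum]
      rfl
    -- The revealed share is classical, so the accepted state is block diagonal in `c`. The diagonal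
    -- blocks of `P` and `N` remain positive, and their traces sum to the full traces.
    refine ⟨fun c => (p : ℂ) • P.submatrix (fun x => (x, c)) fun x => (x, c),
      fun c => (p : ℂ) • N.submatrix (fun x => (x, c)) fun x => (x, c),
      fun c => (hP.submatrix _).smul hpc, fun c => (hN.submatrix _).smul hpc, fun c => ?_, ?_⟩
    · rw [← smul_sub]
      have e' := congrArg (fun M => (p : ℂ) • M.submatrix (fun x : R => (x, c)) fun x => (x, c)) e
      simp only [submatrix_sub, Pi.sub_apply] at e'
      rw [← e', smul_sub]
      have : ∀ s, (p : ℂ) • (gameAcc (fun o => T.accepts κ m o.2.1 o.2.2 = true)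
          (T.gameState A s)).submatrix (fun x : R => (x, c)) (fun x => (x, c)) =
          ∑ vk, ∑ cert, if T.accepts κ m vk cert = true then
            ∑ k, F cert k * T.split κ m s (c, vk) * (F cert k)ᴴ else 0 := by
        intro s
        have hE : ∀ cert k vk, A.E cert k * T.split κ m s (c, vk) * (A.E cert k)ᴴ =
            (p : ℂ)⁻¹ • (F cert k * T.split κ m s (c, vk) * (F cert k)ᴴ) := by
          intro cert k vk
          simp only [A, conjTranspose_smul, Matrix.smul_mul, Matrix.mul_smul, smul_smul, ← hrc,
            Complex.star_def, Complex.conj_ofReal]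
        have hsub : (gameAcc (fun o => T.accepts κ m o.2.1 o.2.2 = true)
            (T.gameState A s)).submatrix (fun x : R => (x, c)) (fun x => (x, c)) =
            ∑ vk, ∑ cert, if T.accepts κ m vk cert = true then
            ∑ k, A.E cert k * T.split κ m s (c, vk) * (A.E cert k)ᴴ else 0 := by
          ext x y
          simp only [gameAcc, Fintype.sum_prod_type, submatrix_apply, Matrix.sum_apply]
          rw [Finset.sum_eq_single c]
          · refine Finset.sum_congr rfl fun vk _ => Finset.sum_congr rfl fun cert _ => ?_
            split_ifs
            · simp [gameState, ketbra, Matrix.sum_apply]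
            · simp
          · intro c' _ hc
            refine Finset.sum_eq_zero fun vk _ => Finset.sum_eq_zero fun cert _ => ?_
            split_ifs
            · simp [gameState, ketbra, hc]
            · simp
          · simp
        rw [hsub, Finset.smul_sum]
        refine Finset.sum_congr rfl fun vk _ => ?_
        rw [Finset.smul_sum]
        refine Finset.sum_congr rfl fun cert _ => ?_
        split_ifs
        · simp_rw [hE]
          rw [← Finset.smul_sum, smul_smul, mul_inv_cancel₀ (by exact_mod_cast hp.ne'), one_smul]
        · simp
      rw [this, this, ← Finset.sum_sub_distrib]
      refine Finset.sum_congr rfl fun vk _ => ?_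
      rw [← Finset.sum_sub_distrib]
      refine Finset.sum_congr rfl fun cert _ => ?_
      split_ifs
      · simp only [Matrix.mul_sub, Matrix.sub_mul, Finset.sum_sub_distrib]
      · simp
    · simp only [Complex.add_re, Finset.sum_add_distrib]
      rw [htr, htr, ← mul_add]
      exact mul_le_mul_of_nonneg_left ht hp.le

end TwoOfTwo

end

end CertDel

namespace CertDel

open Matrix
open scoped ComplexOrder Kronecker

noncomputable section

/-! ## Correctness of the compiled scheme -/

lemma trace_mul_nonneg {X : Type} [Fintype X] {A B : Matrix X X ℂ} (hA : A.PosSemidef)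
    (hB : B.PosSemidef) : 0 ≤ (A * B).trace := by
  classical
  open scoped MatrixOrder in
  obtain ⟨C, rfl⟩ := CStarAlgebra.nonneg_iff_eq_star_mul_self.mp
    (Matrix.nonneg_iff_posSemidef.mpr hB)
  rw [star_eq_conjTranspose, ← mul_assoc, trace_mul_comm, ← mul_assoc]
  exact (hA.mul_mul_conjTranspose_same C).trace_nonneg

lemma PMF_map_eq_pure {α β : Type} {p : PMF α} {f : α → β} {b : β} (h : p.map f = PMF.pure b)
    {a : α} (ha : p a ≠ 0) : f a = b := by
  have : f a ∈ (p.map f).support := by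
    rw [PMF.support_map]
    exact ⟨a, (PMF.mem_support_iff _ _).mpr ha, rfl⟩
  rw [h] at this
  simpa using this

namespace TwoOfTwo

variable {T : TwoOfTwo}

/-- The probabilities of all wrong outcomes, over all `c` and `vk`, are nonnegative and sum to zero,
so each of them vanishes. -/
lemma Correct.trace_eq (hT : T.Correct) {κ m : ℕ} (s s' : Bits m) (c vk) :
    (T.reconstruct κ m c s' * T.split κ m s (c, vk)).trace =
      if s' = s then (T.split κ m s (c, vk)).trace else 0 := by
  have hnn : ∀ s' c vk, 0 ≤ (T.reconstruct κ m c s' * T.split κ m s (c, vk)).trace :=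
    fun s' c vk => trace_mul_nonneg ((T.reconstruct_isPOVM κ m c).pos s')
      ((T.split_isEnsemble κ m s).pos _)
  have hsum : ∀ c vk, ∑ s', (T.reconstruct κ m c s' * T.split κ m s (c, vk)).trace =
      (T.split κ m s (c, vk)).trace := by
    intro c vk
    rw [← trace_sum, ← Finset.sum_mul, (T.reconstruct_isPOVM κ m c).sum_eq_one, one_mul]
  have herase : ∀ c vk, ∑ s' ∈ Finset.univ.erase s,
      (T.reconstruct κ m c s' * T.split κ m s (c, vk)).trace = 0 := by
    have h1 : ∑ c, ∑ vk, ∑ s' ∈ Finset.univ.erase s,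
        (T.reconstruct κ m c s' * T.split κ m s (c, vk)).trace = 0 := by
      have := hT κ m s
      have h2 := (T.split_isEnsemble κ m s).trace_eq_one
      rw [Fintype.sum_prod_type] at h2
      simp_rw [← hsum, ← Finset.add_sum_erase _ _ (Finset.mem_univ s), Finset.sum_add_distrib] at h2
      rw [this] at h2
      simpa using h2
    intro c vk
    have h2 := (Finset.sum_eq_zero_iff_of_nonneg fun c _ => Finset.sum_nonneg fun vk _ =>
      Finset.sum_nonneg fun s' _ => hnn s' c vk).mp h1 c (Finset.mem_univ _)
    exact (Finset.sum_eq_zero_iff_of_nonneg fun vk _ =>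
      Finset.sum_nonneg fun s' _ => hnn s' c vk).mp h2 vk (Finset.mem_univ _)
  split_ifs with h
  · subst h
    rw [← hsum c vk, ← Finset.add_sum_erase _ _ (Finset.mem_univ s'), herase, add_zero]
  · exact (Finset.sum_eq_zero_iff_of_nonneg fun s' _ => hnn s' c vk).mp (herase c vk) s'
      (Finset.mem_erase.mpr ⟨h, Finset.mem_univ _⟩)

/-- The rejection probabilities of the individual branches are nonnegative with sum zero. -/
lemma DeletionCorrect.trace_eq (hT : T.DeletionCorrect) {κ m : ℕ} (s : Bits m) (c vk) :
    ∑ cert, (if T.verify κ m vk cert = true then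
      (T.delete κ m cert * T.split κ m s (c, vk)).trace else 0) =
      (T.split κ m s (c, vk)).trace := by
  have hle : ∀ c vk, 0 ≤ (T.split κ m s (c, vk)).trace -
      ∑ cert, (if T.verify κ m vk cert = true then
        (T.delete κ m cert * T.split κ m s (c, vk)).trace else 0) := by
    intro c vk
    have : (T.split κ m s (c, vk)).trace =
        ∑ cert, (T.delete κ m cert * T.split κ m s (c, vk)).trace := by
      rw [← trace_sum, ← Finset.sum_mul, (T.delete_isPOVM κ m).sum_eq_one, one_mul]
    rw [this, ← Finset.sum_sub_distrib]
    refine Finset.sum_nonneg fun cert _ => ?_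
    split_ifs
    · simp
    · rw [sub_zero]
      exact trace_mul_nonneg ((T.delete_isPOVM κ m).pos cert) ((T.split_isEnsemble κ m s).pos _)
  have h0 : ∑ c, ∑ vk, ((T.split κ m s (c, vk)).trace -
      ∑ cert, (if T.verify κ m vk cert = true then
        (T.delete κ m cert * T.split κ m s (c, vk)).trace else 0)) = 0 := by
    have h2 := (T.split_isEnsemble κ m s).trace_eq_one
    rw [Fintype.sum_prod_type] at h2
    simp_rw [Finset.sum_sub_distrib]
    rw [h2, hT κ m s, sub_self]
  have h2 := (Finset.sum_eq_zero_iff_of_nonneg fun c _ => Finset.sum_nonneg fun vk _ =>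
    hle c vk).mp h0 c (Finset.mem_univ _)
  have h3 := (Finset.sum_eq_zero_iff_of_nonneg fun vk _ => hle c vk).mp h2 vk (Finset.mem_univ _)
  exact (sub_eq_zero.mp h3).symm

end TwoOfTwo

/-! ### Local operators acting on product states -/

section OnSubset

variable {ι : Type} [Fintype ι] [DecidableEq ι] {X : ι → Type} [∀ i, DecidableEq (X i)]

lemma onSubset_piTensor (P : Finset ι) (A : ∀ i : P, Matrix (X i) (X i) ℂ) :
    onSubset P (piTensor A) = piTensor fun i => if h : i ∈ P then A ⟨i, h⟩ else 1 := by
  ext x y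
  simp only [onSubset, piTensor, of_apply]
  rw [← Finset.prod_mul_prod_compl P, ← Finset.prod_coe_sort P]
  have h1 : ∏ i : P, (if h : (i : ι) ∈ P then A ⟨i, h⟩ else 1 : Matrix (X i) (X i) ℂ) (x i) (y i) =
      ∏ i : P, A i (x i) (y i) := by
    refine Finset.prod_congr rfl fun i _ => ?_
    rw [dif_pos i.2]
  have h2 : ∏ i ∈ Pᶜ, (if h : (i : ι) ∈ P then A ⟨i, h⟩ else 1 : Matrix (X i) (X i) ℂ) (x i) (y i) =
      if ∀ i ∉ P, x i = y i then 1 else 0 := by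
    rw [Finset.prod_congr rfl (g := fun i => if x i = y i then (1 : ℂ) else 0)]
    · rw [Finset.prod_ite_zero]
      simp
    · intro i hi
      rw [dif_neg (by simpa using hi), one_apply]
  rw [h1, h2]
  split_ifs <;> simp

lemma onSubset_zero (P : Finset ι) : onSubset (X := X) P 0 = 0 := by
  ext x y
  simp [onSubset]

lemma onSubset_sum {O : Type*} (s : Finset O) (P : Finset ι)
    (M : O → Matrix (∀ i : P, X i) (∀ i : P, X i) ℂ) :
    onSubset P (∑ o ∈ s, M o) = ∑ o ∈ s, onSubset P (M o) := by
  ext x y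
  simp only [onSubset, of_apply, Matrix.sum_apply]
  split_ifs <;> simp

lemma onSingle_mul_piTensor_trace [∀ i, Fintype (X i)] (i : ι) (M : Matrix (X i) (X i) ℂ)
    (σ : ∀ i, Matrix (X i) (X i) ℂ) :
    (onSingle i M * piTensor σ).trace =
      (M * σ i).trace * ∏ j ∈ Finset.univ.erase i, (σ j).trace := by
  have h : onSingle i M = piTensor (Function.update (fun j => 1) i M) := by
    ext x y
    simp only [onSingle, piTensor, of_apply]
    rw [← Finset.mul_prod_erase _ _ (Finset.mem_univ i), Function.update_self,
      Finset.prod_congr rfl (g := fun j => if x j = y j then (1 : ℂ) else 0)]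
    · rw [Finset.prod_ite_zero]
      simp
    · intro j hj
      rw [Function.update_of_ne (Finset.ne_of_mem_erase hj), one_apply]
  rw [h, piTensor_mul, piTensor_trace, ← Finset.mul_prod_erase _ _ (Finset.mem_univ i),
    Function.update_self]
  congr 1
  refine Finset.prod_congr rfl fun j hj => ?_
  rw [Function.update_of_ne (Finset.ne_of_mem_erase hj), one_mul]

lemma onSubset_piTensor_mul_trace [∀ i, Fintype (X i)] (P : Finset ι)
    (A : ∀ i : P, Matrix (X i) (X i) ℂ) (σ : ∀ i, Matrix (X i) (X i) ℂ) :
    (onSubset P (piTensor A) * piTensor σ).trace =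
      (∏ i : P, (A i * σ i).trace) * ∏ i ∈ Pᶜ, (σ i).trace := by
  rw [onSubset_piTensor, piTensor_mul, piTensor_trace, ← Finset.prod_mul_prod_compl P,
    ← Finset.prod_coe_sort P]
  congr 1
  · refine Finset.prod_congr rfl fun i _ => ?_
    rw [dif_pos i.2]
  · refine Finset.prod_congr rfl fun i hi => ?_
    rw [dif_neg (by simpa using hi), one_mul]

end OnSubset

/-! ### Correctness, branch by branch -/

section Correctness

variable {n : ℕ} {C : ClassicalScheme n} {T : TwoOfTwo} {m : ℕ}

lemma ketbra_mul_ketbra_trace {X : Type} [Fintype X] [DecidableEq X] (d e : X) :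
    (ketbra d * ketbra e).trace = if d = e then 1 else 0 := by
  split_ifs with h
  · subst h
    simp [ketbra]
  · simp [ketbra, h]

/-- The share registers for fixed values of all classical random variables. -/
def compileTerm (C : ClassicalScheme n) (T : TwoOfTwo) (m sec : ℕ)
    (sh : ∀ i, Bits (C.shareLen m i)) (csh : ∀ i, Bits (clen C T m sec i))
    (vk : ∀ i, T.VK (kappa n sec) (C.shareLen m i))
    (cc : ∀ j i, Bits (C.shareLen (clen C T m sec j) i)) (i : Fin n) :
    Matrix (ShareReg C T m sec i) (ShareReg C T m sec i) ℂ :=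
  T.split (kappa n sec) (C.shareLen m i) (sh i) (csh i, vk i) ⊗ₖ ketbra fun j => cc j i

/-- By linearity, an event is certain once it is certain for every choice of classical shares of
positive probability; the other terms have weight zero. -/
lemma trace_mul_compileSplit {sec : ℕ} {s : Bits m}
    {vk : ∀ i, T.VK (kappa n sec) (C.shareLen m i)}
    (O : Matrix (∀ i, ShareReg C T m sec i) (∀ i, ShareReg C T m sec i) ℂ)
    (h : ∀ sh csh cc, C.split m s sh ≠ 0 → (∀ j, C.split _ (csh j) (cc j) ≠ 0) →
      (O * piTensor (compileTerm C T m sec sh csh vk cc)).trace =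
        (piTensor (compileTerm C T m sec sh csh vk cc)).trace) :
    (O * compileSplit C T m sec s vk).trace = (compileSplit C T m sec s vk).trace := by
  simp only [compileSplit, Finset.mul_sum, trace_sum]
  refine Finset.sum_congr rfl fun sh _ => Finset.sum_congr rfl fun csh _ =>
    Finset.sum_congr rfl fun cc _ => ?_
  rw [Matrix.mul_smul, trace_smul, trace_smul]
  by_cases hw : C.split m s sh ≠ 0 ∧ ∀ j, C.split _ (csh j) (cc j) ≠ 0
  · exact congrArg _ (h sh csh cc hw.1 hw.2)
  · have : (C.split m s sh).toReal * ∏ j, (C.split _ (csh j) (cc j)).toReal = 0 := by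
      rw [not_and_or] at hw
      rcases hw with hw | hw
      · rw [not_not.mp hw]
        simp
      · push Not at hw
        obtain ⟨j, hj⟩ := hw
        rw [Finset.prod_eq_zero (Finset.mem_univ j) (by rw [hj]; simp), mul_zero]
    rw [this]
    simp

lemma sum_trace_delete_mul_compileSplit (hT : T.DeletionCorrect) (sec : ℕ) (s : Bits m)
    (i : Fin n) (vk : ∀ i, T.VK (kappa n sec) (C.shareLen m i)) :
    ∑ cert, (if T.verify (kappa n sec) (C.shareLen m i) (vk i) cert = true then
      (onSingle i (T.delete (kappa n sec) (C.shareLen m i) cert ⊗ₖ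
        (1 : Matrix (ClassicalPart C T m sec i) (ClassicalPart C T m sec i) ℂ)) *
          compileSplit C T m sec s vk).trace else 0) = (compileSplit C T m sec s vk).trace := by
  have key := trace_mul_compileSplit (C := C) (T := T) (s := s) (vk := vk)
    (∑ cert, if T.verify (kappa n sec) (C.shareLen m i) (vk i) cert = true then
      onSingle i (T.delete (kappa n sec) (C.shareLen m i) cert ⊗ₖ
        (1 : Matrix (ClassicalPart C T m sec i) (ClassicalPart C T m sec i) ℂ)) else 0) ?_
  · rw [Finset.sum_mul, trace_sum] at key
    refine Eq.trans (Finset.sum_congr rfl fun cert _ => ?_) key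
    split_ifs <;> simp
  · intro sh csh cc _ _
    rw [Finset.sum_mul, trace_sum, piTensor_trace, ← Finset.mul_prod_erase _ _ (Finset.mem_univ i)]
    have : (compileTerm C T m sec sh csh vk cc i).trace =
        (T.split (kappa n sec) (C.shareLen m i) (sh i) (csh i, vk i)).trace := by
      rw [compileTerm, trace_kronecker, ketbra_trace, mul_one]
    rw [this, ← hT.trace_eq, Finset.sum_mul]
    refine Finset.sum_congr rfl fun cert _ => ?_
    split_ifs
    · rw [onSingle_mul_piTensor_trace]
      congr 1
      rw [compileTerm, ← mul_kronecker_mul, one_mul, trace_kronecker, ketbra_trace, mul_one]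
    · simp

lemma compile_deletionCorrect (hT : T.DeletionCorrect) : (compile C T m).DeletionCorrect := by
  intro sec s i
  rw [← (compileSplit_isEnsemble C T m sec s).trace_eq_one]
  exact Finset.sum_congr rfl fun vk _ => sum_trace_delete_mul_compileSplit hT sec s i vk

lemma trace_compileReconstruct_mul_compileSplit {S : UpperSet (Finset (Fin n))} (hT : T.Correct)
    (hC : C.Correct S) (sec : ℕ) (s : Bits m) {P : Finset (Fin n)} (hP : P ∈ S)
    (vk : ∀ i, T.VK (kappa n sec) (C.shareLen m i)) :
    (onSubset P (compileReconstruct C T m sec P (some s)) * compileSplit C T m sec s vk).trace =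
      (compileSplit C T m sec s vk).trace := by
  refine trace_mul_compileSplit (C := C) (T := T) (s := s) (vk := vk)
    (onSubset P (compileReconstruct C T m sec P (some s))) ?_
  intro sh csh cc hsh hcc
  -- The classical parts that the parties in `P` really hold; any other measured value `d`
  -- contributes trace zero.
  set d₀ : ∀ i : P, ClassicalPart C T m sec i := fun i j => cc j i with hd₀
  have hdec : decode C T m sec P d₀ = some fun i : P => csh i := by
    have h : ∀ i : P, C.reconstruct (clen C T m sec i) P (fun j => d₀ j i) = some (csh i) :=
      fun i => PMF_map_eq_pure (hC (clen C T m sec i) (csh i) P hP) (hcc i)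
    have h' : ∀ i : P, (C.reconstruct (clen C T m sec i) P fun j => d₀ j i).isSome = true :=
      fun i => by rw [h]; rfl
    rw [decode, dif_pos h']
    simp only [h, Option.get_some]
  have hrec : C.reconstruct m P (fun i => sh i) = some s := PMF_map_eq_pure (hC m s P hP) hsh
  have hkron : ∀ (d : ∀ i : P, ClassicalPart C T m sec i)
      (A : ∀ i : P, Matrix (T.Q (kappa n sec) (C.shareLen m i)) _ ℂ),
      (onSubset P (piTensor fun i => A i ⊗ₖ ketbra (d i)) *
        piTensor (compileTerm C T m sec sh csh vk cc)).trace =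
      if d = d₀ then (∏ i : P, (A i * T.split (kappa n sec) (C.shareLen m i) (sh i)
        (csh i, vk i)).trace) * ∏ i ∈ Pᶜ, (compileTerm C T m sec sh csh vk cc i).trace else 0 := by
    intro d A
    rw [onSubset_piTensor_mul_trace]
    simp only [compileTerm, ← mul_kronecker_mul, trace_kronecker, ketbra_mul_ketbra_trace]
    rw [Finset.prod_mul_distrib, Finset.prod_ite_zero]
    by_cases h : d = d₀
    · rw [if_pos h, if_pos (fun i _ => congrFun h i)]
      simp
    · rw [if_neg h, if_neg (fun h' => h (funext fun i => h' i (Finset.mem_univ _)))]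
      simp
  rw [compileReconstruct, onSubset_sum, Finset.sum_mul, trace_sum, Finset.sum_eq_single d₀]
  · simp only [hdec]
    rw [onSubset_sum, Finset.sum_mul, trace_sum, Finset.sum_eq_single (fun i : P => sh i)]
    · rw [if_pos hrec, hkron, if_pos rfl, piTensor_trace, ← Finset.prod_mul_prod_compl P,
        ← Finset.prod_coe_sort P]
      congr 1
      refine Finset.prod_congr rfl fun i _ => ?_
      rw [hT.trace_eq, if_pos rfl, compileTerm, trace_kronecker, ketbra_trace, mul_one]
    · intro sh' _ hne
      split_ifs
      · obtain ⟨i, hi⟩ := Function.ne_iff.mp hne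
        rw [hkron, if_pos rfl, Finset.prod_eq_zero (Finset.mem_univ i), zero_mul]
        rw [hT.trace_eq, if_neg hi]
      · simp [onSubset_zero]
    · simp
  · intro d _ hd
    cases decode C T m sec P d with
    | none => simp [onSubset_zero]
    | some csh' =>
      simp only
      rw [onSubset_sum, Finset.sum_mul, trace_sum]
      refine Finset.sum_eq_zero fun sh' _ => ?_
      split_ifs
      · rw [hkron, if_neg hd]
      · simp [onSubset_zero]
  · simp

lemma compile_reconstructionCorrect {S : UpperSet (Finset (Fin n))} (hT : T.Correct)
    (hC : C.Correct S) : (compile C T m).ReconstructionCorrect S := by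
  intro sec s P hP
  rw [← (compileSplit_isEnsemble C T m sec s).trace_eq_one]
  exact Finset.sum_congr rfl fun vk _ =>
    trace_compileReconstruct_mul_compileSplit hT hC sec s hP vk

end Correctness

end

end CertDel

namespace CertDel

open Matrix
open scoped ComplexOrder Kronecker

noncomputable section

/-! ## Running one part of the adversary first -/

section TwoStage

variable {ι : Type} [Fintype ι] [DecidableEq ι] {O X Y : ι → Type}

lemma piTensor_update_sum {Y : ι → Type} {Λ : Type} [Fintype Λ]
    (B : ∀ t, Matrix (Y t) (X t) ℂ) (t₀ : ι) (M : Λ → Matrix (Y t₀) (X t₀) ℂ) :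
    ∑ o, piTensor (Function.update B t₀ (M o)) = piTensor (Function.update B t₀ (∑ o, M o)) := by
  have h : ∀ M₀ : Matrix (Y t₀) (X t₀) ℂ, piTensor (Function.update B t₀ M₀) =
      of fun y x => M₀ (y t₀) (x t₀) * ∏ t ∈ Finset.univ.erase t₀, B t (y t) (x t) := by
    intro M₀
    ext y x
    simp only [piTensor, of_apply]
    rw [← Finset.mul_prod_erase _ _ (Finset.mem_univ t₀), Function.update_self]
    congr 1
    refine Finset.prod_congr rfl fun t ht => ?_
    rw [Function.update_of_ne (Finset.ne_of_mem_erase ht)]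
  ext y x
  simp only [h, Matrix.sum_apply, of_apply, Finset.sum_mul]

/-- The Kraus operators of the part `t₀`, which keep the registers of all other parts. -/
def firstStage [∀ t, DecidableEq (X t)] (t₀ : ι) (M : Matrix (Y t₀) (X t₀) ℂ) :
    Matrix (∀ t, Y t ⊕ X t) (∀ t, X t) ℂ :=
  piTensor (Function.update (fun _ => fromRows 0 1) t₀ (fromRows M 0))

/-- The Kraus operators of a part that has already been run (`none`) or not. -/
def resume [∀ t, DecidableEq (Y t)] (M : ∀ t, O t → Matrix (Y t) (X t) ℂ) (t : ι) :
    Option (O t) → Matrix (Y t) (Y t ⊕ X t) ℂ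
  | none => fromCols 1 0
  | some o => fromCols 0 (M t o)

/-- The outcomes of all parts other than `t₀`. -/
def skipPart (t₀ : ι) (o : ∀ t : {t // t ≠ t₀}, O t) (t : ι) : Option (O t) :=
  if h : t = t₀ then none else some (o ⟨t, h⟩)

lemma skipPart_injective (t₀ : ι) :
    Function.Injective (skipPart t₀ : (∀ t : {t // t ≠ t₀}, O t) → ∀ t, Option (O t)) := by
  intro o o' h
  funext t
  have := congrFun h t
  simpa [skipPart, t.2] using this

/-- The Kraus operators of all parts other than `t₀`. -/
def secondStage [∀ t, DecidableEq (Y t)] (M : ∀ t, O t → Matrix (Y t) (X t) ℂ) (t₀ : ι)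
    (o : ∀ t : {t // t ≠ t₀}, O t) : Matrix (∀ t, Y t) (∀ t, Y t ⊕ X t) ℂ :=
  piTensor fun t => resume M t (skipPart t₀ o t)

variable [∀ t, Fintype (X t)] [∀ t, DecidableEq (X t)] [∀ t, Fintype (Y t)]
  [∀ t, DecidableEq (Y t)]

/-- The intermediate register `Y t ⊕ X t` records whether part `t` has been run. After the first
stage part `t₀` is in the left summand, which `resume` leaves alone, and every other part is in the
right one, where its operator still acts. -/
lemma secondStage_mul_firstStage (M : ∀ t, O t → Matrix (Y t) (X t) ℂ) (t₀ : ι) (o₀ : O t₀)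
    (o : ∀ t : {t // t ≠ t₀}, O t) : secondStage M t₀ o * firstStage t₀ (M t₀ o₀) =
      piTensor fun t => M t ((Equiv.piSplitAt t₀ O).symm (o₀, o) t) := by
  rw [secondStage, firstStage, piTensor_mul]
  congr 1
  funext t
  by_cases h : t = t₀
  · subst h
    simp [skipPart, resume, fromCols_mul_fromRows, Equiv.piSplitAt]
  · simp [skipPart, resume, fromCols_mul_fromRows, Equiv.piSplitAt, h]

lemma firstStage_sum {Λ : Type} [Fintype Λ] (t₀ : ι) {M : Λ → Matrix (Y t₀) (X t₀) ℂ}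
    (hM : ∑ o, (M o)ᴴ * M o = 1) :
    ∑ o, (firstStage t₀ (M o))ᴴ * firstStage t₀ (M o) = 1 := by
  have h : ∀ o, (firstStage t₀ (M o))ᴴ * firstStage t₀ (M o) =
      piTensor (Function.update (fun t => (1 : Matrix (X t) (X t) ℂ)) t₀ ((M o)ᴴ * M o)) := by
    intro o
    rw [firstStage, piTensor_conjTranspose, piTensor_mul]
    congr 1
    funext t
    by_cases h : t = t₀
    · subst h
      simp [conjTranspose_fromRows_eq_fromCols_conjTranspose, fromCols_mul_fromRows]
    · simp [conjTranspose_fromRows_eq_fromCols_conjTranspose, fromCols_mul_fromRows, h]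
  simp_rw [h]
  rw [piTensor_update_sum, hM, Function.update_eq_self, piTensor_one]

variable [∀ t, Fintype (O t)]

lemma resume_sum {M : ∀ t, O t → Matrix (Y t) (X t) ℂ} {t : ι}
    (hM : ∑ o, (M t o)ᴴ * M t o = 1) : ∑ o, (resume M t o)ᴴ * resume M t o = 1 := by
  rw [Fintype.sum_option]
  simp only [resume, conjTranspose_fromCols_eq_fromRows_conjTranspose, fromRows_mul_fromCols]
  ext (x | x) (y | y)
  · simp [Matrix.sum_apply, Matrix.one_apply]
  · simp [Matrix.sum_apply]
  · simp [Matrix.sum_apply]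
  · have := congrFun (congrFun hM x) y
    simpa [Matrix.sum_apply, Matrix.one_apply] using this

/-- The second-stage operators form a subfamily of the complete family in which each part either
rests (`none`) or runs (`some o`), so dropping the other outcomes can only lower the trace of a
positive state. -/
lemma secondStage_trace_le {M : ∀ t, O t → Matrix (Y t) (X t) ℂ} (t₀ : ι)
    (hM : ∀ t, ∑ o, (M t o)ᴴ * M t o = 1) (ok : (∀ t : {t // t ≠ t₀}, O t) → Prop)
    [DecidablePred ok] {P : Matrix (∀ t, Y t ⊕ X t) (∀ t, Y t ⊕ X t) ℂ} (hP : P.PosSemidef) :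
    (∑ o, if ok o then secondStage M t₀ o * P * (secondStage M t₀ o)ᴴ else 0).trace.re ≤
      P.trace.re := by
  classical
  have h1 : ∑ o : ∀ t, Option (O t), (piTensor fun t => resume M t (o t))ᴴ *
      (piTensor fun t => resume M t (o t)) = (1 : ℂ) • 1 := by
    simp_rw [piTensor_conjTranspose, piTensor_mul]
    rw [piTensor_sum (fun t o => (resume M t o)ᴴ * resume M t o)]
    simp_rw [resume_sum (hM _)]
    rw [piTensor_one, one_smul]
  have h2 := trace_sum_kraus _ h1 P
  rw [one_mul] at h2
  rw [← h2, trace_sum, trace_sum, Complex.re_sum, Complex.re_sum]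
  have hnn : ∀ o : ∀ t, Option (O t), 0 ≤ ((piTensor fun t => resume M t (o t)) * P *
      (piTensor fun t => resume M t (o t))ᴴ).trace.re := fun o =>
    posSemidef_re_trace_nonneg (hP.mul_mul_conjTranspose_same _)
  refine le_trans (b := ∑ o, ((secondStage M t₀ o) * P * (secondStage M t₀ o)ᴴ).trace.re)
    (Finset.sum_le_sum fun o _ => ?_) ?_
  · split_ifs
    · exact le_rfl
    · rw [trace_zero, Complex.zero_re]
      exact hnn (skipPart t₀ o)
  · change ∑ o, ((piTensor fun t => resume M t (skipPart t₀ o t)) * P *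
      (piTensor fun t => resume M t (skipPart t₀ o t))ᴴ).trace.re ≤ _
    rw [← Finset.sum_image (g := skipPart t₀)
      (f := fun o => ((piTensor fun t => resume M t (o t)) * P *
        (piTensor fun t => resume M t (o t))ᴴ).trace.re)
      fun a _ b _ h => skipPart_injective t₀ h]
    exact Finset.sum_le_sum_of_subset_of_nonneg (Finset.subset_univ _) fun o _ _ => hnn o

/-- The differences `Δ c vk` of the states of two secrets become close under every operation, if its
outcome is accepted and `c` is revealed afterwards. -/
def RevealBound {Q Γ V Ce : Type} [Fintype Q] [DecidableEq Q] [Fintype Γ] [Fintype V] [Fintype Ce]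
    (acc : V → Ce → Bool) (Δ : Γ → V → Matrix Q Q ℂ) (δ : ℝ) : Prop :=
  ∀ (R K : Type) [Fintype R] [DecidableEq R] [Fintype K] (F : Ce → K → Matrix R Q ℂ) (p : ℝ),
    0 ≤ p → ∑ o, ∑ k, (F o k)ᴴ * F o k = (p : ℂ) • 1 →
    ∃ P N : Γ → Matrix R R ℂ, (∀ c, (P c).PosSemidef) ∧ (∀ c, (N c).PosSemidef) ∧
      (∀ c, (∑ vk, ∑ cert, if acc vk cert = true then
        ∑ k, F cert k * Δ c vk * (F cert k)ᴴ else 0) = P c - N c) ∧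
      ∑ c, ((P c).trace + (N c).trace).re ≤ p * (2 * δ)

variable {Q Γ V Ce L CC CX : Type} [Fintype Q] [DecidableEq Q] [Fintype Γ] [Fintype V]
  [Fintype Ce] [DecidableEq Ce] [Fintype L] [Fintype CC] [Fintype CX] [DecidableEq CX]

lemma sum_pi_eq_sum_split {M : Type*} [AddCommMonoid M] (t₀ : ι) (f : (∀ t, O t) → M) :
    ∑ o, f o = ∑ o₀ : O t₀, ∑ o' : ∀ t : {t // t ≠ t₀}, O t,
      f ((Equiv.piSplitAt t₀ O).symm (o₀, o')) := by
  rw [← (Equiv.piSplitAt t₀ O).symm.sum_comp, Fintype.sum_prod_type]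

-- The operation submitted to the reveal game prepares the registers with `Ψ`, runs part `t₀` alone
-- and keeps all other registers in its residual register. It is complete up to `p` because
-- `firstStage` is complete.
omit [∀ t, Fintype (O t)] in
lemma exists_firstStage_decomposition {t₀ : ι} [Fintype (O t₀)]
    {M : O t₀ → Matrix (Y t₀) (X t₀) ℂ}
    (hM : ∑ o, (M o)ᴴ * M o = 1) {acc : V → Ce → Bool} {bot : Ce}
    (hbot : ∀ vk, acc vk bot = false) {Δ : Γ → V → Matrix Q Q ℂ} {δ : ℝ}
    (hΔ : RevealBound acc Δ δ) {Ψ : L → Matrix (∀ t, X t) Q ℂ} {p : ℝ} (hp : 0 ≤ p)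
    (hΨ : ∑ l, (Ψ l)ᴴ * Ψ l = (p : ℂ) • 1) (ce : O t₀ → Ce) (ok : O t₀ → Prop)
    [DecidablePred ok] :
    ∃ P N : Γ → Matrix (∀ t, Y t ⊕ X t) (∀ t, Y t ⊕ X t) ℂ, (∀ c, (P c).PosSemidef) ∧
      (∀ c, (N c).PosSemidef) ∧
      (∀ c, (∑ vk, ∑ o, if acc vk (ce o) = true ∧ ok o then
        firstStage t₀ (M o) * (∑ l, Ψ l * Δ c vk * (Ψ l)ᴴ) * (firstStage t₀ (M o))ᴴ else 0) =
          P c - N c) ∧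
      ∑ c, ((P c).trace + (N c).trace).re ≤ p * (2 * δ) := by
  -- The extra condition `ok` is absorbed into the game by submitting the always rejected
  -- certificate `bot` when it fails.
  let out : O t₀ → Ce := fun o => if ok o then ce o else bot
  obtain ⟨P, N, hP, hN, e, ht⟩ := hΔ (∀ t, Y t ⊕ X t) (O t₀ × L)
    (fun cert k => if cert = out k.1 then firstStage t₀ (M k.1) * Ψ k.2 else 0) p hp (by
      rw [Finset.sum_comm, Fintype.sum_prod_type, Finset.sum_comm, ← hΨ]
      refine Finset.sum_congr rfl fun l _ => ?_
      have : ∀ o : O t₀, (∑ cert, (if cert = out o then firstStage t₀ (M o) * Ψ l else 0)ᴴ *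
          (if cert = out o then firstStage t₀ (M o) * Ψ l else 0)) =
          (Ψ l)ᴴ * ((firstStage t₀ (M o))ᴴ * firstStage t₀ (M o)) * Ψ l := by
        intro o
        rw [Finset.sum_eq_single (out o)]
        · simp [conjTranspose_mul, Matrix.mul_assoc]
        · intro cert _ h
          simp [h]
        · simp
      simp_rw [this]
      rw [← Matrix.sum_mul, ← Matrix.mul_sum, firstStage_sum t₀ hM, Matrix.mul_one])
  refine ⟨P, N, hP, hN, fun c => ?_, ht⟩
  rw [← e]
  refine Finset.sum_congr rfl fun vk _ => ?_
  have hcert : ∀ cert, (if acc vk cert = true then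
      ∑ k : O t₀ × L, (if cert = out k.1 then firstStage t₀ (M k.1) * Ψ k.2 else 0) * Δ c vk *
        (if cert = out k.1 then firstStage t₀ (M k.1) * Ψ k.2 else 0)ᴴ else 0) =
      ∑ o, if cert = out o then (if acc vk cert = true then
        firstStage t₀ (M o) * (∑ l, Ψ l * Δ c vk * (Ψ l)ᴴ) * (firstStage t₀ (M o))ᴴ else 0)
          else 0 := by
    intro cert
    split_ifs with h
    · rw [Fintype.sum_prod_type]
      refine Finset.sum_congr rfl fun o _ => ?_
      split_ifs
      · rw [Matrix.mul_sum, Matrix.sum_mul]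
        refine Finset.sum_congr rfl fun l _ => ?_
        simp only [conjTranspose_mul, Matrix.mul_assoc]
      · simp
    · simp
  simp_rw [hcert]
  rw [Finset.sum_comm]
  refine Finset.sum_congr rfl fun o _ => ?_
  rw [Finset.sum_ite_eq', if_pos (Finset.mem_univ _)]
  by_cases h : ok o
  · simp [out, h]
  · simp [out, h, hbot]

/-- The classical data `cc` depends on the revealed value `c`, but part `t₀` sees only `r cc`, whose
law `sim` does not depend on `c`. For each value `x` of `r cc` the first stage is therefore an
attack on the reveal game that needs no knowledge of `c`. The second stage, which uses all of `cc`,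
comes after the reveal and only loses trace. -/
lemma TNle_twoStage {t₀ : ι} {M : CC → ∀ t, O t → Matrix (Y t) (X t) ℂ}
    (hM : ∀ cc t, ∑ o, (M cc t o)ᴴ * M cc t o = 1) {r : CC → CX}
    (hr : ∀ cc cc', r cc = r cc' → M cc t₀ = M cc' t₀) {pr : Γ → CC → ℝ}
    (hpr : ∀ c cc, 0 ≤ pr c cc) {sim : CX → ℝ} (hsim0 : ∀ x, 0 ≤ sim x)
    (hsim : ∀ c x, (∑ cc, if r cc = x then pr c cc else 0) = sim x) (hsim1 : ∑ x, sim x = 1)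
    {acc : V → Ce → Bool} {bot : Ce}
    (hbot : ∀ vk, acc vk bot = false) {Δ : Γ → V → Matrix Q Q ℂ} {δ : ℝ} (hδ : 0 ≤ δ)
    (hΔ : RevealBound acc Δ δ) {Ψ : L → Matrix (∀ t, X t) Q ℂ} {p : ℝ} (hp : 0 ≤ p)
    (hΨ : ∑ l, (Ψ l)ᴴ * Ψ l = (p : ℂ) • 1) (ce : O t₀ → Ce) (ok : ∀ t, O t → Prop)
    [∀ t, DecidablePred (ok t)] :
    TNle (∑ c, ∑ vk, ∑ cc, (pr c cc : ℂ) • ∑ o : ∀ t, O t,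
      if acc vk (ce (o t₀)) = true ∧ ∀ t, ok t (o t) then
        (piTensor fun t => M cc t (o t)) * (∑ l, Ψ l * Δ c vk * (Ψ l)ᴴ) *
          (piTensor fun t => M cc t (o t))ᴴ else 0) (p * (2 * δ)) := by
  have hdec : ∀ x : CX, ∃ P N : Γ → Matrix (∀ t, Y t ⊕ X t) (∀ t, Y t ⊕ X t) ℂ,
      (∀ c, (P c).PosSemidef) ∧ (∀ c, (N c).PosSemidef) ∧
      (∀ cc, r cc = x → ∀ c, (∑ vk, ∑ o, if acc vk (ce o) = true ∧ ok t₀ o then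
        firstStage t₀ (M cc t₀ o) * (∑ l, Ψ l * Δ c vk * (Ψ l)ᴴ) *
          (firstStage t₀ (M cc t₀ o))ᴴ else 0) = P c - N c) ∧
      ∑ c, ((P c).trace + (N c).trace).re ≤ p * (2 * δ) := by
    intro x
    -- Values outside the range of `r` never occur, so the zero decomposition serves for them.
    by_cases hx : ∃ cc, r cc = x
    · obtain ⟨cc, rfl⟩ := hx
      obtain ⟨P, N, hP, hN, e, ht⟩ :=
        exists_firstStage_decomposition (hM cc t₀) hbot hΔ hp hΨ ce (ok t₀)
      refine ⟨P, N, hP, hN, fun cc' h c => ?_, ht⟩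
      rw [hr cc' cc h]
      exact e c
    · exact ⟨0, 0, fun _ => .zero, fun _ => .zero, fun cc h => absurd ⟨cc, h⟩ hx,
        by simpa using mul_nonneg hp (by linarith)⟩
  choose P N hP hN e ht using hdec
  let ok' : (∀ t : {t // t ≠ t₀}, O t) → Prop := fun o => ∀ t : {t // t ≠ t₀}, ok t (o t)
  let G : CC → Matrix (∀ t, Y t ⊕ X t) (∀ t, Y t ⊕ X t) ℂ → Matrix (∀ t, Y t) (∀ t, Y t) ℂ :=
    fun cc A => ∑ o, if ok' o then secondStage (M cc) t₀ o * A * (secondStage (M cc) t₀ o)ᴴ else 0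
  have hGpos : ∀ cc A, A.PosSemidef → (G cc A).PosSemidef := by
    intro cc A hA
    refine posSemidef_sum _ fun o _ => ?_
    split_ifs
    exacts [hA.mul_mul_conjTranspose_same _, .zero]
  have key : ∀ c cc, (∑ vk, ∑ o : ∀ t, O t,
      if acc vk (ce (o t₀)) = true ∧ ∀ t, ok t (o t) then
        (piTensor fun t => M cc t (o t)) * (∑ l, Ψ l * Δ c vk * (Ψ l)ᴴ) *
          (piTensor fun t => M cc t (o t))ᴴ else 0) = G cc (P (r cc) c) - G cc (N (r cc) c) := by
    intro c cc
    have hG : G cc (P (r cc) c) - G cc (N (r cc) c) = G cc (P (r cc) c - N (r cc) c) := by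
      simp only [G]
      rw [← Finset.sum_sub_distrib]
      refine Finset.sum_congr rfl fun o _ => ?_
      split_ifs
      · rw [Matrix.mul_sub, Matrix.sub_mul]
      · simp
    rw [hG, ← e (r cc) cc rfl c]
    simp only [G, sum_pi_eq_sum_split t₀]
    have hswap : ∀ f : V → O t₀ → (∀ t : {t // t ≠ t₀}, O t) → Matrix (∀ t, Y t) (∀ t, Y t) ℂ,
        ∑ vk, ∑ o₀, ∑ o', f vk o₀ o' = ∑ o', ∑ vk, ∑ o₀, f vk o₀ o' := by
      intro f
      rw [Finset.sum_congr rfl fun vk _ => Finset.sum_comm, Finset.sum_comm]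
    rw [hswap]
    refine Finset.sum_congr rfl fun o' _ => ?_
    -- The condition factorizes over the parts: the factor at `t₀` belongs to the first stage, the
    -- rest to the second.
    have hok : ∀ o₀, (∀ t, ok t ((Equiv.piSplitAt t₀ O).symm (o₀, o') t)) ↔ ok t₀ o₀ ∧ ok' o' := by
      intro o₀
      constructor
      · intro h
        refine ⟨by simpa [Equiv.piSplitAt] using h t₀, fun t => ?_⟩
        have := h t
        simpa [Equiv.piSplitAt, t.2] using this
      · rintro ⟨h1, h2⟩ t
        by_cases ht : t = t₀
        · subst ht
          simpa [Equiv.piSplitAt] using h1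
        · simpa [Equiv.piSplitAt, ht] using h2 ⟨t, ht⟩
    have h0 : ∀ o₀, (Equiv.piSplitAt t₀ O).symm (o₀, o') t₀ = o₀ := by
      intro o₀
      simp [Equiv.piSplitAt]
    simp only [hok, h0]
    by_cases h : ok' o'
    · simp only [h, and_true, if_true, Matrix.mul_sum, Matrix.sum_mul]
      refine Finset.sum_congr rfl fun vk _ => Finset.sum_congr rfl fun o₀ _ => ?_
      split_ifs
      · rw [← secondStage_mul_firstStage]
        simp only [Matrix.mul_sum, Matrix.sum_mul]
        refine Finset.sum_congr rfl fun l _ => ?_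
        simp only [conjTranspose_mul, Matrix.mul_assoc]
      · simp
    · simp [h]
  have hsum : (∑ c, ∑ vk, ∑ cc, (pr c cc : ℂ) • ∑ o : ∀ t, O t,
      if acc vk (ce (o t₀)) = true ∧ ∀ t, ok t (o t) then
        (piTensor fun t => M cc t (o t)) * (∑ l, Ψ l * Δ c vk * (Ψ l)ᴴ) *
          (piTensor fun t => M cc t (o t))ᴴ else 0) =
      ∑ c, ∑ cc, (pr c cc : ℂ) • (G cc (P (r cc) c) - G cc (N (r cc) c)) := by
    refine Finset.sum_congr rfl fun c _ => ?_
    rw [Finset.sum_comm]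
    refine Finset.sum_congr rfl fun cc _ => ?_
    rw [← key, Finset.smul_sum]
  rw [hsum]
  refine (TNle.sum _ fun c _ => TNle.sum _ fun cc _ => (TNle_sub_of_posSemidef
    (hGpos cc _ (hP (r cc) c)) (hGpos cc _ (hN (r cc) c))).smul_nonneg (hpr c cc)).mono ?_
  calc ∑ c, ∑ cc, pr c cc * ((G cc (P (r cc) c)).trace + (G cc (N (r cc) c)).trace).re
      ≤ ∑ c, ∑ cc, pr c cc * ((P (r cc) c).trace + (N (r cc) c).trace).re := by
        refine Finset.sum_le_sum fun c _ => Finset.sum_le_sum fun cc _ =>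
          mul_le_mul_of_nonneg_left ?_ (hpr c cc)
        rw [Complex.add_re, Complex.add_re]
        exact add_le_add (secondStage_trace_le t₀ (hM cc) ok' (hP _ c))
          (secondStage_trace_le t₀ (hM cc) ok' (hN _ c))
    -- After the second stage has been bounded, the weights enter only through the law of `r cc`,
    -- which is `sim` for every `c`; this frees the sum over `c` for the reveal bound.
    _ = ∑ c, ∑ x, sim x * ((P x c).trace + (N x c).trace).re := by
        refine Finset.sum_congr rfl fun c _ => ?_
        simp_rw [← hsim c, Finset.sum_mul]
        rw [Finset.sum_comm]
        refine Finset.sum_congr rfl fun cc _ => ?_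
        simp
    _ = ∑ x, sim x * ∑ c, ((P x c).trace + (N x c).trace).re := by
        rw [Finset.sum_comm]
        simp_rw [Finset.mul_sum]
    _ ≤ ∑ x, sim x * (p * (2 * δ)) :=
        Finset.sum_le_sum fun x _ => mul_le_mul_of_nonneg_left (ht x) (hsim0 x)
    _ = p * (2 * δ) := by rw [← Finset.sum_mul, hsim1, one_mul]

end TwoStage

end

end CertDel

namespace CertDel

open Matrix
open scoped ComplexOrder Kronecker

noncomputable section

/-! ## Grouping registers by the parts of a partition -/

section Grouping

variable {ι τ : Type} (part : ι → τ)

/-- A family indexed by the parties and one indexed by the parts, grouped by the parts. -/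
def groupEquiv (F : ι → Type) (G : τ → Type) :
    ((∀ i, F i) × ∀ t, G t) ≃ ∀ t, (∀ i : {i // part i = t}, F i) × G t where
  toFun x t := (fun i => x.1 i, x.2 t)
  invFun z := (fun i => (z (part i)).1 ⟨i, rfl⟩, fun t => (z t).2)
  left_inv _ := rfl
  right_inv z := by
    funext t
    refine Prod.ext ?_ rfl
    funext ⟨i, hi⟩
    subst hi
    rfl

/-- The isometry that maps the basis vector `x` to the basis vector `f x`. -/
def relabel {Z X : Type} [DecidableEq Z] (f : X → Z) : Matrix Z X ℂ :=
  of fun z x => if z = f x then 1 else 0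

lemma mul_relabel {Y Z X : Type} [Fintype Z] [DecidableEq Z] (f : X → Z) (J : Matrix Y Z ℂ) :
    J * relabel f = J.submatrix id f := by
  ext y x
  simp [Matrix.mul_apply, relabel]

/-- A matrix supported on the basis vectors in the range of `f` is the isometric image of its
restriction. This is used to remove classical registers with a fixed value. -/
lemma eq_relabel_conj {Z X : Type} [Fintype X] [DecidableEq Z] (f : X → Z)
    (hf : Function.Injective f) (N : Matrix X X ℂ) (N' : Matrix Z Z ℂ)
    (h1 : ∀ x x', N' (f x) (f x') = N x x')
    (h2 : ∀ z z', z ∉ Set.range f ∨ z' ∉ Set.range f → N' z z' = 0) :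
    N' = relabel f * N * (relabel f)ᴴ := by
  classical
  have hV : ∀ z, z ∉ Set.range f → ∀ x, relabel f z x = 0 := by
    intro z hz x
    exact if_neg fun h => hz ⟨x, h.symm⟩
  ext z z'
  by_cases hz : z ∈ Set.range f
  · by_cases hz' : z' ∈ Set.range f
    · obtain ⟨x, rfl⟩ := hz
      obtain ⟨x', rfl⟩ := hz'
      rw [h1]
      simp [Matrix.mul_apply, relabel, hf.eq_iff]
    · rw [h2 _ _ (Or.inr hz'), Matrix.mul_apply]
      simp only [conjTranspose_apply, hV z' hz', star_zero, mul_zero, Finset.sum_const_zero]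
  · rw [h2 _ _ (Or.inl hz)]
    simp only [Matrix.mul_apply, hV z hz, zero_mul, Finset.sum_const_zero]

/-- An operator on quantum and classical registers, for fixed values `d` of the latter. -/
def withClassical {part : ι → τ} {Q CP : ι → Type} {Y I : Type} {t : τ}
    (E : Matrix Y ((∀ i : {i // part i = t}, Q i × CP i) × I) ℂ) (d : ∀ i, CP i) :
    Matrix Y ((∀ i : {i // part i = t}, Q i) × I) ℂ :=
  E.submatrix id fun x => (fun i => (x.1 i, d i), x.2)

lemma withClassical_congr {part : ι → τ} {Q CP : ι → Type} {Y I : Type} {t : τ}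
    (E : Matrix Y ((∀ i : {i // part i = t}, Q i × CP i) × I) ℂ) {d d' : ∀ i, CP i}
    (h : ∀ i, part i = t → d i = d' i) : withClassical E d = withClassical E d' := by
  have : ∀ x : (∀ i : {i // part i = t}, Q i) × I, (fun i : {i // part i = t} => (x.1 i, d i)) =
      fun i : {i // part i = t} => (x.1 i, d' i) := fun x => by
    funext i
    rw [h i i.2]
  simp only [withClassical, this]

variable [Fintype ι] [DecidableEq ι] [Fintype τ] [DecidableEq τ]
  {Q CP : ι → Type} {I Y : τ → Type} [∀ i, Fintype (Q i)] [∀ i, DecidableEq (Q i)]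
  [∀ i, Fintype (CP i)] [∀ i, DecidableEq (CP i)] [∀ t, Fintype (I t)] [∀ t, DecidableEq (I t)]

/-- For fixed classical registers `d`, the operations of the parts act on the quantum registers. -/
lemma joint_conj_eq (E : ∀ t, Matrix (Y t) ((∀ i : {i // part i = t}, Q i × CP i) × I t) ℂ)
    (B : ∀ i, Matrix (Q i) (Q i) ℂ) (d : ∀ i, CP i) (ρ : Matrix (∀ t, I t) (∀ t, I t) ℂ)
    (J : Matrix (∀ t, Y t) ((∀ i, Q i × CP i) × ∀ t, I t) ℂ)
    (hJ : ∀ y x, J y x = ∏ t, E t (y t) (fun i => x.1 i, x.2 t)) :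
    J * (piTensor (fun i => B i ⊗ₖ ketbra (d i)) ⊗ₖ ρ) * Jᴴ =
      piTensor (fun t => withClassical (E t) d) *
        (piTensor B ⊗ₖ ρ).submatrix (groupEquiv part Q I).symm (groupEquiv part Q I).symm *
        (piTensor (fun t => withClassical (E t) d))ᴴ := by
  let f : (∀ i, Q i) × (∀ t, I t) → (∀ i, Q i × CP i) × (∀ t, I t) :=
    fun x => (fun i => (x.1 i, d i), x.2)
  have hf : Function.Injective f := by
    rintro ⟨x, a⟩ ⟨x', a'⟩ h
    simp only [f, Prod.mk.injEq, funext_iff] at h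
    exact Prod.ext (funext fun i => (h.1 i).1) (funext h.2)
  have hrange : ∀ z : (∀ i, Q i × CP i) × (∀ t, I t), z ∉ Set.range f → ∃ i, (z.1 i).2 ≠ d i := by
    intro z hz
    by_contra! h
    refine hz ⟨(fun i => (z.1 i).1, z.2), ?_⟩
    refine Prod.ext (funext fun i => Prod.ext rfl (h i).symm) rfl
  -- Fixing the classical registers to `d` embeds the quantum registers isometrically; the embedding
  -- is then absorbed into the operators on both sides.
  have hlift := eq_relabel_conj f hf (piTensor B ⊗ₖ ρ)
    (piTensor (fun i => B i ⊗ₖ ketbra (d i)) ⊗ₖ ρ) (by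
      intro x x'
      simp [f, piTensor, ketbra]) (by
      rintro z z' h
      have : ∃ i, d i ≠ (z.1 i).2 ∨ d i ≠ (z'.1 i).2 := by
        rcases h with h | h
        · obtain ⟨i, hi⟩ := hrange z h
          exact ⟨i, Or.inl hi.symm⟩
        · obtain ⟨i, hi⟩ := hrange z' h
          exact ⟨i, Or.inr hi.symm⟩
      obtain ⟨i, hi⟩ := this
      simp only [kroneckerMap_apply, piTensor, of_apply]
      rw [Finset.prod_eq_zero (Finset.mem_univ i), zero_mul]
      rw [ketbra, single_apply, if_neg (by tauto), mul_zero])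
  rw [hlift]
  set W := piTensor (fun t => withClassical (E t) d) with hW
  have hJV : J * relabel f = W.submatrix id (groupEquiv part Q I) := by
    rw [mul_relabel]
    ext y x
    rw [submatrix_apply, hJ]
    rfl
  have hsub : (piTensor B ⊗ₖ ρ) = ((piTensor B ⊗ₖ ρ).submatrix (groupEquiv part Q I).symm
      (groupEquiv part Q I).symm).submatrix (groupEquiv part Q I) (groupEquiv part Q I) := by
    simp
  calc J * (relabel f * (piTensor B ⊗ₖ ρ) * (relabel f)ᴴ) * Jᴴ
      = (J * relabel f) * (piTensor B ⊗ₖ ρ) * (J * relabel f)ᴴ := by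
        simp only [conjTranspose_mul, Matrix.mul_assoc]
    _ = _ := by
        rw [hJV, conjTranspose_submatrix]
        conv_lhs => rw [hsub]
        rw [submatrix_mul_equiv, submatrix_mul_equiv, submatrix_id_id]

end Grouping

/-! ### Preparing the shares of the other parties around one quantum share -/

section Attach

variable {ι I : Type} [Fintype ι] [DecidableEq ι] [Fintype I] [DecidableEq I]
  {Q : ι → Type} [∀ i, Fintype (Q i)] [∀ i, DecidableEq (Q i)]

/-- Kraus operators that add to the register `i₀` the registers of all other parties, in the states
`H j * (H j)ᴴ`, and a register in the state `ψ`. -/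
def attach (i₀ : ι) (H : ∀ j : {j // j ≠ i₀}, Matrix (Q j) (Q j) ℂ) (ψ : I → ℂ)
    (l : ∀ j : {j // j ≠ i₀}, Q j) : Matrix ((∀ i, Q i) × I) (Q i₀) ℂ :=
  of fun x q => if x.1 i₀ = q then (∏ j, H j (x.1 j) (l j)) * ψ x.2 else 0

/-- Summing over the columns of each `H j` turns the Kraus operators into `H j * (H j)ᴴ`, while the
register `i₀` passes through untouched. -/
lemma sum_attach_conj (i₀ : ι) (H : ∀ j : {j // j ≠ i₀}, Matrix (Q j) (Q j) ℂ) (ψ : I → ℂ)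
    (B : ∀ j, Matrix (Q j) (Q j) ℂ) (hB : ∀ j, H j * (H j)ᴴ = B j) :
    ∑ l, attach i₀ H ψ l * B i₀ * (attach i₀ H ψ l)ᴴ =
      piTensor B ⊗ₖ vecMulVec ψ (star ψ) := by
  ext ⟨x, a⟩ ⟨x', a'⟩
  have h : ∀ l, (attach i₀ H ψ l * B i₀ * (attach i₀ H ψ l)ᴴ) (x, a) (x', a') =
      (B i₀ (x i₀) (x' i₀) * (ψ a * star (ψ a'))) *
        ∏ j : {j // j ≠ i₀}, H j (x j) (l j) * star (H j (x' j) (l j)) := by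
    intro l
    simp only [Matrix.mul_apply, attach, of_apply, conjTranspose_apply, ite_mul, zero_mul,
      Finset.sum_ite_eq, Finset.mem_univ, if_true, apply_ite star, star_zero, mul_ite, mul_zero,
      star_mul', star_prod]
    rw [Finset.prod_mul_distrib]
    ring
  rw [Matrix.sum_apply]
  simp_rw [h]
  rw [← Finset.mul_sum, ← Fintype.prod_sum (fun (j : {j // j ≠ i₀}) q =>
    H j (x j) q * star (H j (x' j) q))]
  have h2 : ∀ j : {j // j ≠ i₀}, ∑ q, H j (x j) q * star (H j (x' j) q) = B j (x j) (x' j) := by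
    intro j
    rw [← hB j, Matrix.mul_apply]
    rfl
  simp_rw [h2]
  simp only [kroneckerMap_apply, piTensor, of_apply, vecMulVec_apply, Pi.star_apply]
  rw [Fintype.prod_eq_mul_prod_subtype_ne _ i₀]
  ring

/-- The attached states are unnormalized, so the operation multiplies traces by the product of their
traces, the probability of the fixed classical values. The identity is tested against every `ρ`
under the trace, which reduces it to `sum_attach_conj`. -/
lemma sum_attach_isometry (i₀ : ι) (H : ∀ j : {j // j ≠ i₀}, Matrix (Q j) (Q j) ℂ) {ψ : I → ℂ}
    (hψ : ∑ r, ‖ψ r‖ ^ 2 = 1) :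
    ∑ l, (attach i₀ H ψ l)ᴴ * attach i₀ H ψ l = (∏ j, (H j * (H j)ᴴ).trace) • 1 := by
  rw [Matrix.ext_iff_trace_mul_right]
  intro ρ
  let B : ∀ j, Matrix (Q j) (Q j) ℂ := (Equiv.piSplitAt i₀ fun j => Matrix (Q j) (Q j) ℂ).symm
    (ρ, fun j => H j * (H j)ᴴ)
  have hB0 : B i₀ = ρ := by simp [B, Equiv.piSplitAt]
  have hB : ∀ j : {j // j ≠ i₀}, H j * (H j)ᴴ = B j := by
    intro j
    simp [B, Equiv.piSplitAt, j.2]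
  have h := congrArg trace (sum_attach_conj i₀ H ψ B hB)
  have hψ' : (vecMulVec ψ (star ψ)).trace = 1 := by
    simp only [trace, diag_apply, vecMulVec_apply, Pi.star_apply, Complex.star_def,
      Complex.mul_conj']
    exact_mod_cast hψ
  rw [trace_kronecker, piTensor_trace, hψ', mul_one,
    Fintype.prod_eq_mul_prod_subtype_ne _ i₀, hB0] at h
  simp_rw [← hB] at h
  rw [Matrix.smul_mul, Matrix.one_mul, trace_smul, smul_eq_mul, mul_comm, ← h, Matrix.sum_mul,
    trace_sum, trace_sum]
  refine Finset.sum_congr rfl fun l _ => ?_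
  rw [Matrix.trace_mul_comm (attach i₀ H ψ l * ρ), Matrix.mul_assoc]

lemma submatrix_instrument {O K X X' Y : Type} [Fintype O] [Fintype K] [Fintype X] [DecidableEq X]
    [Fintype X'] [DecidableEq X'] [Fintype Y] {E : O → K → Matrix Y X ℂ} (hE : IsInstrument E)
    (f : X' → X) (hf : Function.Injective f) :
    ∑ o : O × K, ((E o.1 o.2).submatrix id f)ᴴ * (E o.1 o.2).submatrix id f = 1 := by
  have : ∀ o : O × K, ((E o.1 o.2).submatrix id f)ᴴ * (E o.1 o.2).submatrix id f =
      ((E o.1 o.2)ᴴ * E o.1 o.2).submatrix f f := by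
    intro o
    ext x x'
    simp [Matrix.mul_apply]
  simp_rw [this]
  rw [← submatrix_one f hf, ← hE, Fintype.sum_prod_type]
  ext x x'
  simp [Matrix.sum_apply]

end Attach

end

end CertDel

namespace CertDel

open Matrix
open scoped ComplexOrder Kronecker

noncomputable section

/-! ## No-signaling security of the compiled scheme -/

lemma TwoOfTwo.revealBound (T : TwoOfTwo) {κ m : ℕ} {δ : ℝ} {a b : Bits m}
    (hδ : ∀ A : T.Adversary κ m,
      traceDist (T.experiment κ m A a) (T.experiment κ m A b) ≤ δ) :
    RevealBound (T.accepts κ m)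
      (fun c vk => T.split κ m a (c, vk) - T.split κ m b (c, vk)) δ := by
  intro R K _ _ _ F p hp hF
  exact T.exists_decomposition hδ F hp hF

section Compile

variable {n : ℕ} {C : ClassicalScheme n} {T : TwoOfTwo} {m sec ℓ : ℕ}

/-- The classical randomness in the share of party `i`: the classical share, the verification key
and the second-level shares. -/
abbrev Env (C : ClassicalScheme n) (T : TwoOfTwo) (m sec : ℕ) (i : Fin n) : Type :=
  Bits (clen C T m sec i) × T.VK (kappa n sec) (C.shareLen m i) ×
    (∀ k, Bits (C.shareLen (clen C T m sec i) k))

/-- The classical parts of the shares. -/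
def classicalPart (cc : ∀ j i, Bits (C.shareLen (clen C T m sec j) i)) (i : Fin n) :
    ClassicalPart C T m sec i := fun j => cc j i

/-- The probability of the second-level shares of `csh_i`. -/
def envWeight (i : Fin n) (c : Bits (clen C T m sec i))
    (cc : ∀ k, Bits (C.shareLen (clen C T m sec i) k)) : ℝ := (C.split _ c cc).toReal

variable (A : (compile C T m).Adversary sec ℓ)

/-- The outcomes of part `t`: the certificates and the index of the Kraus operator. -/
abbrev Outcome (t : Fin ℓ) : Type :=
  (∀ i : {i // A.part i = t}, Option (T.Cert (kappa n sec) (C.shareLen m i))) × A.K t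

/-- The quantum inputs of part `t`. -/
abbrev PartReg (t : Fin ℓ) : Type :=
  (∀ i : {i // A.part i = t}, T.Q (kappa n sec) (C.shareLen m i)) × A.In t

/-- The Kraus operators of part `t` for fixed classical parts of the shares. -/
def partKraus (d : ∀ i, ClassicalPart C T m sec i) (t : Fin ℓ) (o : Outcome A t) :
    Matrix (A.Out t) (PartReg A t) ℂ :=
  withClassical (Q := fun i => T.Q (kappa n sec) (C.shareLen m i))
    (CP := ClassicalPart C T m sec) (A.E t o.1 o.2) d

lemma partKraus_sum (d : ∀ i, ClassicalPart C T m sec i) (t : Fin ℓ) :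
    ∑ o, (partKraus A d t o)ᴴ * partKraus A d t o = 1 := by
  refine submatrix_instrument (A.isInstrument t) _ ?_
  rintro ⟨x, a⟩ ⟨x', a'⟩ h
  have h' := Prod.ext_iff.mp h
  exact Prod.ext (funext fun i => (Prod.ext_iff.mp (congrFun h'.1 i)).1) h'.2

/-- The state of all quantum registers for fixed values of the classical random variables. -/
def inputState (B : ∀ i, Matrix (T.Q (kappa n sec) (C.shareLen m i)) (T.Q (kappa n sec)
    (C.shareLen m i)) ℂ) : Matrix (∀ t, PartReg A t) (∀ t, PartReg A t) ℂ :=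
  (piTensor B ⊗ₖ vecMulVec A.ψ (star A.ψ)).submatrix
    (groupEquiv A.part (fun i => T.Q (kappa n sec) (C.shareLen m i)) A.In).symm
    (groupEquiv A.part (fun i => T.Q (kappa n sec) (C.shareLen m i)) A.In).symm

/-- The residual state of the game for fixed values of the classical random variables. -/
def residual (B : ∀ i, Matrix (T.Q (kappa n sec) (C.shareLen m i)) (T.Q (kappa n sec)
    (C.shareLen m i)) ℂ) (d : ∀ i, ClassicalPart C T m sec i) (o : ∀ t, Outcome A t) :
    Matrix (∀ t, A.Out t) (∀ t, A.Out t) ℂ :=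
  (piTensor fun t => partKraus A d t (o t)) * inputState A B *
    (piTensor fun t => partKraus A d t (o t))ᴴ

/-- The certificate for the share of party `i`. -/
def certOf (o : ∀ t, Outcome A t) (i : Fin n) : Option (T.Cert (kappa n sec) (C.shareLen m i)) :=
  (o (A.part i)).1 ⟨i, rfl⟩

/-- The unnormalized residual state for the first-level shares `sh`, if `V` is the set of the
parties whose certificates are accepted. -/
def condState (sh : ∀ i, Bits (C.shareLen m i)) (V : Finset (Fin n)) :
    Matrix (∀ t, A.Out t) (∀ t, A.Out t) ℂ :=
  ∑ e : ∀ i, Env C T m sec i, ((∏ i, envWeight i (e i).1 (e i).2.2 : ℝ) : ℂ) •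
    ∑ o : ∀ t, Outcome A t,
      if ∀ i, T.accepts _ _ (e i).2.1 (certOf A o i) = decide (i ∈ V) then
        residual A (fun i => T.split (kappa n sec) (C.shareLen m i) (sh i) ((e i).1, (e i).2.1))
          (classicalPart fun j => (e j).2.2) o
      else 0

lemma sum_marginal {α β : Type} [Fintype α] [DecidableEq β] (p : PMF α) (f : α → β) (x : β) :
    (∑ a, if f a = x then (p a).toReal else 0) = ((p.map f) x).toReal := by
  rw [PMF.map_apply, tsum_fintype, ENNReal.toReal_sum]
  · refine Finset.sum_congr rfl fun a _ => ?_
    by_cases h : f a = x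
    · rw [if_pos h, if_pos h.symm]
    · rw [if_neg h, if_neg (Ne.symm h)]
      simp
  · intro a _
    split_ifs
    exacts [p.apply_ne_top a, ENNReal.zero_ne_top]

lemma partKraus_congr {d d' : ∀ i, ClassicalPart C T m sec i} {t : Fin ℓ}
    (h : ∀ i, A.part i = t → d i = d' i) : partKraus A d t = partKraus A d' t := by
  funext o
  exact withClassical_congr _ h

lemma sum_envWeight (i : Fin n) (s : Bits (C.shareLen m i)) :
    ∑ e : Env C T m sec i, envWeight i e.1 e.2.2 *
      (T.split (kappa n sec) (C.shareLen m i) s (e.1, e.2.1)).trace.re = 1 := by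
  have h := congrArg Complex.re (T.split_isEnsemble (kappa n sec) (C.shareLen m i) s).trace_eq_one
  rw [Complex.re_sum, Fintype.sum_prod_type, Complex.one_re] at h
  rw [← h, Fintype.sum_prod_type]
  refine Finset.sum_congr rfl fun c _ => ?_
  rw [Fintype.sum_prod_type]
  refine Finset.sum_congr rfl fun vk _ => ?_
  simp only [envWeight]
  rw [← Finset.sum_mul, sum_toReal, one_mul]

-- One hybrid step. With the classical randomness `e'` of all parties other than `i₀` fixed, their
-- quantum shares and `ψ` can be attached to `qsh_{i₀}`, and the acceptance pattern of these parties
-- becomes a condition on each part's outcome. Since `i₀ ∈ V`, the certificate for `i₀` must be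
-- accepted, which is when the deletion game of instance `i₀` reveals `csh_{i₀}`. `TNle_twoStage`
-- applies with the second-level shares of `csh_{i₀}` as `cc` and their restriction to the part of
-- `i₀` as `r`.
open Classical in
set_option maxHeartbeats 400000 in
lemma TNle_condState_of_eq_off {S : UpperSet (Finset (Fin n))} (hC : C.Private S)
    (hA : A.Admissible S) {δ : ℝ} (hδ0 : 0 ≤ δ)
    (hδ : ∀ (i : Fin n) (A' : T.Adversary (kappa n sec) (C.shareLen m i)) a b,
      traceDist (T.experiment _ _ A' a) (T.experiment _ _ A' b) ≤ δ)
    {V : Finset (Fin n)} {i₀ : Fin n} (hi₀ : i₀ ∈ V) {sh sh' : ∀ i, Bits (C.shareLen m i)}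
    (hsh : ∀ j, j ≠ i₀ → sh j = sh' j) :
    TNle (condState A sh V - condState A sh' V) (2 * δ) := by
  -- Factors `H * Hᴴ` of the other parties' states serve as preparation operators.
  have hH : ∀ (e : ∀ j : {j // j ≠ i₀}, Env C T m sec j) (j : {j // j ≠ i₀}),
      ∃ H : Matrix (T.Q (kappa n sec) (C.shareLen m j)) (T.Q (kappa n sec) (C.shareLen m j)) ℂ,
        H * Hᴴ = T.split (kappa n sec) (C.shareLen m j) (sh j) ((e j).1, (e j).2.1) := by
    intro e j
    open scoped MatrixOrder in
    obtain ⟨B, hB⟩ := CStarAlgebra.nonneg_iff_eq_star_mul_self.mp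
      (Matrix.nonneg_iff_posSemidef.mpr ((T.split_isEnsemble _ _ (sh j)).pos
        ((e j).1, (e j).2.1)))
    exact ⟨Bᴴ, by rw [conjTranspose_conjTranspose, hB, star_eq_conjTranspose]⟩
  choose H hH using hH
  let g := groupEquiv A.part (fun i => T.Q (kappa n sec) (C.shareLen m i)) A.In
  let Ψ : ∀ (e : ∀ j : {j // j ≠ i₀}, Env C T m sec j)
      (l : ∀ j : {j // j ≠ i₀}, T.Q (kappa n sec) (C.shareLen m j)),
      Matrix (∀ t, PartReg A t) (T.Q (kappa n sec) (C.shareLen m i₀)) ℂ :=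
    fun e l => (attach i₀ (H e) A.ψ l).submatrix g.symm id
  let p : (∀ j : {j // j ≠ i₀}, Env C T m sec j) → ℝ := fun e => ∏ j : {j // j ≠ i₀},
    (T.split (kappa n sec) (C.shareLen m j) (sh j) ((e j).1, (e j).2.1)).trace.re
  let q : (∀ j : {j // j ≠ i₀}, Env C T m sec j) → ℝ := fun e => ∏ j : {j // j ≠ i₀},
    envWeight (j : Fin n) (e j).1 (e j).2.2
  have hpos : ∀ j s c, (T.split (kappa n sec) (C.shareLen m j) s c).PosSemidef :=
    fun j s c => (T.split_isEnsemble _ _ s).pos c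
  have hp : ∀ e, 0 ≤ p e := fun e => Finset.prod_nonneg fun j _ =>
    posSemidef_re_trace_nonneg (hpos j _ _)
  have hq : ∀ e, 0 ≤ q e := fun e => Finset.prod_nonneg fun j _ => ENNReal.toReal_nonneg
  have hΨ : ∀ e, ∑ l, (Ψ e l)ᴴ * Ψ e l = (p e : ℂ) • 1 := by
    intro e
    have h1 := sum_attach_isometry (Q := fun i => T.Q (kappa n sec) (C.shareLen m i)) i₀ (H e)
      A.ψ_norm
    have h2 : ∏ j : {j // j ≠ i₀}, (H e j * (H e j)ᴴ).trace = (p e : ℂ) := by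
      simp only [p, Complex.ofReal_prod]
      refine Finset.prod_congr rfl fun j _ => ?_
      rw [hH, posSemidef_ofReal_re_trace (hpos j _ _)]
    rw [← h2, ← h1]
    refine Finset.sum_congr rfl fun l _ => ?_
    simp only [Ψ]
    rw [conjTranspose_submatrix, submatrix_mul_equiv, submatrix_id_id]
  have hinput : ∀ (e : ∀ j : {j // j ≠ i₀}, Env C T m sec j) (B : ∀ i, Matrix (T.Q (kappa n sec)
      (C.shareLen m i)) (T.Q (kappa n sec) (C.shareLen m i)) ℂ),
      (∀ j : {j // j ≠ i₀}, B j = T.split _ _ (sh j) ((e j).1, (e j).2.1)) →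
      inputState A B = ∑ l, Ψ e l * B i₀ * (Ψ e l)ᴴ := by
    intro e B hB
    have h1 := sum_attach_conj i₀ (H e) A.ψ B fun j => by rw [hH, hB]
    rw [inputState, ← h1]
    ext x x'
    simp only [submatrix_apply, Matrix.sum_apply]
    refine Finset.sum_congr rfl fun l _ => ?_
    simp only [Ψ, conjTranspose_submatrix]
    rfl
  -- All second-level shares, with those of `csh_{i₀}` left as the variable `cc` and the others
  -- taken from `e'`.
  let glue : (e' : ∀ j : {j // j ≠ i₀}, Env C T m sec j) →
      (∀ k, Bits (C.shareLen (clen C T m sec i₀) k)) →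
      ∀ j i, Bits (C.shareLen (clen C T m sec j) i) := fun e' cc =>
    (Equiv.piSplitAt i₀ fun j => ∀ k, Bits (C.shareLen (clen C T m sec j) k)).symm
      (cc, fun j => (e' j).2.2)
  have hglue0 : ∀ e' cc, glue e' cc i₀ = cc := by
    intro e' cc
    simp [glue, Equiv.piSplitAt]
  have hglue1 : ∀ e' cc j, j ≠ i₀ → ∀ h : j ≠ i₀, glue e' cc j = (e' ⟨j, h⟩).2.2 := by
    intro e' cc j _ h
    simp [glue, Equiv.piSplitAt, h]
  -- Because the keys in `e'` are fixed, whether the other certificates match `V` can be checked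
  -- within each part.
  let ok : (∀ j : {j // j ≠ i₀}, Env C T m sec j) → ∀ t, Outcome A t → Prop := fun e' t o =>
    ∀ (i : {i // A.part i = t}) (h : (i : Fin n) ≠ i₀),
      T.accepts _ _ (e' ⟨i, h⟩).2.1 (o.1 i) = decide ((i : Fin n) ∈ V)
  have hcond : ∀ e' (e₀ : Env C T m sec i₀) (o : ∀ t, Outcome A t),
      (∀ i, T.accepts _ _ ((Equiv.piSplitAt i₀ (Env C T m sec)).symm (e₀, e') i).2.1
        (certOf A o i) = decide (i ∈ V)) ↔
      (T.accepts _ _ e₀.2.1 ((o (A.part i₀)).1 ⟨i₀, rfl⟩) = true ∧ ∀ t, ok e' t (o t)) := by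
    intro e' e₀ o
    constructor
    · intro h
      refine ⟨by simpa [Equiv.piSplitAt, hi₀, certOf] using h i₀, ?_⟩
      rintro t ⟨i, rfl⟩ hi
      have hi' : i ≠ i₀ := hi
      simpa [Equiv.piSplitAt, hi', certOf] using h i
    · rintro ⟨h1, h2⟩ i
      by_cases hi : i = i₀
      · subst hi
        simpa [Equiv.piSplitAt, hi₀, certOf] using h1
      · simpa [Equiv.piSplitAt, hi, certOf] using h2 (A.part i) ⟨i, rfl⟩ hi
  have hstate : ∀ sh'' : ∀ i, Bits (C.shareLen m i), (∀ j, j ≠ i₀ → sh j = sh'' j) →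
      condState A sh'' V = ∑ e', (q e' : ℂ) • ∑ c, ∑ vk, ∑ cc, ((envWeight i₀ c cc : ℝ) : ℂ) •
        ∑ o : ∀ t, Outcome A t,
          if T.accepts _ _ vk ((o (A.part i₀)).1 ⟨i₀, rfl⟩) = true ∧ ∀ t, ok e' t (o t) then
            (piTensor fun t => partKraus A (classicalPart (glue e' cc)) t (o t)) *
              (∑ l, Ψ e' l * T.split _ _ (sh'' i₀) (c, vk) * (Ψ e' l)ᴴ) *
              (piTensor fun t => partKraus A (classicalPart (glue e' cc)) t (o t))ᴴ
          else 0 := by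
    intro sh'' hsh''
    rw [condState, sum_pi_eq_sum_split i₀, Finset.sum_comm]
    refine Finset.sum_congr rfl fun e' _ => ?_
    rw [Fintype.sum_prod_type, Finset.smul_sum]
    refine Finset.sum_congr rfl fun c _ => ?_
    rw [Fintype.sum_prod_type, Finset.smul_sum]
    refine Finset.sum_congr rfl fun vk _ => ?_
    rw [Finset.smul_sum]
    refine Finset.sum_congr rfl fun cc _ => ?_
    have hw : (∏ i, envWeight i ((Equiv.piSplitAt i₀ (Env C T m sec)).symm ((c, vk, cc), e') i).1
        ((Equiv.piSplitAt i₀ (Env C T m sec)).symm ((c, vk, cc), e') i).2.2) =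
        q e' * envWeight i₀ c cc := by
      rw [Fintype.prod_eq_mul_prod_subtype_ne _ i₀, mul_comm]
      congr 1
      · refine Finset.prod_congr rfl fun j _ => ?_
        simp [Equiv.piSplitAt, j.2]
      · simp [Equiv.piSplitAt]
    rw [hw, Complex.ofReal_mul, mul_smul]
    refine congrArg (fun x => (q e' : ℂ) • ((envWeight i₀ c cc : ℝ) : ℂ) • x) ?_
    refine Finset.sum_congr rfl fun o _ => ?_
    simp only [hcond]
    refine if_congr Iff.rfl ?_ rfl
    have hd : (classicalPart fun j =>
        ((Equiv.piSplitAt i₀ (Env C T m sec)).symm ((c, vk, cc), e') j).2.2) =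
        classicalPart (glue e' cc) := by
      congr 1
      funext j
      by_cases hj : j = i₀
      · subst hj
        rw [hglue0]
        simp [Equiv.piSplitAt]
      · rw [hglue1 e' cc j hj hj]
        simp [Equiv.piSplitAt, hj]
    rw [residual, hd, hinput e']
    · simp [Equiv.piSplitAt]
    · intro j
      simp [Equiv.piSplitAt, j.2, hsh'' j j.2]
  obtain ⟨Sim, hSim⟩ := hC
  let P : Finset (Fin n) := Finset.univ.filter fun i => A.part i = A.part i₀
  have hP : P ∉ S := hA (A.part i₀)
  have hdiff : condState A sh V - condState A sh' V =
      ∑ e', (q e' : ℂ) • ∑ c, ∑ vk, ∑ cc, ((envWeight i₀ c cc : ℝ) : ℂ) •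
        ∑ o : ∀ t, Outcome A t,
          if T.accepts _ _ vk ((o (A.part i₀)).1 ⟨i₀, rfl⟩) = true ∧ ∀ t, ok e' t (o t) then
            (piTensor fun t => partKraus A (classicalPart (glue e' cc)) t (o t)) *
              (∑ l, Ψ e' l * (T.split _ _ (sh i₀) (c, vk) - T.split _ _ (sh' i₀) (c, vk)) *
                (Ψ e' l)ᴴ) *
              (piTensor fun t => partKraus A (classicalPart (glue e' cc)) t (o t))ᴴ
          else 0 := by
    rw [hstate sh fun _ _ => rfl, hstate sh' hsh, ← Finset.sum_sub_distrib]
    refine Finset.sum_congr rfl fun e' _ => ?_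
    rw [← smul_sub]
    simp only [← Finset.sum_sub_distrib, ← smul_sub]
    refine congrArg (fun x => (q e' : ℂ) • x) ?_
    refine Finset.sum_congr rfl fun c _ => Finset.sum_congr rfl fun vk _ =>
      Finset.sum_congr rfl fun cc _ => ?_
    refine congrArg (fun x => ((envWeight i₀ c cc : ℝ) : ℂ) • x) ?_
    refine Finset.sum_congr rfl fun o _ => ?_
    split_ifs
    · simp only [Matrix.mul_sub, Matrix.sub_mul, Finset.sum_sub_distrib]
    · simp
  rw [hdiff]
  have key : ∀ e', TNle (∑ c, ∑ vk, ∑ cc, ((envWeight i₀ c cc : ℝ) : ℂ) •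
        ∑ o : ∀ t, Outcome A t,
          if T.accepts _ _ vk ((o (A.part i₀)).1 ⟨i₀, rfl⟩) = true ∧ ∀ t, ok e' t (o t) then
            (piTensor fun t => partKraus A (classicalPart (glue e' cc)) t (o t)) *
              (∑ l, Ψ e' l * (T.split _ _ (sh i₀) (c, vk) - T.split _ _ (sh' i₀) (c, vk)) *
                (Ψ e' l)ᴴ) *
              (piTensor fun t => partKraus A (classicalPart (glue e' cc)) t (o t))ᴴ
          else 0) (p e' * (2 * δ)) := by
    intro e'
    have hsim : ∀ c x, (∑ cc, if (fun i : P => cc i) = x then envWeight i₀ c cc else 0) =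
        (Sim (clen C T m sec i₀) P x).toReal := by
      intro c x
      rw [← hSim (clen C T m sec i₀) P hP c, ← sum_marginal]
      rfl
    -- The part of `i₀` reads only the second-level shares of its own parties. They form an
    -- unauthorized set, so `hsim` gives their law independently of `csh_{i₀}`.
    have hr : ∀ cc cc' : ∀ k, Bits (C.shareLen (clen C T m sec i₀) k),
        (fun i : P => cc i) = (fun i : P => cc' i) →
        partKraus A (classicalPart (glue e' cc)) (A.part i₀) =
          partKraus A (classicalPart (glue e' cc')) (A.part i₀) := by
      intro cc cc' h
      refine partKraus_congr A fun i hi => ?_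
      funext j
      simp only [classicalPart]
      by_cases hj : j = i₀
      · subst hj
        rw [hglue0, hglue0]
        exact congrFun h ⟨i, Finset.mem_filter.mpr ⟨Finset.mem_univ _, hi⟩⟩
      · rw [hglue1 e' cc j hj hj, hglue1 e' cc' j hj hj]
    have := TNle_twoStage (X := PartReg A) (Y := A.Out) (O := Outcome A) (t₀ := A.part i₀)
      (M := fun cc => partKraus A (classicalPart (glue e' cc))) (fun cc t => partKraus_sum A _ t)
      (r := fun cc => fun i : P => cc i) hr (pr := envWeight i₀)
      (fun c cc => ENNReal.toReal_nonneg)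
      (sim := fun x => (Sim (clen C T m sec i₀) P x).toReal) (fun x => ENNReal.toReal_nonneg) hsim
      (sum_toReal _) (bot := none) (fun vk => rfl) hδ0
      (T.revealBound fun A' => hδ i₀ A' (sh i₀) (sh' i₀)) (hp e') (hΨ e')
      (fun o => o.1 ⟨i₀, rfl⟩) (ok e')
    convert this using 15
  refine (TNle.sum _ fun e' _ => TNle.smul_nonneg (key e') (hq e')).mono ?_
  -- `q e' * p e'` is the joint probability of the other parties' classical randomness, so the
  -- average over `e'` costs no factor.
  · have hone : ∑ e', q e' * p e' = 1 := by
      simp only [p, q, ← Finset.prod_mul_distrib]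
      rw [← Fintype.prod_sum (fun (j : {j // j ≠ i₀}) (e : Env C T m sec j) =>
        envWeight (j : Fin n) e.1 e.2.2 *
          (T.split (kappa n sec) (C.shareLen m j) (sh j) (e.1, e.2.1)).trace.re)]
      exact Finset.prod_eq_one fun j _ => sum_envWeight (j : Fin n) (sh j)
    simp_rw [← mul_assoc]
    rw [← Finset.sum_mul, ← Finset.sum_mul, hone, one_mul]

end Compile

end

end CertDel

namespace CertDel

open Matrix
open scoped ComplexOrder Kronecker

noncomputable section

/-! ### The no-signaling game as a game with rejection -/

section SchemeGame

variable {n : ℕ} {M : Type} [Fintype M] {D : Scheme n M} {sec ℓ : ℕ}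

/-- Each part's instrument is complete, hence so is their tensor product; regrouping registers and
outcomes by parts turns it into `joint`. -/
lemma Scheme.Adversary.joint_sum (A : D.Adversary sec ℓ) :
    ∑ o : (∀ i, Option (D.Cert sec i)) × ∀ t, A.K t, (A.joint o.1 o.2)ᴴ * A.joint o.1 o.2 =
      (1 : ℂ) • 1 := by
  have h1 : ∑ o : ∀ t, (∀ i : {i // A.part i = t}, Option (D.Cert sec i)) × A.K t,
      (piTensor fun t => A.E t (o t).1 (o t).2)ᴴ * (piTensor fun t => A.E t (o t).1 (o t).2) =
        1 := by
    simp_rw [piTensor_conjTranspose, piTensor_mul]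
    rw [piTensor_sum (fun t (o : (∀ i : {i // A.part i = t}, Option (D.Cert sec i)) × A.K t) =>
      (A.E t o.1 o.2)ᴴ * A.E t o.1 o.2)]
    have h2 : ∀ t, ∑ o : (∀ i : {i // A.part i = t}, Option (D.Cert sec i)) × A.K t,
        (A.E t o.1 o.2)ᴴ * A.E t o.1 o.2 = 1 := by
      intro t
      rw [Fintype.sum_prod_type]
      exact A.isInstrument t
    simp_rw [h2]
    exact piTensor_one
  rw [← (groupEquiv A.part (fun i => Option (D.Cert sec i)) A.K).sum_comp] at h1
  have h3 := congrArg (fun N => N.submatrix (groupEquiv A.part (D.Reg sec) A.In)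
    (groupEquiv A.part (D.Reg sec) A.In)) h1
  simp only [submatrix_one_equiv] at h3
  rw [one_smul, ← h3]
  ext x x'
  simp only [Matrix.sum_apply, submatrix_apply]
  rfl

/-- The residual state of the game, by verification key and certificates. -/
def Scheme.gameState (A : D.Adversary sec ℓ) (s : M)
    (o : D.VK sec × ∀ i, Option (D.Cert sec i)) : Matrix (∀ t, A.Out t) (∀ t, A.Out t) ℂ :=
  ∑ k, A.joint o.2 k * (D.split sec s o.1 ⊗ₖ vecMulVec A.ψ (star A.ψ)) * (A.joint o.2 k)ᴴ

open Classical in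
lemma Scheme.experiment_eq_gameOut (S : UpperSet (Finset (Fin n))) (A : D.Adversary sec ℓ)
    (s : M) : D.experiment S sec ℓ A s =
      gameOut (fun o => ∀ P ∈ S, ∃ i ∈ P, D.accepts sec o.1 i (o.2 i) = true)
        (gameState A s) := by
  simp only [experiment, gameOut, Fintype.sum_prod_type, gameState]

lemma Scheme.gameState_posSemidef (A : D.Adversary sec ℓ) (s : M) (o) :
    (gameState A s o).PosSemidef :=
  posSemidef_sum_kraus _ (((D.split_isEnsemble sec s).pos _).kronecker
    (posSemidef_vecMulVec_self_star _))

lemma trace_vecMulVec_self_star {I : Type} [Fintype I] {ψ : I → ℂ} (hψ : ∑ r, ‖ψ r‖ ^ 2 = 1) :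
    (vecMulVec ψ (star ψ)).trace = 1 := by
  simp only [trace, diag_apply, vecMulVec_apply, Pi.star_apply, Complex.star_def,
    Complex.mul_conj']
  exact_mod_cast hψ

lemma Scheme.sum_gameState_trace (A : D.Adversary sec ℓ) (s : M) :
    ∑ o, (gameState A s o).trace = 1 := by
  rw [← (D.split_isEnsemble sec s).trace_eq_one, Fintype.sum_prod_type]
  refine Finset.sum_congr rfl fun vk _ => ?_
  have := trace_sum_kraus _ A.joint_sum (D.split sec s vk ⊗ₖ vecMulVec A.ψ (star A.ψ))
  rw [one_mul, Fintype.sum_prod_type, trace_sum, trace_kronecker,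
    trace_vecMulVec_self_star A.ψ_norm, mul_one] at this
  exact this

lemma Scheme.traceDist_experiment_le_one (S : UpperSet (Finset (Fin n))) (A : D.Adversary sec ℓ)
    (s₀ s₁ : M) : traceDist (D.experiment S sec ℓ A s₀) (D.experiment S sec ℓ A s₁) ≤ 1 := by
  classical
  rw [experiment_eq_gameOut, experiment_eq_gameOut]
  exact traceDist_gameOut_le_one _ (gameState_posSemidef A s₀) (gameState_posSemidef A s₁)
    (sum_gameState_trace A s₀) (sum_gameState_trace A s₁)

end SchemeGame

/-! ### Hybrids over the accepted parties -/

section Compile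

variable {n : ℕ} {C : ClassicalScheme n} {T : TwoOfTwo} {m sec ℓ : ℕ}

lemma sum_pi_prod₃ {ι M : Type*} [Fintype ι] [DecidableEq ι] [AddCommMonoid M]
    {F G H : ι → Type} [∀ i, Fintype (F i)] [∀ i, Fintype (G i)] [∀ i, Fintype (H i)]
    (f : (∀ i, F i × G i × H i) → M) :
    ∑ e, f e = ∑ a : ∀ i, F i, ∑ b : ∀ i, G i, ∑ c : ∀ i, H i, f fun i => (a i, b i, c i) := by
  let g : ((∀ i, F i) × (∀ i, G i) × ∀ i, H i) ≃ ∀ i, F i × G i × H i :=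
    { toFun := fun x i => (x.1 i, x.2.1 i, x.2.2 i)
      invFun := fun e => (fun i => (e i).1, fun i => (e i).2.1, fun i => (e i).2.2)
      left_inv := fun _ => rfl
      right_inv := fun _ => rfl }
  rw [← g.sum_comp, Fintype.sum_prod_type]
  refine Finset.sum_congr rfl fun a _ => ?_
  rw [Fintype.sum_prod_type]
  rfl

variable (A : (compile C T m).Adversary sec ℓ)

-- Each outcome belongs to exactly one `V`, the set of accepted parties, and whether the game
-- accepts depends only on `V`.
open Classical in
lemma sum_condState (S : UpperSet (Finset (Fin n))) (sh : ∀ i, Bits (C.shareLen m i)) :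
    (∑ V ∈ Finset.univ.filter fun V => Vᶜ ∉ S, condState A sh V) =
      ∑ e : ∀ i, Env C T m sec i, ((∏ i, envWeight i (e i).1 (e i).2.2 : ℝ) : ℂ) •
        ∑ o : ∀ t, Outcome A t,
          if ∀ P ∈ S, ∃ i ∈ P, T.accepts _ _ (e i).2.1 (certOf A o i) = true then
            residual A (fun i => T.split (kappa n sec) (C.shareLen m i) (sh i)
              ((e i).1, (e i).2.1)) (classicalPart fun j => (e j).2.2) o
          else 0 := by
  simp only [condState]
  rw [Finset.sum_comm]
  refine Finset.sum_congr rfl fun e _ => ?_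
  rw [← Finset.smul_sum, Finset.sum_comm]
  refine congrArg (fun x => _ • x) (Finset.sum_congr rfl fun o _ => ?_)
  set W : Finset (Fin n) :=
    Finset.univ.filter fun i => T.accepts _ _ (e i).2.1 (certOf A o i) = true with hW
  have h1 : ∀ V : Finset (Fin n), (∀ i, T.accepts _ _ (e i).2.1 (certOf A o i) =
      decide (i ∈ V)) ↔ V = W := by
    intro V
    constructor
    · intro h
      ext i
      simp [hW, h i]
    · rintro rfl i
      simp [hW]
  -- Upward closure enters: some authorized set avoids `W` exactly if the whole complement of `W` is
  -- authorized.
  have h2 : (∀ P ∈ S, ∃ i ∈ P, T.accepts _ _ (e i).2.1 (certOf A o i) = true) ↔ Wᶜ ∉ S := by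
    constructor
    · intro h hS
      obtain ⟨i, hi, hacc⟩ := h _ hS
      simp [hW, hacc] at hi
    · intro h P hP
      by_contra! hP'
      refine h (S.upper (fun i hi => ?_) hP)
      simpa [hW] using hP' i hi
  simp only [h1, h2]
  rw [Finset.sum_ite_eq']
  simp

/-- The joint Kraus operators, as operators on the registers of the compiled scheme. -/
def jointKraus (cert : ∀ i, Option (T.Cert (kappa n sec) (C.shareLen m i))) (k : ∀ t, A.K t) :
    Matrix (∀ t, A.Out t) ((∀ i, ShareReg C T m sec i) × ∀ t, A.In t) ℂ := A.joint cert k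

/-- The certificates and the indices of the Kraus operators, grouped by the parts. -/
def outcomeEquiv : ((∀ i, Option (T.Cert (kappa n sec) (C.shareLen m i))) × ∀ t, A.K t) ≃
    ∀ t, Outcome A t :=
  groupEquiv A.part (fun i => Option (T.Cert (kappa n sec) (C.shareLen m i))) A.K

lemma jointKraus_conj_compileTerm (sh : ∀ i, Bits (C.shareLen m i))
    (csh : ∀ i, Bits (clen C T m sec i)) (vk : ∀ i, T.VK (kappa n sec) (C.shareLen m i))
    (cc : ∀ j i, Bits (C.shareLen (clen C T m sec j) i))
    (cert : ∀ i, Option (T.Cert (kappa n sec) (C.shareLen m i))) (k : ∀ t, A.K t) :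
    jointKraus A cert k * (piTensor (compileTerm C T m sec sh csh vk cc) ⊗ₖ
      vecMulVec A.ψ (star A.ψ)) * (jointKraus A cert k)ᴴ =
      residual A (fun i => T.split (kappa n sec) (C.shareLen m i) (sh i) (csh i, vk i))
        (classicalPart cc) (outcomeEquiv A (cert, k)) :=
  joint_conj_eq A.part (Q := fun i => T.Q (kappa n sec) (C.shareLen m i))
    (CP := ClassicalPart C T m sec) (I := A.In) (Y := A.Out)
    (fun t => A.E t (fun i => cert i) (k t))
    (fun i => T.split (kappa n sec) (C.shareLen m i) (sh i) (csh i, vk i)) (classicalPart cc)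
    (vecMulVec A.ψ (star A.ψ)) (jointKraus A cert k) fun _ _ => rfl

lemma compile_gameState (s : Bits m) (vk : ∀ i, T.VK (kappa n sec) (C.shareLen m i))
    (cert : ∀ i, Option (T.Cert (kappa n sec) (C.shareLen m i))) :
    Scheme.gameState A s (vk, cert) =
      ∑ sh : ∀ i, Bits (C.shareLen m i), ∑ csh : ∀ i, Bits (clen C T m sec i),
        ∑ cc : ∀ j i, Bits (C.shareLen (clen C T m sec j) i), ∑ k,
        (((C.split m s sh).toReal * ∏ j, envWeight j (csh j) (cc j) : ℝ) : ℂ) •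
          residual A (fun i => T.split (kappa n sec) (C.shareLen m i) (sh i) (csh i, vk i))
            (classicalPart cc) (outcomeEquiv A (cert, k)) := by
  have h1 : (compileSplit C T m sec s vk ⊗ₖ vecMulVec A.ψ (star A.ψ)) =
      ∑ sh : ∀ i, Bits (C.shareLen m i), ∑ csh : ∀ i, Bits (clen C T m sec i),
        ∑ cc : ∀ j i, Bits (C.shareLen (clen C T m sec j) i),
        (((C.split m s sh).toReal * ∏ j, envWeight j (csh j) (cc j) : ℝ) : ℂ) •
        (piTensor (compileTerm C T m sec sh csh vk cc) ⊗ₖ vecMulVec A.ψ (star A.ψ)) := by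
    simp only [compileSplit, sum_kron, smul_kronecker]
    rfl
  have h2 : Scheme.gameState A s (vk, cert) = ∑ k, jointKraus A cert k *
      (compileSplit C T m sec s vk ⊗ₖ vecMulVec A.ψ (star A.ψ)) * (jointKraus A cert k)ᴴ := rfl
  rw [h2, h1]
  simp only [Matrix.mul_sum, Matrix.sum_mul, Matrix.mul_smul, Matrix.smul_mul,
    jointKraus_conj_compileTerm]
  rw [Finset.sum_comm]
  refine Finset.sum_congr rfl fun sh _ => ?_
  rw [Finset.sum_comm]
  refine Finset.sum_congr rfl fun csh _ => ?_
  rw [Finset.sum_comm]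

lemma compile_accepts (vk : ∀ i, T.VK (kappa n sec) (C.shareLen m i)) (i : Fin n)
    (c : Option (T.Cert (kappa n sec) (C.shareLen m i))) :
    (compile C T m).accepts sec vk i c = T.accepts _ _ (vk i) c := by
  cases c <;> rfl

-- Connects the game of the compiled scheme with the conditional states: for fixed classical parts
-- of the shares, `jointKraus_conj_compileTerm` turns the joint operation into one on the quantum
-- registers alone, and the rest is a rearrangement of finite sums.
open Classical in
lemma gameAcc_eq_sum_condState (S : UpperSet (Finset (Fin n))) (s : Bits m) :
    gameAcc (fun o : (compile C T m).VK sec × ∀ i, Option ((compile C T m).Cert sec i) =>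
        ∀ P ∈ S, ∃ i ∈ P, (compile C T m).accepts sec o.1 i (o.2 i) = true)
      (Scheme.gameState A s) =
      ∑ V ∈ Finset.univ.filter fun V => Vᶜ ∉ S,
        ∑ sh, (((C.split m s sh).toReal : ℝ) : ℂ) • condState A sh V := by
  have hL : gameAcc (fun o : (compile C T m).VK sec × ∀ i, Option ((compile C T m).Cert sec i) =>
        ∀ P ∈ S, ∃ i ∈ P, (compile C T m).accepts sec o.1 i (o.2 i) = true)
      (Scheme.gameState A s) =
      ∑ vk : ∀ i, T.VK (kappa n sec) (C.shareLen m i),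
        ∑ cert : ∀ i, Option (T.Cert (kappa n sec) (C.shareLen m i)),
        if ∀ P ∈ S, ∃ i ∈ P, T.accepts _ _ (vk i) (cert i) = true then
          Scheme.gameState A s (vk, cert) else 0 := by
    rw [gameAcc, Fintype.sum_prod_type]
    refine Finset.sum_congr rfl fun vk _ => Finset.sum_congr rfl fun cert _ => ?_
    refine if_congr ?_ rfl rfl
    exact forall₂_congr fun P _ => exists_congr fun i => and_congr_right fun _ => by
      rw [← compile_accepts (C := C) vk i (cert i)]
  rw [hL, Finset.sum_comm (s := Finset.univ.filter _)]
  simp_rw [← Finset.smul_sum, sum_condState, sum_pi_prod₃, ← (outcomeEquiv A).sum_comp,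
    Fintype.sum_prod_type, Finset.smul_sum, compile_gameState]
  have hif : ∀ (c : Prop) [Decidable c] (x : ℂ) (M : Matrix (∀ t, A.Out t) (∀ t, A.Out t) ℂ),
      (x • if c then M else 0) = if c then x • M else 0 := by
    intro c _ x M
    split_ifs <;> simp
  have hifs : ∀ (c : Prop) [Decidable c] {α : Type} [Fintype α]
      (f : α → Matrix (∀ t, A.Out t) (∀ t, A.Out t) ℂ),
      (if c then ∑ a, f a else 0) = ∑ a, if c then f a else 0 := by
    intro c _ α _ f
    split_ifs <;> simp
  simp_rw [hifs, smul_smul, hif]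
  rw [Finset.sum_congr rfl fun vk _ => Finset.sum_comm, Finset.sum_comm]
  refine Finset.sum_congr rfl fun sh _ => ?_
  rw [Finset.sum_congr rfl fun vk _ => Finset.sum_comm, Finset.sum_comm]
  refine Finset.sum_congr rfl fun csh _ => Finset.sum_congr rfl fun vk _ => ?_
  rw [Finset.sum_comm]
  refine Finset.sum_congr rfl fun cc _ => Finset.sum_congr rfl fun cert _ =>
    Finset.sum_congr rfl fun k _ => ?_
  simp only [Complex.ofReal_mul]
  rfl

-- One application of `TNle_condState_of_eq_off` per party in `W`; `V` stays fixed while the set `W`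
-- of replaced shares grows.
open Classical in
lemma TNle_condState_hybrid {S : UpperSet (Finset (Fin n))} (hC : C.Private S)
    (hA : A.Admissible S) {δ : ℝ} (hδ0 : 0 ≤ δ)
    (hδ : ∀ (i : Fin n) (A' : T.Adversary (kappa n sec) (C.shareLen m i)) a b,
      traceDist (T.experiment _ _ A' a) (T.experiment _ _ A' b) ≤ δ)
    {V W : Finset (Fin n)} (hW : W ⊆ V) (sh sh' : ∀ i, Bits (C.shareLen m i))
    (hsh : ∀ j, j ∉ W → sh j = sh' j) :
    TNle (condState A sh V - condState A sh' V) (W.card * (2 * δ)) := by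
  induction W using Finset.induction_on generalizing sh with
  | empty =>
    have : sh = sh' := funext fun j => hsh j (Finset.notMem_empty j)
    subst this
    simpa using TNle_zero
  | insert a W ha ih =>
    have h1 := ih ((Finset.subset_insert a W).trans hW) (Function.update sh a (sh' a)) (by
      intro j hj
      by_cases h : j = a
      · subst h
        simp
      · rw [Function.update_of_ne h]
        exact hsh j (by simp [h, hj]))
    have h2 := TNle_condState_of_eq_off A hC hA hδ0 hδ (hW (Finset.mem_insert_self a W))
      (sh := sh) (sh' := Function.update sh a (sh' a))
      fun j hj => (Function.update_of_ne hj _ _).symm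
    have h3 := h2.add h1
    rw [sub_add_sub_cancel] at h3
    refine h3.mono ?_
    rw [Finset.card_insert_of_notMem ha]
    push_cast
    linarith

lemma sum_smul_comp_eq {α β N : Type} [Fintype α] [Fintype β] [DecidableEq β] [AddCommMonoid N]
    [Module ℂ N] (p : PMF α) (f : α → β) (h : β → N) :
    ∑ a, (((p a).toReal : ℝ) : ℂ) • h (f a) = ∑ b, ((((p.map f) b).toReal : ℝ) : ℂ) • h b := by
  simp_rw [← sum_marginal, Complex.ofReal_sum, Finset.sum_smul]
  rw [Finset.sum_comm]
  refine Finset.sum_congr rfl fun a _ => ?_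
  rw [Finset.sum_eq_single (f a)]
  · simp
  · intro b _ hb
    simp [Ne.symm hb]
  · simp

-- Blanking the shares in `V` costs at most `n * (2 * δ)` for each secret. The blanked states depend
-- only on the shares in `Vᶜ`, an unauthorized set, so by privacy their averages agree for the two
-- secrets.
open Classical in
lemma TNle_averaged_condState {S : UpperSet (Finset (Fin n))} (hC : C.Private S)
    (hA : A.Admissible S) {δ : ℝ} (hδ0 : 0 ≤ δ)
    (hδ : ∀ (i : Fin n) (A' : T.Adversary (kappa n sec) (C.shareLen m i)) a b,
      traceDist (T.experiment _ _ A' a) (T.experiment _ _ A' b) ≤ δ)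
    {V : Finset (Fin n)} (hV : Vᶜ ∉ S) (s₀ s₁ : Bits m) :
    TNle (∑ sh, (((C.split m s₀ sh).toReal : ℝ) : ℂ) • condState A sh V -
      ∑ sh, (((C.split m s₁ sh).toReal : ℝ) : ℂ) • condState A sh V) (4 * n * δ) := by
  -- The blank value is the all-`false` string; any choice independent of the secret would do.
  let fill : (∀ i : (Vᶜ : Finset (Fin n)), Bits (C.shareLen m i)) → ∀ i, Bits (C.shareLen m i) :=
    fun x i => if h : i ∈ Vᶜ then x ⟨i, h⟩ else fun _ => false
  let rest : (∀ i, Bits (C.shareLen m i)) → ∀ i : (Vᶜ : Finset (Fin n)), Bits (C.shareLen m i) :=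
    fun sh i => sh i
  have hfill : ∀ sh j, j ∉ V → sh j = fill (rest sh) j := by
    intro sh j hj
    simp [fill, rest, hj]
  have hstep : ∀ s : Bits m, TNle (∑ sh, (((C.split m s sh).toReal : ℝ) : ℂ) • condState A sh V -
      ∑ sh, (((C.split m s sh).toReal : ℝ) : ℂ) • condState A (fill (rest sh)) V)
      (n * (2 * δ)) := by
    intro s
    rw [← Finset.sum_sub_distrib]
    simp_rw [← smul_sub]
    refine (TNle.sum _ fun sh _ => TNle.smul_nonneg
      (TNle_condState_hybrid A hC hA hδ0 hδ subset_rfl sh (fill (rest sh)) (hfill sh))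
      ENNReal.toReal_nonneg).mono ?_
    rw [← Finset.sum_mul, sum_toReal, one_mul]
    have : (V.card : ℝ) ≤ n := by
      exact_mod_cast (Finset.card_le_univ V).trans_eq (Fintype.card_fin n)
    exact mul_le_mul_of_nonneg_right this (by linarith)
  obtain ⟨Sim, hSim⟩ := hC
  have hsame : ∀ s : Bits m,
      ∑ sh, (((C.split m s sh).toReal : ℝ) : ℂ) • condState A (fill (rest sh)) V =
      ∑ x, (((Sim m Vᶜ x).toReal : ℝ) : ℂ) • condState A (fill x) V := by
    intro s
    rw [sum_smul_comp_eq (C.split m s) rest fun x => condState A (fill x) V, ← hSim m Vᶜ hV s]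
  have h := (hstep s₀).add (hstep s₁).neg
  rw [hsame, hsame] at h
  convert h using 1
  · abel
  · ring

/-- The factor `2 ^ n` counts the possible accepted sets `V`, each contributing at most `4 * n * δ`.
-/
theorem compile_nscdAdvantageLE {S : UpperSet (Finset (Fin n))} (hC : C.Private S)
    {δ : ℝ} (hδ0 : 0 ≤ δ)
    (hδ : ∀ (i : Fin n) (A' : T.Adversary (kappa n sec) (C.shareLen m i)) a b,
      traceDist (T.experiment _ _ A' a) (T.experiment _ _ A' b) ≤ δ) :
    (compile C T m).NSCDAdvantageLE S sec (2 ^ n * (4 * n * δ)) := by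
  classical
  intro ℓ A hA s₀ s₁
  rw [Scheme.experiment_eq_gameOut, Scheme.experiment_eq_gameOut]
  refine traceDist_gameOut_le _ ?_ ?_
  · rw [Scheme.sum_gameState_trace, Scheme.sum_gameState_trace]
  · have h0 := gameAcc_eq_sum_condState A S s₀
    have h1 := gameAcc_eq_sum_condState A S s₁
    have h : TNle (∑ V ∈ Finset.univ.filter fun V : Finset (Fin n) => Vᶜ ∉ S,
        (∑ sh, (((C.split m s₀ sh).toReal : ℝ) : ℂ) • condState A sh V -
          ∑ sh, (((C.split m s₁ sh).toReal : ℝ) : ℂ) • condState A sh V))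
        (∑ V ∈ Finset.univ.filter fun V : Finset (Fin n) => Vᶜ ∉ S, 4 * n * δ) :=
      TNle.sum _ fun V hV => TNle_averaged_condState A hC hA hδ0 hδ (Finset.mem_filter.mp hV).2 s₀ s₁
    rw [Finset.sum_sub_distrib, ← h0, ← h1, Finset.sum_const, nsmul_eq_mul] at h
    refine h.mono (mul_le_mul_of_nonneg_right ?_ (by positivity))
    exact_mod_cast (Finset.card_filter_le _ _).trans_eq (by simp)

end Compile

end

end CertDel

namespace CertDel

open Matrix
open scoped ComplexOrder Kronecker

noncomputable section

/-! ## Asymptotic security -/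

lemma negligible_ite_half_pow (c : ℝ) (k₀ : ℕ) :
    Negligible fun k => if k₀ ≤ k then c * (1 / 2) ^ k else 1 := by
  intro d
  have h : Filter.Tendsto (fun k : ℕ => c * ((k : ℝ) ^ d * (1 / 2 : ℝ) ^ k)) Filter.atTop
      (nhds (c * 0)) :=
    (tendsto_pow_const_mul_const_pow_of_abs_lt_one d (by norm_num [abs_of_pos])).const_mul c
  rw [mul_zero] at h
  refine h.congr' ?_
  filter_upwards [Filter.eventually_ge_atTop k₀] with k hk
  rw [if_pos hk]
  ring

/-- Both `2 ^ n` and `n` are at most `2 ^ N`, and `a * N ≥ 3` makes the last factor at most `2 ^ (-3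
* N)`. The quadratic `κ` is what beats the exponential loss. -/
lemma two_rpow_bound {a : ℝ} {N n : ℕ} (hn : n ≤ N) (hN : 3 ≤ a * N) :
    (2 : ℝ) ^ n * (4 * n * (2 : ℝ) ^ (-(a * ((N ^ 2 : ℕ) : ℝ)))) ≤ 4 * (1 / 2) ^ N := by
  have h1 : (2 : ℝ) ^ n ≤ 2 ^ N := pow_le_pow_right₀ (by norm_num) hn
  have h2 : (n : ℝ) ≤ 2 ^ N :=
    (by exact_mod_cast (Nat.lt_two_pow_self (n := n)).le : (n : ℝ) ≤ 2 ^ n).trans h1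
  have h3 : (2 : ℝ) ^ (-(a * ((N ^ 2 : ℕ) : ℝ))) ≤ (1 / 2) ^ (3 * N) := by
    rw [one_div, inv_pow, ← Real.rpow_natCast 2, ← Real.rpow_neg (by norm_num)]
    refine Real.rpow_le_rpow_of_exponent_le (by norm_num) (neg_le_neg ?_)
    push_cast
    nlinarith [(Nat.cast_nonneg N : (0 : ℝ) ≤ N)]
  calc (2 : ℝ) ^ n * (4 * n * (2 : ℝ) ^ (-(a * ((N ^ 2 : ℕ) : ℝ))))
      ≤ 2 ^ N * (4 * 2 ^ N * (1 / 2) ^ (3 * N)) := by gcongr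
    _ = 4 * ((2 * 2 * (1 / 2) ^ 3) ^ N) := by
        rw [mul_pow, mul_pow, ← pow_mul]
        ring
    _ = 4 * (1 / 2) ^ N := by norm_num

theorem exists_negligible_bound (T : TwoOfTwo) (L : ℕ → ℕ) (hT : T.DeletionSecureUpTo L) :
    ∃ ε : ℕ → ℝ, Negligible ε ∧
      ∀ (n : ℕ) (S : UpperSet (Finset (Fin n))) (C : ClassicalScheme n),
        C.Private S → ∀ m sec : ℕ, (∀ i, C.shareLen m i ≤ L (max sec n ^ 2)) →
          (compile C T m).NSCDAdvantageLE S sec (ε sec) := by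
  obtain ⟨a, ha, κ₀, h⟩ := hT
  obtain ⟨k₁, hk₁⟩ := exists_nat_ge (3 / a)
  -- Beyond the threshold, `N ≥ 1` gives `N ^ 2 ≥ N ≥ κ₀`, and `N ≥ k₁ ≥ 3 / a` gives the exponent
  -- condition. The threshold depends on neither `n` nor the classical scheme; below it the trivial
  -- bound `1` is used.
  refine ⟨_, negligible_ite_half_pow 4 (max 1 (max κ₀ k₁)), fun n S C hC m sec hL => ?_⟩
  split_ifs with hsec
  · set N := max sec n with hN
    have hNs : sec ≤ N := le_max_left _ _
    have h1 : 1 ≤ N := (le_max_left _ _).trans (hsec.trans hNs)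
    have hκ : κ₀ ≤ N ^ 2 := by
      have : κ₀ ≤ N := (le_max_left _ _).trans ((le_max_right _ _).trans (hsec.trans hNs))
      nlinarith
    have hk : 3 ≤ a * N := by
      have h2 : k₁ ≤ N := (le_max_right _ _).trans ((le_max_right _ _).trans (hsec.trans hNs))
      have h3 : (k₁ : ℝ) ≤ N := by exact_mod_cast h2
      have h4 := hk₁.trans h3
      rw [div_le_iff₀ ha] at h4
      linarith
    intro ℓ A hA s₀ s₁
    have hadv := compile_nscdAdvantageLE (sec := sec) hC
      (δ := (2 : ℝ) ^ (-(a * ((N ^ 2 : ℕ) : ℝ)))) (by positivity)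
      (fun i A' s s' => h (N ^ 2) hκ _ (hL i) A' s s') ℓ A hA s₀ s₁
    refine hadv.trans ((two_rpow_bound (le_max_right _ _) hk).trans ?_)
    exact mul_le_mul_of_nonneg_left
      (pow_le_pow_of_le_one (by norm_num) (by norm_num) hNs) (by norm_num)
  · intro ℓ A _ s₀ s₁
    exact Scheme.traceDist_experiment_le_one S A s₀ s₁

theorem compile_nscdSecure {T : TwoOfTwo} (hT : T.DeletionSecure) {n : ℕ}
    {S : UpperSet (Finset (Fin n))} {C : ClassicalScheme n} (hC : C.Private S) (m : ℕ) :
    (compile C T m).NSCDSecure S := by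
  -- For fixed `n` and `m` the first-level shares have bounded length, so a constant `L` suffices.
  obtain ⟨ε, hε, h⟩ := exists_negligible_bound T _ (hT (Finset.univ.sup (C.shareLen m)))
  exact ⟨ε, hε, fun sec => h n S C hC m sec fun i => Finset.le_sup (Finset.mem_univ i)⟩

end

end CertDel

namespace CertDel

open Matrix
open scoped ComplexOrder Kronecker

noncomputable section

/-! ## A 2-out-of-2 scheme with certified deletion from conjugate coding -/

/-! ### Characters of bit strings and the two encoding bases -/

section Characters

variable {m : ℕ}

lemma bits_add_self (u : Bits m) : u + u = 0 := funext fun _ => BooleanRing.add_self _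

lemma bits_add_add_self (u v : Bits m) : u + v + v = u := by
  rw [add_assoc, bits_add_self, add_zero]

lemma bits_add_eq_iff {u v w : Bits m} : u + v = w ↔ v = u + w := by
  constructor
  · rintro rfl
    rw [← add_assoc, bits_add_self, zero_add]
  · rintro rfl
    rw [← add_assoc, bits_add_self, zero_add]

/-- The character `u ↦ (-1)^(χ·u)` of the group of bit strings. -/
def sgn (χ u : Bits m) : ℝ := ∏ j, if χ j && u j then -1 else 1

lemma sgn_comm (χ u : Bits m) : sgn χ u = sgn u χ := by
  simp only [sgn, Bool.and_comm]

lemma sgn_zero_left (u : Bits m) : sgn 0 u = 1 := by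
  refine Finset.prod_eq_one fun j _ => ?_
  simp

lemma sgn_zero_right (u : Bits m) : sgn u 0 = 1 := by rw [sgn_comm, sgn_zero_left]

lemma sgn_add (χ u v : Bits m) : sgn χ (u + v) = sgn χ u * sgn χ v := by
  rw [sgn, sgn, sgn, ← Finset.prod_mul_distrib]
  refine Finset.prod_congr rfl fun j _ => ?_
  have : (u + v) j = xor (u j) (v j) := rfl
  rw [this]
  cases χ j <;> cases u j <;> cases v j <;> simp

lemma sgn_mul_self (χ u : Bits m) : sgn χ u * sgn χ u = 1 := by
  rw [← sgn_add, bits_add_self, sgn_zero_right]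

lemma abs_sgn (χ u : Bits m) : |sgn χ u| = 1 := by
  rw [← sq_eq_sq₀ (abs_nonneg _) zero_le_one, sq_abs, sq, sgn_mul_self, one_pow]

lemma sgn_sum {ι : Type*} (s : Finset ι) (χ : Bits m) (u : ι → Bits m) :
    sgn χ (∑ i ∈ s, u i) = ∏ i ∈ s, sgn χ (u i) := by
  classical
  induction s using Finset.induction_on with
  | empty => simp [sgn_zero_right]
  | insert a s ha ih => rw [Finset.sum_insert ha, Finset.prod_insert ha, sgn_add, ih]

lemma sum_sgn (u : Bits m) : ∑ χ, sgn χ u = if u = 0 then 2 ^ m else 0 := by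
  simp only [sgn]
  rw [← Fintype.prod_sum (fun j (b : Bool) => if b && u j then (-1 : ℝ) else 1)]
  have h : ∀ j, (∑ b : Bool, if b && u j then (-1 : ℝ) else 1) = if u j = false then 2 else 0 := by
    intro j
    cases u j <;> norm_num
  simp_rw [h]
  rw [Finset.prod_ite_zero]
  have h0 : (∀ j ∈ Finset.univ, u j = false) ↔ u = 0 :=
    ⟨fun h => funext fun j => h j (Finset.mem_univ j), fun h j _ => by rw [h]; rfl⟩
  by_cases hu : u = 0
  · rw [if_pos (h0.2 hu), if_pos hu]
    simp
  · rw [if_neg (mt h0.1 hu), if_neg hu]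

lemma sum_sgn_mul_sgn (u v : Bits m) :
    ∑ χ, sgn χ u * sgn χ v = if u = v then 2 ^ m else 0 := by
  simp_rw [← sgn_add]
  rw [sum_sgn]
  refine if_congr ?_ rfl rfl
  rw [bits_add_eq_iff, add_zero]
  exact eq_comm

/-- The bit string `x`, encoded in the Hadamard basis (`true`) or the computational basis. -/
def codeword (b : Bool) (x : Bits m) : Matrix (Bits m) (Bits m) ℂ :=
  if b then of fun u v => (((2 ^ m)⁻¹ * (sgn x u * sgn x v) : ℝ) : ℂ) else ketbra x

/-- The permutation of the basis vectors by translation by `χ`. -/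
def shift (χ : Bits m) : Matrix (Bits m) (Bits m) ℂ := of fun u v => if u + v = χ then 1 else 0

lemma codeword_posSemidef (b : Bool) (x : Bits m) : (codeword b x).PosSemidef := by
  cases b
  · exact ketbra_posSemidef x
  · have h : codeword true x = (((2 ^ m)⁻¹ : ℝ) : ℂ) •
        vecMulVec (fun u => ((sgn x u : ℝ) : ℂ)) (star fun u => ((sgn x u : ℝ) : ℂ)) := by
      ext u v
      simp [codeword, vecMulVec_apply]
    rw [h]
    refine (posSemidef_vecMulVec_self_star _).smul ?_
    exact_mod_cast (by positivity : (0 : ℝ) ≤ (2 ^ m)⁻¹)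

/-- The Hadamard states are the joint eigenvectors of the translations, with the characters as
eigenvalues. -/
lemma sum_sgn_smul_codeword (χ : Bits m) :
    ∑ x, ((sgn χ x : ℝ) : ℂ) • codeword true x = shift χ := by
  ext u v
  simp only [codeword, shift, Matrix.sum_apply, Matrix.smul_apply, of_apply, smul_eq_mul, if_true]
  have h : ∀ x : Bits m, ((sgn χ x : ℝ) : ℂ) * (((2 ^ m)⁻¹ * (sgn x u * sgn x v) : ℝ) : ℂ) =
      (((2 ^ m)⁻¹ * (sgn x (u + v) * sgn x χ) : ℝ) : ℂ) := by
    intro x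
    rw [sgn_add, sgn_comm χ x]
    push_cast
    ring
  simp_rw [h]
  rw [← Complex.ofReal_sum, ← Finset.mul_sum, sum_sgn_mul_sgn]
  split_ifs <;> simp

lemma shift_zero : shift (0 : Bits m) = 1 := by
  ext u v
  rw [shift, of_apply, one_apply]
  refine if_congr ?_ rfl rfl
  rw [bits_add_eq_iff, add_zero]
  exact eq_comm

lemma sum_codeword (b : Bool) : ∑ x : Bits m, codeword b x = 1 := by
  cases b
  · exact ketbra_sum
  · rw [← shift_zero, ← sum_sgn_smul_codeword]
    simp [sgn_zero_left]

lemma trace_codeword_mul (b : Bool) (x y : Bits m) :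
    (codeword b x * codeword b y).trace = if x = y then 1 else 0 := by
  cases b
  · exact ketbra_mul_ketbra_trace x y
  · simp only [codeword, trace, diag_apply, Matrix.mul_apply, of_apply, if_true]
    have h : ∀ u v : Bits m, (((2 ^ m)⁻¹ * (sgn x u * sgn x v) : ℝ) : ℂ) *
        (((2 ^ m)⁻¹ * (sgn y v * sgn y u) : ℝ) : ℂ) =
        (((2 ^ m)⁻¹ * (sgn u x * sgn u y) * ((2 ^ m)⁻¹ * (sgn v x * sgn v y)) : ℝ) : ℂ) := by
      intro u v
      rw [sgn_comm x u, sgn_comm x v, sgn_comm y u, sgn_comm y v]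
      push_cast
      ring
    simp_rw [h, ← Complex.ofReal_sum, ← Finset.mul_sum, ← Finset.sum_mul, ← Finset.mul_sum,
      sum_sgn_mul_sgn]
    split_ifs <;> simp

lemma trace_codeword (b : Bool) (x : Bits m) : (codeword b x).trace = 1 := by
  cases b
  · exact ketbra_trace x
  · have h : ∀ u, ((sgn x u : ℝ) : ℂ) * ((sgn x u : ℝ) : ℂ) = 1 := fun u => by
      exact_mod_cast sgn_mul_self x u
    simp [codeword, trace, h]

end Characters

/-! ### The scheme, its correctness and its privacy -/

section Conjugate

variable {κ m : ℕ}

/-- The positions of the data: those that are not used for verification, and `none`. -/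
def isData (θ : Bits κ) : Option (Fin κ) → Bool
  | none => true
  | some i => !θ i

/-- The pad that masks the secret. -/
def pad (θ : Bits κ) (x : Option (Fin κ) → Bits m) : Bits m :=
  ∑ i, if isData θ i then x i else 0

/-- The encoding of `x` in the bases `θ`. -/
def conjState (θ : Bits κ) (x : Option (Fin κ) → Bits m) :
    Matrix (Option (Fin κ) → Bits m) (Option (Fin κ) → Bits m) ℂ :=
  piTensor fun i => codeword (isData θ i) (x i)

/-- The probability of each choice of the bases and of the encoded bit strings. -/
def conjWeight (κ m : ℕ) : ℝ := (2 ^ κ * (2 ^ m) ^ (κ + 1))⁻¹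

lemma conjWeight_nonneg : 0 ≤ conjWeight κ m := by
  unfold conjWeight
  positivity

/-- The splitting algorithm; the classical share is `(θ, s + pad)`. -/
def conjSplit (s : Bits m) (c : Bits (κ + m) × Bits κ × (Option (Fin κ) → Bits m)) :
    Matrix (Option (Fin κ) → Bits m) (Option (Fin κ) → Bits m) ℂ :=
  if c.1 = Fin.appendEquiv κ m (c.2.1, s + pad c.2.1 c.2.2) then
    (conjWeight κ m : ℂ) • conjState c.2.1 c.2.2 else 0

/-- The reconstruction algorithm: measure all positions and add the pad. -/
def conjReconstruct (c : Bits (κ + m)) (s : Bits m) :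
    Matrix (Option (Fin κ) → Bits m) (Option (Fin κ) → Bits m) ℂ :=
  ∑ x, if ((Fin.appendEquiv κ m).symm c).2 + pad ((Fin.appendEquiv κ m).symm c).1 x = s then
    conjState ((Fin.appendEquiv κ m).symm c).1 x else 0

/-- The verification algorithm compares the positions that hold no data. -/
def conjVerify (vk : Bits κ × (Option (Fin κ) → Bits m)) (z : Option (Fin κ) → Bits m) : Bool :=
  decide (∀ i, isData vk.1 i = false → vk.2 i = z i)

lemma conjState_posSemidef (θ : Bits κ) (x : Option (Fin κ) → Bits m) :
    (conjState θ x).PosSemidef :=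
  piTensor_posSemidef fun _ => codeword_posSemidef _ _

lemma conjState_trace (θ : Bits κ) (x : Option (Fin κ) → Bits m) : (conjState θ x).trace = 1 := by
  simp [conjState, piTensor_trace, trace_codeword]

lemma sum_conjState (θ : Bits κ) : ∑ x : Option (Fin κ) → Bits m, conjState θ x = 1 := by
  simp only [conjState]
  rw [piTensor_sum fun i => codeword (isData θ i)]
  simp_rw [sum_codeword]
  exact piTensor_one

lemma trace_conjState_mul (θ : Bits κ) (x y : Option (Fin κ) → Bits m) :
    (conjState θ x * conjState θ y).trace = if x = y then 1 else 0 := by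
  rw [conjState, conjState, piTensor_mul, piTensor_trace]
  simp_rw [trace_codeword_mul]
  rw [Finset.prod_ite_zero]
  simp [funext_iff]

lemma sum_conjWeight :
    ∑ _vk : Bits κ × (Option (Fin κ) → Bits m), (conjWeight κ m : ℂ) = 1 := by
  have h : ((2 : ℂ) ^ κ * (2 ^ m) ^ (κ + 1)) ≠ 0 := by positivity
  simp [conjWeight]
  field_simp

/-- The classical share is a function of the key and the secret, so a sum over `c` has a single
nonzero term. -/
lemma sum_conjSplit (s : Bits m) (vk : Bits κ × (Option (Fin κ) → Bits m)) {N : Type*}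
    [AddCommMonoid N]
    (f : Bits (κ + m) → Matrix (Option (Fin κ) → Bits m) (Option (Fin κ) → Bits m) ℂ → N)
    (hf : ∀ c, f c 0 = 0) :
    ∑ c, f c (conjSplit s (c, vk)) =
      f (Fin.appendEquiv κ m (vk.1, s + pad vk.1 vk.2))
        ((conjWeight κ m : ℂ) • conjState vk.1 vk.2) := by
  rw [Finset.sum_eq_single (Fin.appendEquiv κ m (vk.1, s + pad vk.1 vk.2))]
  · simp [conjSplit]
  · intro c _ hc
    rw [conjSplit, if_neg hc, hf]
  · simp

lemma conjSplit_isEnsemble (s : Bits m) : IsEnsemble (conjSplit (κ := κ) s) where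
  pos c := by
    rw [conjSplit]
    split_ifs
    · refine (conjState_posSemidef _ _).smul ?_
      exact_mod_cast conjWeight_nonneg
    · exact .zero
  trace_eq_one := by
    rw [Fintype.sum_prod_type, Finset.sum_comm, ← sum_conjWeight]
    refine Finset.sum_congr rfl fun vk _ => ?_
    rw [sum_conjSplit s vk (fun _ M => M.trace) (by simp), trace_smul, conjState_trace,
      smul_eq_mul, mul_one]

lemma conjReconstruct_isPOVM (c : Bits (κ + m)) : IsPOVM (conjReconstruct c) where
  pos s := by
    refine posSemidef_sum _ fun x _ => ?_
    split_ifs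
    exacts [conjState_posSemidef _ _, .zero]
  sum_eq_one := by
    simp only [conjReconstruct]
    rw [Finset.sum_comm]
    simp [sum_conjState]

/-- The 2-out-of-2 scheme with certified deletion from conjugate coding. -/
def conjugateCoding : TwoOfTwo where
  Q κ m := Option (Fin κ) → Bits m
  cshLen κ m := κ + m
  VK κ m := Bits κ × (Option (Fin κ) → Bits m)
  Cert κ m := Option (Fin κ) → Bits m
  split _ _ s c := conjSplit s c
  split_isEnsemble _ _ s := conjSplit_isEnsemble s
  reconstruct _ _ c s := conjReconstruct c s
  reconstruct_isPOVM _ _ c := conjReconstruct_isPOVM c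
  delete _ _ z := ketbra z
  delete_isPOVM _ _ := ⟨ketbra_posSemidef, ketbra_sum⟩
  verify _ _ vk z := conjVerify vk z

lemma conjugateCoding_correct : conjugateCoding.Correct := by
  intro κ m s
  change ∑ c : Bits (κ + m), ∑ vk : Bits κ × (Option (Fin κ) → Bits m),
    (conjReconstruct c s * conjSplit s (c, vk)).trace = 1
  rw [Finset.sum_comm, ← sum_conjWeight]
  refine Finset.sum_congr rfl fun vk _ => ?_
  rw [sum_conjSplit s vk (fun c M => (conjReconstruct c s * M).trace) (by simp), Matrix.mul_smul,
    trace_smul, smul_eq_mul, conjReconstruct, Equiv.symm_apply_apply, Finset.sum_mul, trace_sum,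
    Finset.sum_eq_single vk.2]
  · rw [if_pos (bits_add_add_self _ _), trace_conjState_mul, if_pos rfl, mul_one]
  · intro x _ hx
    split_ifs
    · rw [trace_conjState_mul, if_neg hx]
    · simp
  · simp

/-- The position `none` holds data for every `θ`. This makes the pad perfectly uniform even when all
other positions are checks. -/
lemma pad_add_single (θ : Bits κ) (x : Option (Fin κ) → Bits m) (s : Bits m) :
    pad θ (x + Pi.single none s) = pad θ x + s := by
  simp only [pad, Fintype.sum_option, isData, Pi.add_apply, Pi.single_eq_same, if_true, ne_eq,
    reduceCtorEq, not_false_eq_true, Pi.single_eq_of_ne, add_zero]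
  exact add_right_comm _ _ _

lemma conjugateCoding_private : conjugateCoding.Private := by
  intro κ m
  constructor
  · refine ⟨∑ vk : Bits κ × (Option (Fin κ) → Bits m),
      (conjWeight κ m : ℂ) • conjState vk.1 vk.2, fun s => ?_⟩
    change ∑ c : Bits (κ + m), ∑ vk : Bits κ × (Option (Fin κ) → Bits m),
      conjSplit s (c, vk) = _
    rw [Finset.sum_comm]
    exact Finset.sum_congr rfl fun vk _ => sum_conjSplit s vk (fun _ M => M) fun _ => rfl
  · refine ⟨fun c : Bits (κ + m) => ∑ vk : Bits κ × (Option (Fin κ) → Bits m),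
      if c = Fin.appendEquiv κ m (vk.1, pad vk.1 vk.2) then (conjWeight κ m : ℂ) else 0,
      fun s (c : Bits (κ + m)) => ?_⟩
    change ∑ vk : Bits κ × (Option (Fin κ) → Bits m), (conjSplit s (c, vk)).trace =
      ∑ vk : Bits κ × (Option (Fin κ) → Bits m),
        if c = Fin.appendEquiv κ m (vk.1, pad vk.1 vk.2) then (conjWeight κ m : ℂ) else 0
    rw [Fintype.sum_prod_type, Fintype.sum_prod_type]
    refine Finset.sum_congr rfl fun θ _ => ?_
    rw [← Equiv.sum_comp (Equiv.addRight (Pi.single none s : Option (Fin κ) → Bits m))]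
    refine Finset.sum_congr rfl fun x _ => ?_
    simp only [conjSplit, Equiv.coe_addRight, pad_add_single]
    rw [add_comm s, bits_add_add_self]
    split_ifs
    · rw [trace_smul, conjState_trace, smul_eq_mul, mul_one]
    · simp

/-- Check positions are encoded in the basis that the deletion measures, so a mismatch there has
amplitude zero. -/
lemma trace_ketbra_mul_conjState (θ : Bits κ) (x z : Option (Fin κ) → Bits m)
    (h : conjVerify (θ, x) z = false) : (ketbra z * conjState θ x).trace = 0 := by
  simp only [conjVerify, decide_eq_false_iff_not, not_forall] at h
  obtain ⟨i, hi, hne⟩ := h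
  rw [ketbra, trace_single_mul, one_smul, conjState, piTensor, of_apply,
    Finset.prod_eq_zero (Finset.mem_univ i)]
  rw [hi, codeword]
  simp [ketbra, hne]

lemma conjugateCoding_deletionCorrect : conjugateCoding.DeletionCorrect := by
  intro κ m s
  change ∑ c : Bits (κ + m), ∑ vk : Bits κ × (Option (Fin κ) → Bits m),
    ∑ z : Option (Fin κ) → Bits m,
    (if conjVerify vk z = true then (ketbra z * conjSplit s (c, vk)).trace else 0) = 1
  rw [Finset.sum_comm, ← sum_conjWeight]
  refine Finset.sum_congr rfl fun vk _ => ?_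
  rw [sum_conjSplit s vk (fun c M => ∑ z : Option (Fin κ) → Bits m,
    if conjVerify vk z = true then (ketbra z * M).trace else 0) (by simp)]
  have h : ∀ z : Option (Fin κ) → Bits m, (if conjVerify vk z = true then
      (ketbra z * (conjWeight κ m : ℂ) • conjState vk.1 vk.2).trace else 0) =
      (conjWeight κ m : ℂ) * (ketbra z * conjState vk.1 vk.2).trace := by
    intro z
    split_ifs with hz
    · rw [Matrix.mul_smul, trace_smul, smul_eq_mul]
    · rw [trace_ketbra_mul_conjState _ _ _ (by simpa using hz), mul_zero]
  simp_rw [h]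
  rw [← Finset.mul_sum, ← trace_sum, ← Finset.sum_mul, ketbra_sum, one_mul, conjState_trace,
    mul_one]

end Conjugate

end

end CertDel

namespace CertDel

open Matrix
open scoped ComplexOrder Kronecker

noncomputable section

/-! ## Deletion security of conjugate coding -/

/-! ### Two-sided operator bounds for tensor products -/

section Domination

lemma piTensor_smul {ι : Type} [Fintype ι] {X Y : ι → Type} (c : ι → ℂ)
    (A : ∀ i, Matrix (Y i) (X i) ℂ) :
    piTensor (fun i => c i • A i) = (∏ i, c i) • piTensor A := by
  ext y x
  simp [piTensor, Finset.prod_mul_distrib]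

lemma piTensor_diagonal {ι : Type} [Fintype ι] {X : ι → Type} [∀ i, DecidableEq (X i)]
    [DecidableEq (∀ i, X i)] (d : ∀ i, X i → ℂ) :
    piTensor (fun i => diagonal (d i)) = diagonal fun x => ∏ i, d i (x i) := by
  ext y x
  simp only [piTensor, of_apply, diagonal_apply, funext_iff]
  rw [Finset.prod_ite_zero]
  simp

/-- If `-D i ≤ B i ≤ D i` for all `i`, the same holds for the tensor products. -/
lemma piTensor_dominated {ι : Type} [Fintype ι] [DecidableEq ι] {X : ι → Type}
    [∀ i, Fintype (X i)] [∀ i, DecidableEq (X i)] {D B : ∀ i, Matrix (X i) (X i) ℂ}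
    (h : ∀ i (b : Bool), (D i + (if b then -1 else 1 : ℂ) • B i).PosSemidef) (b : Bool) :
    (piTensor D + (if b then -1 else 1 : ℂ) • piTensor B).PosSemidef := by
  -- `D i` and `B i` are half the sum and half the difference of the positive operators `D i ± B i`.
  -- Expanding both tensor products gives coefficients proportional to `1 ± ∏ (signs)`, which are
  -- nonnegative.
  have hD : D = fun i => ∑ b : Bool, (2⁻¹ : ℂ) • (D i + (if b then -1 else 1 : ℂ) • B i) := by
    funext i
    simp only [Fintype.sum_bool, if_true, Bool.false_eq_true, if_false]
    module
  have hB : B = fun i => ∑ b : Bool, ((2⁻¹ : ℂ) * if b then -1 else 1) •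
      (D i + (if b then -1 else 1 : ℂ) • B i) := by
    funext i
    simp only [Fintype.sum_bool, if_true, Bool.false_eq_true, if_false]
    module
  have key : piTensor D + (if b then -1 else 1 : ℂ) • piTensor B =
      ∑ f : ι → Bool, ((∏ _i : ι, (2⁻¹ : ℝ)) * (1 + (if b then -1 else 1) *
        ∏ i, if f i then -1 else 1) : ℝ) •
          piTensor fun i => D i + (if f i then -1 else 1 : ℂ) • B i := by
    have h1 : piTensor D = ∑ f : ι → Bool, (∏ _i : ι, (2⁻¹ : ℂ)) •
        piTensor fun i => D i + (if f i then -1 else 1 : ℂ) • B i := by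
      conv_lhs => rw [hD]
      rw [← piTensor_sum]
      simp_rw [piTensor_smul]
    have h2 : piTensor B = ∑ f : ι → Bool, ((∏ _i : ι, (2⁻¹ : ℂ)) * ∏ i, if f i then -1 else 1) •
        piTensor fun i => D i + (if f i then -1 else 1 : ℂ) • B i := by
      conv_lhs => rw [hB]
      rw [← piTensor_sum (fun i (b : Bool) => ((2⁻¹ : ℂ) * if b then -1 else 1) •
        (D i + (if b then -1 else 1 : ℂ) • B i))]
      simp_rw [piTensor_smul, Finset.prod_mul_distrib]
    conv_lhs => rw [h1, h2]
    rw [Finset.smul_sum, ← Finset.sum_add_distrib]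
    refine Finset.sum_congr rfl fun f _ => ?_
    rw [smul_smul, ← add_smul, ← Complex.coe_smul]
    congr 1
    have hc : ∀ b : Bool, ((if b then -1 else 1 : ℝ) : ℂ) = if b then -1 else 1 := by
      intro b
      cases b <;> simp
    simp only [Complex.ofReal_mul, Complex.ofReal_prod, Complex.ofReal_add, Complex.ofReal_one,
      Complex.ofReal_inv, Complex.ofReal_ofNat, hc]
    ring
  rw [key]
  refine posSemidef_sum _ fun f _ => (piTensor_posSemidef fun i => h i (f i)).smul ?_
  refine mul_nonneg (Finset.prod_nonneg fun _ _ => by norm_num) ?_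
  have hp : |∏ i, if f i then (-1 : ℝ) else 1| = 1 := by
    rw [Finset.abs_prod]
    exact Finset.prod_eq_one fun i _ => by split_ifs <;> simp
  have := abs_le.mp hp.le
  split_ifs <;> linarith [this.1, this.2]

end Domination

/-! ### Trace norms under an operation with a classical tag -/

section Kraus

variable {X Y Z K : Type} [Fintype X] [Fintype Y] [Fintype Z] [DecidableEq Z] [Fintype K]

/-- The operation with Kraus operators `F`, which moreover outputs the classical value `c`. -/
def krausTag (F : K → Matrix Y X ℂ) (c : Z) : Matrix X X ℂ →ₗ[ℂ] Matrix (Y × Z) (Y × Z) ℂ where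
  toFun ρ := (∑ k, F k * ρ * (F k)ᴴ) ⊗ₖ ketbra c
  map_add' ρ σ := by
    simp only [Matrix.mul_add, Matrix.add_mul, Finset.sum_add_distrib, add_kronecker]
  map_smul' r ρ := by
    simp only [Matrix.mul_smul, Matrix.smul_mul, ← Finset.smul_sum, smul_kronecker,
      RingHom.id_apply]

lemma krausTag_posSemidef (F : K → Matrix Y X ℂ) (c : Z) {ρ : Matrix X X ℂ}
    (h : ρ.PosSemidef) : (krausTag F c ρ).PosSemidef :=
  (posSemidef_sum_kraus F h).kronecker (ketbra_posSemidef c)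

lemma krausTag_trace_diagonal [DecidableEq X] (F : K → Matrix Y X ℂ) (c : Z) (d : X → ℝ) :
    (krausTag F c (diagonal fun u => (d u : ℂ))).trace.re =
      ∑ u, ((∑ k, (F k)ᴴ * F k) u u).re * d u := by
  have h : (krausTag F c (diagonal fun u => (d u : ℂ))).trace =
      ∑ u, (∑ k, (F k)ᴴ * F k) u u * d u := by
    simp only [krausTag, LinearMap.coe_mk, AddHom.coe_mk]
    rw [trace_kronecker, ketbra_trace, mul_one, trace_sum]
    rw [Finset.sum_congr rfl fun k _ => trace_mul_cycle (F k) _ (F k)ᴴ]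
    rw [← trace_sum, ← Finset.sum_mul, trace]
    simp only [diag_apply, mul_diagonal]
  rw [h, Complex.re_sum]
  simp

/-- If `-D ≤ B ≤ D`, the trace norm of the image of `B` is at most the trace of the image of `D`. -/
lemma TNle_krausTag (F : K → Matrix Y X ℂ) (c : Z) {D B : Matrix X X ℂ}
    (h : ∀ b : Bool, (D + (if b then -1 else 1 : ℂ) • B).PosSemidef) :
    TNle (krausTag F c B) (krausTag F c D).trace.re := by
  have h1 := h false
  have h2 := h true
  simp only [if_true, Bool.false_eq_true, if_false, one_smul, neg_smul] at h1 h2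
  -- `B` is half of `(D + B) - (D - B)`, and the images of these two positive operators have total
  -- trace twice that of `D`.
  have := (TNle_sub_of_posSemidef (krausTag_posSemidef F c h1)
    (krausTag_posSemidef F c h2)).smul (2⁻¹)
  rw [← map_sub, ← map_smul, ← trace_add, ← map_add] at this
  convert this using 1
  · congr 1
    push_cast
    module
  · have e : D + B + (D + -B) = (2 : ℂ) • D := by module
    rw [e, map_smul, trace_smul, abs_of_nonneg (by norm_num)]
    simp

end Kraus

/-! ### Diagonal bounds for one position -/

section Cells

variable {m : ℕ}

/-- The tensor factors after the sum over the encoded strings. -/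
def cell (b : Bool) (χ z : Bits m) : Matrix (Bits m) (Bits m) ℂ :=
  if b then shift χ else ketbra z

/-- A weight that is small at `z` and satisfies `damp χ z u * damp χ z (u + χ) = 1`. -/
def damp (χ z u : Bits m) : ℝ := if u = z then 2 / 3 else if u + χ = z then 3 / 2 else 1

/-- The diagonal of an operator that dominates `cell b χ z`. -/
def cellBound (b : Bool) (χ z u : Bits m) : ℝ := if b then damp χ z u else if u = z then 1 else 0

lemma damp_pos (χ z u : Bits m) : 0 < damp χ z u := by
  unfold damp
  split_ifs <;> norm_num

lemma damp_mul_damp {χ : Bits m} (hχ : χ ≠ 0) (z u : Bits m) :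
    damp χ z u * damp χ z (u + χ) = 1 := by
  simp only [damp, bits_add_add_self]
  by_cases h1 : u = z <;> by_cases h2 : u + χ = z
  · exact absurd (add_eq_left.mp (h2.trans h1.symm)) hχ
  · rw [if_pos h1, if_neg h2, if_pos h1]; norm_num
  · rw [if_neg h1, if_pos h2, if_pos h2]; norm_num
  · simp [h1, h2]

lemma cellBound_nonneg (b : Bool) (χ z u : Bits m) : 0 ≤ cellBound b χ z u := by
  unfold cellBound
  split_ifs <;> first | exact (damp_pos _ _ _).le | norm_num

lemma damp_le (χ z u : Bits m) : damp χ z u ≤ 3 / 2 := by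
  unfold damp
  split_ifs <;> norm_num

/-- The three cases give `2/3 + 1` at `u = z`, `3/2` at `u + χ = z`, and `1` elsewhere. Undamped,
the case `u = z` would give `2` and no decay; the value `2/3` keeps both it and the reciprocal `3/2`
strictly below `2`. -/
lemma sum_cellBound_le (χ z u : Bits m) : ∑ b : Bool, cellBound (!b) χ z u ≤ 5 / 3 := by
  simp only [Fintype.sum_bool, cellBound, damp]
  by_cases h1 : u = z <;> by_cases h2 : u + χ = z <;> simp [h1, h2] <;> norm_num

lemma shift_conjTranspose (χ : Bits m) : (shift χ)ᴴ = shift χ := by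
  ext u v
  simp only [shift, conjTranspose_apply, of_apply, add_comm v u]
  split_ifs <;> simp

lemma shift_mul_self (χ : Bits m) : shift χ * shift χ = 1 := by
  ext u v
  simp only [shift, Matrix.mul_apply, of_apply, one_apply, bits_add_eq_iff]
  rw [Finset.sum_eq_single (u + χ)]
  · rw [if_pos rfl, one_mul]
    refine if_congr ?_ rfl rfl
    rw [bits_add_add_self]
    exact eq_comm
  · intro w _ hw
    rw [if_neg hw, zero_mul]
  · simp

/-- The translation is a Hermitian involution, so `1 ± shift χ` is twice a projection. -/
lemma one_add_shift_posSemidef (χ : Bits m) (b : Bool) :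
    (1 + (if b then -1 else 1 : ℂ) • shift χ).PosSemidef := by
  have h : 1 + (if b then -1 else 1 : ℂ) • shift χ =
      (2⁻¹ : ℝ) • ((1 + (if b then -1 else 1 : ℂ) • shift χ)ᴴ *
        (1 + (if b then -1 else 1 : ℂ) • shift χ)) := by
    rw [conjTranspose_add, conjTranspose_one, conjTranspose_smul, shift_conjTranspose,
      Matrix.add_mul, Matrix.mul_add, Matrix.mul_add, Matrix.smul_mul, Matrix.smul_mul,
      Matrix.mul_smul, Matrix.mul_smul, shift_mul_self, Matrix.mul_one, Matrix.one_mul,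
      Matrix.mul_one]
    cases b <;> simp <;> module
  rw [h]
  exact (posSemidef_conjTranspose_mul_self _).smul (by norm_num)

lemma cell_dominated (b : Bool) {χ : Bits m} (hχ : χ ≠ 0) (z : Bits m) (c : Bool) :
    (diagonal (fun u => (cellBound b χ z u : ℂ)) +
      (if c then -1 else 1 : ℂ) • cell b χ z).PosSemidef := by
  cases b
  · have h : diagonal (fun u => (cellBound false χ z u : ℂ)) +
        (if c then -1 else 1 : ℂ) • cell false χ z = (if c then 0 else 2 : ℝ) • ketbra z := by
      have : diagonal (fun u => (cellBound false χ z u : ℂ)) = ketbra z := by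
        ext u v
        simp only [diagonal_apply, cellBound, ketbra, single_apply]
        by_cases h : u = v
        · subst h
          by_cases h' : u = z <;> simp [h', eq_comm (a := z)]
        · by_cases h' : z = u
          · subst h'
            simp [h]
          · simp [h, h']
      rw [this]
      cases c <;> simp [cell] <;> module
    rw [h]
    exact (ketbra_posSemidef z).smul (by split_ifs <;> norm_num)
  -- Conjugation by the square root of the weight turns `1` into the weight and fixes the
  -- translation, since the weights of `u` and `u + χ` are reciprocal.
  · have h : diagonal (fun u => (cellBound true χ z u : ℂ)) +
        (if c then -1 else 1 : ℂ) • cell true χ z =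
        (diagonal fun u => ((√(damp χ z u) : ℝ) : ℂ))ᴴ *
          (1 + (if c then -1 else 1 : ℂ) • shift χ) *
          diagonal fun u => ((√(damp χ z u) : ℝ) : ℂ) := by
      ext u v
      rw [diagonal_conjTranspose, mul_diagonal, diagonal_mul]
      simp only [cell, cellBound, if_true, Matrix.add_apply, Matrix.smul_apply, diagonal_apply,
        one_apply, shift, of_apply, Pi.star_apply, RCLike.star_def, Complex.conj_ofReal,
        smul_eq_mul]
      rw [mul_add, add_mul]
      congr 1
      · split_ifs with h
        · subst h
          rw [mul_one]
          exact_mod_cast (Real.mul_self_sqrt (damp_pos _ _ _).le).symm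
        · simp
      · by_cases h : u + v = χ
        · have hv : v = u + χ := bits_add_eq_iff.mp h
          have hs : ((√(damp χ z u) : ℝ) : ℂ) * ((√(damp χ z v) : ℝ) : ℂ) = 1 := by
            rw [hv, ← Complex.ofReal_mul, ← Real.sqrt_mul (damp_pos _ _ _).le,
              damp_mul_damp hχ, Real.sqrt_one, Complex.ofReal_one]
          rw [if_pos h, mul_one, mul_right_comm, hs, one_mul]
        · simp [h]
    rw [h]
    exact (one_add_shift_posSemidef χ c).conjTranspose_mul_mul_same _

end Cells

end

end CertDel

namespace CertDel

open Matrix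
open scoped ComplexOrder Kronecker

noncomputable section

/-! ### Fourier analysis of the accepted state -/

section Conjugate

variable {κ m : ℕ}

/-- The sum of the encodings that are consistent with the classical share `(θ, p)` of the secret `s`
and with the certificate `z`. -/
def consistentState (s : Bits m) (θ : Bits κ) (z : Option (Fin κ) → Bits m) (p : Bits m) :
    Matrix (Option (Fin κ) → Bits m) (Option (Fin κ) → Bits m) ℂ :=
  ∑ x, if p = s + pad θ x then if conjVerify (θ, x) z = true then conjState θ x else 0 else 0

lemma indicator_eq_sum_sgn (s p u : Bits m) :
    (if p = s + u then (1 : ℂ) else 0) =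
      ∑ χ, (((2 ^ m)⁻¹ * sgn χ (s + p) : ℝ) : ℂ) * ((sgn χ u : ℝ) : ℂ) := by
  have h := sum_sgn_mul_sgn (s + p) u
  have h2 : ∑ χ, (((2 ^ m)⁻¹ * sgn χ (s + p) : ℝ) : ℂ) * ((sgn χ u : ℝ) : ℂ) =
      (((2 ^ m)⁻¹ * ∑ χ, sgn χ (s + p) * sgn χ u : ℝ) : ℂ) := by
    rw [Finset.mul_sum, Complex.ofReal_sum]
    refine Finset.sum_congr rfl fun χ _ => ?_
    push_cast
    ring
  rw [h2, h]
  have h3 : p = s + u ↔ s + p = u := by rw [bits_add_eq_iff]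
  by_cases hp : p = s + u
  · rw [if_pos hp, if_pos (h3.mp hp)]
    simp
  · rw [if_neg hp, if_neg (mt h3.mpr hp)]
    simp

/-- A character of the pad is a product over the data positions, so the sum over `x` factorizes: a
data position yields a translation and a check position is pinned to `z i`. -/
lemma sum_sgn_pad (θ : Bits κ) (z : Option (Fin κ) → Bits m) (χ : Bits m) :
    ∑ x, ((sgn χ (pad θ x) : ℝ) : ℂ) • (if conjVerify (θ, x) z = true then conjState θ x else 0) =
      piTensor fun i => cell (isData θ i) χ (z i) := by
  have h : ∀ i, cell (isData θ i) χ (z i) = ∑ x : Bits m,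
      (if isData θ i then ((sgn χ x : ℝ) : ℂ) else if x = z i then 1 else 0) •
        codeword (isData θ i) x := by
    intro i
    cases isData θ i
    · simp [cell, codeword]
    · simp only [cell, if_true]
      exact (sum_sgn_smul_codeword χ).symm
  simp_rw [h]
  rw [← piTensor_sum fun i (x : Bits m) =>
    (if isData θ i then ((sgn χ x : ℝ) : ℂ) else if x = z i then 1 else 0) •
      codeword (isData θ i) x]
  refine Finset.sum_congr rfl fun x _ => ?_
  rw [piTensor_smul, pad, sgn_sum, Complex.ofReal_prod, conjState]
  by_cases hv : ∀ i, isData θ i = false → x i = z i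
  · rw [if_pos (by simpa [conjVerify] using hv)]
    congr 1
    refine Finset.prod_congr rfl fun i _ => ?_
    cases hi : isData θ i
    · simp [hv i hi, sgn_zero_right]
    · simp
  · rw [if_neg (by simpa [conjVerify] using hv), smul_zero]
    push Not at hv
    obtain ⟨i, hi, hne⟩ := hv
    rw [Finset.prod_eq_zero (Finset.mem_univ i), zero_smul]
    simp [hi, hne]

/-- Fourier inversion of the constraint on the pad confines the secret to the signs `sgn χ (s + p)`.
-/
lemma consistentState_eq (s : Bits m) (θ : Bits κ) (z : Option (Fin κ) → Bits m) (p : Bits m) :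
    consistentState s θ z p = ∑ χ, (((2 ^ m)⁻¹ * sgn χ (s + p) : ℝ) : ℂ) •
      piTensor fun i => cell (isData θ i) χ (z i) := by
  simp_rw [← sum_sgn_pad, Finset.smul_sum]
  rw [Finset.sum_comm, consistentState]
  refine Finset.sum_congr rfl fun x _ => ?_
  simp_rw [smul_smul]
  rw [← Finset.sum_smul, ← indicator_eq_sum_sgn, ite_smul, one_smul, zero_smul]

variable {R K : Type} [Fintype R] [Fintype K]

/-- The accepted part of the certified deletion game for conjugate coding. -/
def conjAccepted (F : (Option (Fin κ) → Bits m) → K → Matrix R (Option (Fin κ) → Bits m) ℂ)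
    (s : Bits m) : Matrix (R × Bits (κ + m)) (R × Bits (κ + m)) ℂ :=
  ∑ c : Bits (κ + m), ∑ vk : Bits κ × (Option (Fin κ) → Bits m), ∑ z,
    if conjVerify vk z = true then krausTag (F z) c (conjSplit s (c, vk)) else 0

lemma conjAccepted_eq (F : (Option (Fin κ) → Bits m) → K → Matrix R (Option (Fin κ) → Bits m) ℂ)
    (s : Bits m) : conjAccepted F s = ∑ θ, ∑ z, ∑ p, (conjWeight κ m : ℂ) •
      krausTag (F z) (Fin.appendEquiv κ m (θ, p)) (consistentState s θ z p) := by
  rw [conjAccepted, Finset.sum_comm, Fintype.sum_prod_type]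
  refine Finset.sum_congr rfl fun θ _ => ?_
  have h : ∀ x : Option (Fin κ) → Bits m, (∑ c : Bits (κ + m), ∑ z,
      if conjVerify (θ, x) z = true then krausTag (F z) c (conjSplit s (c, (θ, x))) else 0) =
      ∑ z, ∑ p, (conjWeight κ m : ℂ) • krausTag (F z) (Fin.appendEquiv κ m (θ, p))
        (if p = s + pad θ x then if conjVerify (θ, x) z = true then conjState θ x else 0
          else 0) := by
    intro x
    rw [sum_conjSplit s (θ, x) (fun c M => ∑ z,
      if conjVerify (θ, x) z = true then krausTag (F z) c M else 0) (by simp)]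
    refine Finset.sum_congr rfl fun z _ => ?_
    rw [Finset.sum_eq_single (s + pad θ x)]
    · rw [if_pos rfl]
      split_ifs
      · rw [map_smul]
      · rw [map_zero, smul_zero]
    · intro p _ hp
      rw [if_neg hp, map_zero, smul_zero]
    · simp
  simp_rw [h]
  rw [Finset.sum_comm]
  refine Finset.sum_congr rfl fun z _ => ?_
  rw [Finset.sum_comm]
  refine Finset.sum_congr rfl fun p _ => ?_
  rw [consistentState, map_sum, Finset.smul_sum]

/-- The diagonal of an operator that dominates the tensor product of the cells. -/
def dataBound (θ : Bits κ) (χ : Bits m) (z u : Option (Fin κ) → Bits m) : ℝ :=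
  ∏ i, cellBound (isData θ i) χ (z i) (u i)

lemma dataBound_nonneg (θ : Bits κ) (χ : Bits m) (z u : Option (Fin κ) → Bits m) :
    0 ≤ dataBound θ χ z u :=
  Finset.prod_nonneg fun _ _ => cellBound_nonneg _ _ _ _

lemma sum_dataBound_le (χ : Bits m) (z u : Option (Fin κ) → Bits m) :
    ∑ θ : Bits κ, dataBound θ χ z u ≤ 3 / 2 * (5 / 3) ^ κ := by
  simp only [dataBound, Fintype.prod_option, isData]
  rw [← Finset.mul_sum,
    ← Fintype.prod_sum fun (i : Fin κ) b => cellBound (!b) χ (z (some i)) (u (some i))]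
  refine mul_le_mul (damp_le _ _ _) ?_ (Finset.prod_nonneg fun i _ =>
    Finset.sum_nonneg fun b _ => cellBound_nonneg _ _ _ _) (by norm_num)
  calc _ ≤ ∏ _i : Fin κ, (5 / 3 : ℝ) := Finset.prod_le_prod
        (fun i _ => Finset.sum_nonneg fun b _ => cellBound_nonneg _ _ _ _)
        fun i _ => sum_cellBound_le _ _ _
    _ = _ := by rw [Finset.prod_const, Finset.card_univ, Fintype.card_fin]

lemma piTensor_cell_dominated (θ : Bits κ) {χ : Bits m} (hχ : χ ≠ 0)
    (z : Option (Fin κ) → Bits m) (b : Bool) :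
    (diagonal (fun u => (dataBound θ χ z u : ℂ)) +
      (if b then -1 else 1 : ℂ) • piTensor fun i => cell (isData θ i) χ (z i)).PosSemidef := by
  have := piTensor_dominated (fun i b => cell_dominated (isData θ i) hχ (z i) b) b
  rw [piTensor_diagonal] at this
  simpa only [dataBound, Complex.ofReal_prod] using this

lemma TNle_krausTag_consistentState_sub
    (F : K → Matrix R (Option (Fin κ) → Bits m) ℂ) (c : Bits (κ + m)) (s₀ s₁ : Bits m)
    (θ : Bits κ) (z : Option (Fin κ) → Bits m) (p : Bits m) :
    TNle (krausTag F c (consistentState s₀ θ z p - consistentState s₁ θ z p))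
      (∑ χ, (2 ^ m)⁻¹ * 2 * ∑ u, ((∑ k, (F k)ᴴ * F k) u u).re * dataBound θ χ z u) := by
  rw [consistentState_eq, consistentState_eq, ← Finset.sum_sub_distrib, map_sum]
  refine TNle.sum _ fun χ _ => ?_
  rw [← sub_smul, ← Complex.ofReal_sub, map_smul, ← mul_sub, ← krausTag_trace_diagonal F c]
  -- The trivial character carries no secret and cancels. It has to be treated apart, because the
  -- reciprocal weights need `χ ≠ 0`.
  by_cases hχ : χ = 0
  · subst hχ
    simp only [sgn_zero_left, sub_self, mul_zero, Complex.ofReal_zero, zero_smul]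
    refine TNle_zero.mono (mul_nonneg (by positivity) (posSemidef_re_trace_nonneg
      (krausTag_posSemidef F c (PosSemidef.diagonal fun u =>
        Complex.zero_le_real.mpr (dataBound_nonneg θ 0 z u)))))
  · have h := TNle_krausTag F c (piTensor_cell_dominated θ hχ z)
    refine (h.smul _).mono (mul_le_mul_of_nonneg_right ?_ ?_)
    · rw [abs_mul, abs_of_nonneg (by positivity)]
      gcongr
      refine (abs_sub _ _).trans ?_
      rw [abs_sgn, abs_sgn]
      norm_num
    · refine posSemidef_re_trace_nonneg (krausTag_posSemidef F c (PosSemidef.diagonal fun u =>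
        Complex.zero_le_real.mpr (dataBound_nonneg θ χ z u)))

/-- The diagonal bound depends on the adversary only through the diagonal of its effects, so `θ` can
be summed for fixed `z` and `u`. Each of the `κ` positions contributes at most `5/3` out of two
basis choices, and the position `none` at most `3/2`. -/
lemma TNle_conjAccepted_sub
    {F : (Option (Fin κ) → Bits m) → K → Matrix R (Option (Fin κ) → Bits m) ℂ}
    (hF : ∀ u, ∑ z, ((∑ k, (F z k)ᴴ * F z k) u u).re ≤ 1) (s₀ s₁ : Bits m) :
    TNle (conjAccepted F s₀ - conjAccepted F s₁) (3 * 2 ^ m * (5 / 6) ^ κ) := by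
  have h : conjAccepted F s₀ - conjAccepted F s₁ = ∑ θ, ∑ z, ∑ p, (conjWeight κ m : ℂ) •
      krausTag (F z) (Fin.appendEquiv κ m (θ, p))
        (consistentState s₀ θ z p - consistentState s₁ θ z p) := by
    simp_rw [conjAccepted_eq, ← Finset.sum_sub_distrib, ← smul_sub, ← map_sub]
  rw [h]
  refine (TNle.sum _ fun θ _ => TNle.sum _ fun z _ => TNle.sum _ fun p _ =>
    (TNle_krausTag_consistentState_sub (F z) _ s₀ s₁ θ z p).smul_nonneg conjWeight_nonneg).mono ?_
  obtain ⟨M, hM⟩ : ∃ M : (Option (Fin κ) → Bits m) → (Option (Fin κ) → Bits m) → ℝ,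
      ∀ z u, ((∑ k, (F z k)ᴴ * F z k) u u).re = M z u := ⟨_, fun _ _ => rfl⟩
  have hM0 : ∀ z u, 0 ≤ M z u := fun z u => by
    rw [← hM]
    have : (∑ k, (F z k)ᴴ * F z k).PosSemidef :=
      posSemidef_sum _ fun k _ => posSemidef_conjTranspose_mul_self _
    simpa using (Complex.le_def.mp (this.diag_nonneg (i := u))).1
  simp only [hM] at hF ⊢
  have h1 : ∀ χ : Bits m, ∑ θ : Bits κ, ∑ z, ∑ u, M z u * dataBound θ χ z u ≤
      (2 ^ m) ^ (κ + 1) * (3 / 2 * (5 / 3) ^ κ) := by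
    intro χ
    calc ∑ θ : Bits κ, ∑ z, ∑ u, M z u * dataBound θ χ z u
        = ∑ u, ∑ z, M z u * ∑ θ : Bits κ, dataBound θ χ z u := by
          simp_rw [Finset.mul_sum]
          exact Finset.sum_comm.trans
            ((Finset.sum_congr rfl fun z _ => Finset.sum_comm).trans Finset.sum_comm)
      _ ≤ ∑ u, ∑ z, M z u * (3 / 2 * (5 / 3) ^ κ) := by
          gcongr with u _ z _
          · exact hM0 z u
          · exact sum_dataBound_le χ z u
      _ ≤ ∑ u : Option (Fin κ) → Bits m, 1 * (3 / 2 * (5 / 3) ^ κ) := by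
          simp_rw [← Finset.sum_mul]
          gcongr with u _
          exact hF u
      _ = _ := by simp
  calc _ = conjWeight κ m * 2 *
        ∑ χ : Bits m, ∑ θ : Bits κ, ∑ z, ∑ u, M z u * dataBound θ χ z u := by
        -- The bound does not depend on `p`, and the `2 ^ m` values of `p` cancel the Fourier
        -- factor.
        have h2 : ∀ (θ : Bits κ) (z : Option (Fin κ) → Bits m), ∑ _p : Bits m, conjWeight κ m *
            ∑ χ, (2 ^ m)⁻¹ * 2 * ∑ u, M z u * dataBound θ χ z u =
            conjWeight κ m * 2 * ∑ χ, ∑ u, M z u * dataBound θ χ z u := by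
          intro θ z
          rw [← Finset.mul_sum, ← Finset.mul_sum, Finset.sum_const, Finset.card_univ, nsmul_eq_mul,
            Fintype.card_pi_const, Fintype.card_bool]
          push_cast
          field_simp
        simp_rw [h2, ← Finset.mul_sum]
        congr 1
        exact (Finset.sum_congr rfl fun θ _ => Finset.sum_comm).trans Finset.sum_comm
    _ ≤ conjWeight κ m * 2 * ∑ χ : Bits m, (2 ^ m) ^ (κ + 1) * (3 / 2 * (5 / 3) ^ κ) := by
        have := conjWeight_nonneg (κ := κ) (m := m)
        gcongr with χ _
        exact h1 χ
    _ = _ := by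
        have h6 : (5 / 6 : ℝ) ^ κ = (5 / 3) ^ κ / 2 ^ κ := by
          rw [← div_pow]
          norm_num
        rw [h6]
        simp [conjWeight]
        field_simp

lemma conjugateCoding_gameAcc (A : conjugateCoding.Adversary κ m)
    (F : (Option (Fin κ) → Bits m) → A.K → Matrix A.R (Option (Fin κ) → Bits m) ℂ)
    (hF : ∀ z, A.E (some z) = F z) (s : Bits m) :
    gameAcc (fun o => conjugateCoding.accepts κ m o.2.1 o.2.2 = true)
      (conjugateCoding.gameState A s) = conjAccepted F s := by
  simp only [gameAcc, Fintype.sum_prod_type]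
  rw [conjAccepted]
  refine Finset.sum_congr rfl fun c _ => ?_
  refine Finset.sum_congr rfl fun vk _ => ?_
  rw [Fintype.sum_option, if_neg (by simp [TwoOfTwo.accepts]), zero_add]
  refine Finset.sum_congr rfl fun z _ => ?_
  rw [← hF z]
  rfl

lemma conjugateCoding_traceDist_le (A : conjugateCoding.Adversary κ m) (s₀ s₁ : Bits m) :
    traceDist (conjugateCoding.experiment κ m A s₀) (conjugateCoding.experiment κ m A s₁) ≤
      3 * 2 ^ m * (5 / 6) ^ κ := by
  rw [TwoOfTwo.experiment_eq_gameOut, TwoOfTwo.experiment_eq_gameOut]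
  refine traceDist_gameOut_le _ ?_ ?_
  · rw [TwoOfTwo.sum_gameState_trace, TwoOfTwo.sum_gameState_trace]
  · obtain ⟨F, hF⟩ : ∃ F : (Option (Fin κ) → Bits m) → A.K →
        Matrix A.R (Option (Fin κ) → Bits m) ℂ, ∀ z, A.E (some z) = F z :=
      ⟨fun z => A.E (some z), fun _ => rfl⟩
    rw [conjugateCoding_gameAcc A F hF, conjugateCoding_gameAcc A F hF]
    refine TNle_conjAccepted_sub (fun u => ?_) s₀ s₁
    have hA := A.isInstrument
    rw [IsInstrument, Fintype.sum_option] at hA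
    -- The certificate `⊥` is never accepted; dropping its effect leaves effects whose diagonals sum
    -- to at most one.
    obtain ⟨F₀, hF₀⟩ : ∃ F₀ : A.K → Matrix A.R (Option (Fin κ) → Bits m) ℂ, A.E none = F₀ :=
      ⟨A.E none, rfl⟩
    have hA : ∑ k, (F₀ k)ᴴ * F₀ k +
        ∑ z : Option (Fin κ) → Bits m, ∑ k, (F z k)ᴴ * F z k = 1 := by
      obtain rfl : (fun z => A.E (some z)) = F := funext hF
      subst hF₀
      exact hA
    have h := congrArg (fun M => (M u u).re) hA
    simp only [Matrix.add_apply, Complex.add_re, one_apply_eq, Complex.one_re] at h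
    have h0 : (∑ k, (F₀ k)ᴴ * F₀ k).PosSemidef :=
      posSemidef_sum _ fun k _ => posSemidef_conjTranspose_mul_self _
    have h1 := (Complex.le_def.mp (h0.diag_nonneg (i := u))).1
    rw [Complex.zero_re] at h1
    have hs : (∑ z, ∑ k, (F z k)ᴴ * F z k) u u = ∑ z, (∑ k, (F z k)ᴴ * F z k) u u :=
      Matrix.sum_apply _ _ _ _
    rw [hs, Complex.re_sum] at h
    exact le_of_add_le_of_nonneg_right h.le h1

lemma conjugateCoding_deletionSecure : conjugateCoding.DeletionSecure := by
  intro m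
  have hlim : Filter.Tendsto (fun κ : ℕ => 3 * 2 ^ m * (11 / 12 : ℝ) ^ κ) Filter.atTop
      (nhds (3 * 2 ^ m * 0)) :=
    (tendsto_pow_atTop_nhds_zero_of_lt_one (by norm_num) (by norm_num)).const_mul _
  rw [mul_zero] at hlim
  obtain ⟨κ₀, hκ₀⟩ := Filter.eventually_atTop.mp (hlim.eventually_le_const zero_lt_one)
  -- With `5/6 = (11/12) * (10/11)`, the powers of `11/12` swallow the constant `3 * 2 ^ m` from
  -- `κ₀` on, and those of `10/11` give the exponent.
  refine ⟨Real.logb 2 (11 / 10), Real.logb_pos (by norm_num) (by norm_num), κ₀,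
    fun κ hκ m' hm A s₀ s₁ => (conjugateCoding_traceDist_le A s₀ s₁).trans ?_⟩
  have h1 : (2 : ℝ) ^ (-(Real.logb 2 (11 / 10) * κ)) = (10 / 11) ^ κ := by
    rw [Real.rpow_neg (by norm_num), Real.rpow_mul (by norm_num),
      Real.rpow_logb (by norm_num) (by norm_num) (by norm_num), Real.rpow_natCast, ← inv_pow]
    norm_num
  have h2 : (5 / 6 : ℝ) ^ κ = (11 / 12) ^ κ * (10 / 11) ^ κ := by
    rw [← mul_pow]
    norm_num
  rw [h1, h2, ← mul_assoc]
  refine mul_le_of_le_one_left (by positivity) (le_trans ?_ (hκ₀ κ hκ))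
  gcongr
  norm_num

end Conjugate

end

end CertDel

namespace CertDel

noncomputable section

/-! ## A classical scheme for every access structure -/

section Classical

/-- A bijection between the two supports that `f` cannot detect transports one uniform distribution
to the other. -/
lemma map_uniformOfFinset_eq {α β : Type*} {s t : Finset α} (hs : s.Nonempty)
    (ht : t.Nonempty) (e : α ≃ α) (he : ∀ x, e x ∈ t ↔ x ∈ s) (f : α → β)
    (hf : ∀ x, f (e x) = f x) :
    (PMF.uniformOfFinset s hs).map f = (PMF.uniformOfFinset t ht).map f := by
  classical
  have hc : s.card = t.card :=
    Finset.card_equiv e fun x => (he x).symm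
  have h : (PMF.uniformOfFinset s hs).map e = PMF.uniformOfFinset t ht := by
    ext y
    rw [PMF.map_apply, tsum_eq_single (e.symm y)]
    · have := he (e.symm y)
      rw [Equiv.apply_symm_apply] at this
      simp only [PMF.uniformOfFinset_apply, this, hc, Equiv.apply_symm_apply, if_true]
    · intro x hx
      rw [if_neg]
      rintro rfl
      simp at hx
  rw [← h, PMF.map_comp]
  congr 1
  exact funext fun x => (hf x).symm

lemma PMF_map_eq_pure_of_forall {α β : Type*} {p : PMF α} {f : α → β} {b : β}
    (h : ∀ a ∈ p.support, f a = b) : p.map f = PMF.pure b := by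
  classical
  ext y
  rw [PMF.map_apply, PMF.pure_apply]
  have h' : ∀ a, (if y = f a then p a else 0) = if y = b then p a else 0 := by
    intro a
    by_cases ha : p a = 0
    · simp [ha]
    · rw [h a ((PMF.mem_support_iff _ _).mpr ha)]
  simp_rw [h']
  split_ifs
  · exact p.tsum_coe
  · exact tsum_zero

variable {n : ℕ}

/-- A share that holds one bit string for each set of parties. -/
def shareEquiv (n m : ℕ) :
    Bits (Fintype.card (Finset (Fin n)) * m) ≃ (Finset (Fin n) → Bits m) :=
  (Equiv.arrowCongr finProdFinEquiv.symm (Equiv.refl _)).trans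
    ((Equiv.curry _ _ _).trans
      (Equiv.arrowCongr (Fintype.equivFin (Finset (Fin n))).symm (Equiv.refl _)))

/-- The shares for which each authorized set holds an additive sharing of the secret. -/
def additiveShares (S : UpperSet (Finset (Fin n))) (m : ℕ) (s : Bits m) :
    Set (Fin n → Bits (Fintype.card (Finset (Fin n)) * m)) :=
  {sh | ∀ P ∈ S, ∑ i ∈ P, shareEquiv n m (sh i) P = s}

/-- The shares obtained by adding `D i P` to the entry of party `i` for each set `P`. -/
def addToShares (m : ℕ) (D : Fin n → Finset (Fin n) → Bits m) :
    (Fin n → Bits (Fintype.card (Finset (Fin n)) * m)) ≃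
      (Fin n → Bits (Fintype.card (Finset (Fin n)) * m)) :=
  (Equiv.piCongrRight fun _ => shareEquiv n m).trans
    ((Equiv.addRight D).trans (Equiv.piCongrRight fun _ => (shareEquiv n m).symm))

lemma addToShares_apply (m : ℕ) (D : Fin n → Finset (Fin n) → Bits m)
    (sh : Fin n → Bits (Fintype.card (Finset (Fin n)) * m)) (i : Fin n) :
    addToShares m D sh i = (shareEquiv n m).symm (shareEquiv n m (sh i) + D i) :=
  rfl

lemma addToShares_mem {S : UpperSet (Finset (Fin n))} {m : ℕ}
    {D : Fin n → Finset (Fin n) → Bits m} {d : Bits m} (hD : ∀ P ∈ S, ∑ i ∈ P, D i P = d)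
    (s : Bits m) (sh : Fin n → Bits (Fintype.card (Finset (Fin n)) * m)) :
    addToShares m D sh ∈ additiveShares S m (s + d) ↔ sh ∈ additiveShares S m s := by
  refine forall₂_congr fun P hP => ?_
  simp only [addToShares_apply, Equiv.apply_symm_apply, Pi.add_apply, Finset.sum_add_distrib,
    hD P hP, add_left_inj]

/-- A secret can be added to the shares of one party of each authorized set. -/
lemma exists_offset {S : UpperSet (Finset (Fin n))} {U : Finset (Fin n)} (hU : U ∉ S) {m : ℕ}
    (d : Bits m) : ∃ D : Fin n → Finset (Fin n) → Bits m,
      (∀ P ∈ S, ∑ i ∈ P, D i P = d) ∧ ∀ i ∈ U, D i = 0 := by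
  classical
  -- An authorized set contained in `U` would make `U` authorized, so some member outside `U` can
  -- carry the offset.
  have h : ∀ P ∈ S, ∃ i ∈ P, i ∉ U := fun P hP =>
    Finset.not_subset.mp fun h => hU (S.upper h hP)
  choose j hj hjU using h
  refine ⟨fun i P => if hP : P ∈ S then if i = j P hP then d else 0 else 0, fun P hP => ?_,
    fun i hi => funext fun P => ?_⟩
  · simp [hP, hj P hP]
  · dsimp only
    split_ifs with hP h
    · exact absurd (h ▸ hi) (hjU P hP)
    · rfl
    · rfl

/-- An offset moves the zero shares, which share the secret `0`, to shares of `s`. The empty set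
must be unauthorized, since an empty sum cannot equal a nonzero secret. -/
lemma additiveShares_nonempty {S : UpperSet (Finset (Fin n))} (hS : ∅ ∉ S) (m : ℕ) (s : Bits m) :
    (additiveShares S m s).toFinite.toFinset.Nonempty := by
  rw [Set.Finite.toFinset_nonempty]
  obtain ⟨D, hD, -⟩ := exists_offset hS s
  refine ⟨addToShares m D fun _ => (shareEquiv n m).symm 0, ?_⟩
  have := (addToShares_mem hD 0 fun _ => (shareEquiv n m).symm 0).mpr fun P _ => by simp
  rwa [zero_add] at this

open Classical in
/-- The classical scheme that shares the secret additively among the parties of each authorized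
set. -/
def additiveScheme (S : UpperSet (Finset (Fin n))) (hS : ∅ ∉ S) : ClassicalScheme n where
  shareLen m _ := Fintype.card (Finset (Fin n)) * m
  split m s := PMF.uniformOfFinset (additiveShares S m s).toFinite.toFinset
    (additiveShares_nonempty hS m s)
  reconstruct m P sh := if P ∈ S then some (∑ i, shareEquiv n m (sh i) P) else none

lemma additiveScheme_correct (S : UpperSet (Finset (Fin n))) (hS : ∅ ∉ S) :
    (additiveScheme S hS).Correct S := by
  intro m s P hP
  refine PMF_map_eq_pure_of_forall fun sh hsh => ?_
  have hs : sh ∈ additiveShares S m s :=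
    (Set.Finite.mem_toFinset _).mp ((PMF.mem_support_uniformOfFinset_iff
      (additiveShares_nonempty hS m s) _).mp hsh)
  refine (if_pos hP).trans ?_
  rw [Finset.sum_coe_sort P fun i => shareEquiv n m (sh i) P, hs P hP]

/-- An offset that vanishes on `U` maps the sharings of `s` bijectively to those of `s + s = 0`
without changing what `U` sees, so a sharing of `0` simulates its view. -/
lemma additiveScheme_private (S : UpperSet (Finset (Fin n))) (hS : ∅ ∉ S) :
    (additiveScheme S hS).Private S := by
  refine ⟨fun m U => ((additiveScheme S hS).split m 0).map fun sh => fun i : U => sh i,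
    fun m U hU s => ?_⟩
  obtain ⟨D, hD, hDU⟩ := exists_offset hU s
  refine map_uniformOfFinset_eq (additiveShares_nonempty hS m s)
    (additiveShares_nonempty hS m 0) (addToShares m D) (fun sh => ?_) _ fun sh => funext fun i => ?_
  · rw [Set.Finite.mem_toFinset, Set.Finite.mem_toFinset, ← addToShares_mem hD s, bits_add_self]
  · rw [addToShares_apply, hDU i i.2, add_zero, Equiv.symm_apply_apply]

end Classical

end

end CertDel

theorem mainTheorem1 :
    (∀ T : CertDel.TwoOfTwo, T.Correct → T.DeletionCorrect →
      ∀ (n : ℕ) (S : UpperSet (Finset (Fin n))) (C : CertDel.ClassicalScheme n),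
        C.Correct S → C.Private S →
        (∀ m : ℕ, (CertDel.compile C T m).ReconstructionCorrect S ∧
          (CertDel.compile C T m).DeletionCorrect) ∧
        (T.DeletionSecure → ∀ m : ℕ, (CertDel.compile C T m).NSCDSecure S)) ∧
    (∀ (T : CertDel.TwoOfTwo) (L : ℕ → ℕ), T.DeletionSecureUpTo L →
      ∃ ε : ℕ → ℝ, CertDel.Negligible ε ∧
        ∀ (n : ℕ) (S : UpperSet (Finset (Fin n))) (C : CertDel.ClassicalScheme n),
          C.Private S → ∀ m sec : ℕ, (∀ i, C.shareLen m i ≤ L (max sec n ^ 2)) →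
            (CertDel.compile C T m).NSCDAdvantageLE S sec (ε sec)) ∧
    (∃ T : CertDel.TwoOfTwo,
      T.Correct ∧ T.Private ∧ T.DeletionCorrect ∧ T.DeletionSecure ∧
      ∀ (n : ℕ) (S : UpperSet (Finset (Fin n))), ∅ ∉ S →
        ∃ C : CertDel.ClassicalScheme n, C.Correct S ∧ C.Private S ∧
          ∀ m : ℕ, (CertDel.compile C T m).ReconstructionCorrect S ∧
            (CertDel.compile C T m).DeletionCorrect ∧
            (CertDel.compile C T m).NSCDSecure S) := by
  refine ⟨fun T hT hD n S C hC hP => ⟨fun m => ⟨CertDel.compile_reconstructionCorrect hT hC,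
    CertDel.compile_deletionCorrect hD⟩,
    fun hs m => CertDel.compile_nscdSecure hs hP m⟩,
    fun T L hT => CertDel.exists_negligible_bound T L hT,
    CertDel.conjugateCoding, CertDel.conjugateCoding_correct, CertDel.conjugateCoding_private,
    CertDel.conjugateCoding_deletionCorrect, CertDel.conjugateCoding_deletionSecure,
    fun n S hS => ⟨CertDel.additiveScheme S hS, CertDel.additiveScheme_correct S hS,
      CertDel.additiveScheme_private S hS, fun m => ⟨?_, ?_, ?_⟩⟩⟩
  · exact CertDel.compile_reconstructionCorrect CertDel.conjugateCoding_correct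
      (CertDel.additiveScheme_correct S hS)
  · exact CertDel.compile_deletionCorrect CertDel.conjugateCoding_deletionCorrect
  · exact CertDel.compile_nscdSecure CertDel.conjugateCoding_deletionSecure
      (CertDel.additiveScheme_private S hS) m
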